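/- A parameterized problem is a set $Q\subseteq\Sigma^*\times\mathbb{N}$ for a finite alphabet $\Sigma$. A pl-reduction from $Q$ to $Q'$ is a map $R:(x,k)\mapsto(x',k')$ such that $(x,k)\in Q \iff (x',k')\in Q'$, $k'\le g(k)$ for a computable function $g$, and $R$ is computed by a deterministic Turing machine (read-only input, write-only output) using work space $f(k)+O(\log|x|)$ for a computable function $f$. A rooted forest $F$ on the vertex set of a graph $G$ is an elimination forest of $G$ if for each edge $uv$ of $G$ one of $u,v$ is an ancestor of the other in $F$; its depth is the maximum number of vertices on a root-to-leaf path. In BinCSP parameterized by treedepth the input consists of a graph $G$, a finite domain $D(u)$ for each vertex $u$, a constraint $C(u,v)\subseteq D(u)\times D(v)$ for each edge $uv$ (with $C(v,u)$ the converse of $C(u,v)$), and an elimination forest of $G$ of depth at most $k$, where $k$ is the parameter; the question is whether there is an assignment $\eta$ with $\eta(u)\in D(u)$ for every vertex $u$ and $(\eta(u),\eta(v))\in C(u,v)$ for every edge $uv$. In List Coloring parameterized by treedepth the input consists of a graph $G$, a finite list $L(u)$ of colors for each vertex $u$, and an elimination forest of $G$ of depth at most $k$, where $k$ is the parameter; the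 question is whether there is a map $f$ with $f(u)\in L(u)$ for every vertex $u$ and $f(u)\ne f(v)$ for every edge $uv$. Words that do not encode such an input are no-instances. Let $\mathrm{XSLP}$ be the class of all parameterized problems that are pl-reducible to BinCSP parameterized by treedepth. **Corollary.** List Coloring parameterized by treedepth is $\mathrm{XSLP}$-complete: it belongs to $\mathrm{XSLP}$, and every problem in $\mathrm{XSLP}$ is pl-reducible to it. -/

import Mathlib

namespace ParamCplx

/-! ### Deterministic Turing machines with a separate work space -/

/-- A head movement. -/
inductive Move : Type
  | left
  | stay
  | right

/-- What the input head scans: a symbol of the input or one of the two end markers. -/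
inductive Scan (α : Type) : Type
  | leftEnd
  | sym (a : α)
  | rightEnd

/-- A deterministic Turing machine transducer with a two-way read-only input tape over `α`,
finitely many work tapes (indexed by `Tp`, infinite to the right, over the finite alphabet `Γ`) and
a write-only output tape over `β`.  In one step the machine reads the scanned cells; it either
halts (`none`), or it changes its state, moves the input head, writes and moves on every work tape,
and possibly appends one symbol to the output. -/
structure Transducer (α β : Type) where
  State : Type
  [finiteState : Finite State]
  Tp : Type
  [finiteTp : Finite Tp]
  Γ : Type
  [finiteΓ : Finite Γ]
  blank : Γ
  start : State
  δ : State → Scan α → (Tp → Γ) → Option (State × Move × (Tp → Γ × Move) × Option β)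

namespace Transducer

variable {α β : Type}

/-- A configuration.  `inPos = 0` is the left end marker of the input, `inPos = i + 1` is the
`i`-th input symbol, and `inPos = length + 1` is the right end marker. -/
structure Cfg (M : Transducer α β) where
  state : M.State
  inPos : ℕ
  work : M.Tp → ℕ → M.Γ
  pos : M.Tp → ℕ
  out : List β

/-- The cell of the input tape at a given position. -/
def scan (w : List α) : ℕ → Scan α
  | 0 => Scan.leftEnd
  | i + 1 => match w[i]? with
    | some a => Scan.sym a
    | none => Scan.rightEnd

/-- Movement on a tape that is infinite to the right (a left move in the first cell has no
effect). -/
def moveHead : Move → ℕ → ℕ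
  | Move.left, p => p - 1
  | Move.stay, p => p
  | Move.right, p => p + 1

/-- The initial configuration: all work tapes are blank and all heads are at the left end. -/
def init (M : Transducer α β) : M.Cfg where
  state := M.start
  inPos := 0
  work := fun _ _ => M.blank
  pos := fun _ => 0
  out := []

/-- One step on the input `w`; `none` if the machine has halted.  The input head never leaves the
part of the input tape that is delimited by the end markers. -/
def step (M : Transducer α β) (w : List α) (c : M.Cfg) : Option M.Cfg :=
  (M.δ c.state (scan w c.inPos) (fun t => c.work t (c.pos t))).map fun r =>
    { state := r.1
      inPos := min (moveHead r.2.1 c.inPos) (w.length + 1)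
      work := fun t => Function.update (c.work t) (c.pos t) (r.2.2.1 t).1
      pos := fun t => moveHead (r.2.2.1 t).2 (c.pos t)
      out := c.out ++ r.2.2.2.toList }

/-- The configuration `c` occurs in the computation of `M` on the input `w`. -/
def Reaches (M : Transducer α β) (w : List α) (c : M.Cfg) : Prop :=
  StateTransition.Reaches (M.step w) M.init c

/-- On the input `w` the machine halts with output `v`. -/
def Outputs (M : Transducer α β) (w : List α) (v : List β) : Prop :=
  ∃ c, M.Reaches w c ∧ M.step w c = none ∧ c.out = v

/-- During the computation on the input `w`, only the first `s` cells of each work tape are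
visited. -/
def UsesSpace (M : Transducer α β) (w : List α) (s : ℕ) : Prop :=
  ∀ c, M.Reaches w c → ∀ t, c.pos t < s

end Transducer

/-! ### Parameterized problems and parameterized logspace reductions -/

/-- A parameterized problem over the alphabet `α`: a set of pairs `(x, k)`, where `x` is a word and
`k` is the parameter. -/
abbrev ParamProblem (α : Type) : Type := Set (List α × ℕ)

/-- The word on a tape that stands for `(x, k)`: the word `x` followed by `k` tally marks
(`none` is the tally mark). -/
def tapeWord {α : Type} (z : List α × ℕ) : List (Option α) :=
  z.1.map some ++ List.replicate z.2 none

/-- The map `R` is computable in parameterized logspace: a deterministic Turing machine computes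
it in space `f(k) + O(log n)` on inputs `(x, k)` with `|x| = n`, where `f` is computable. -/
def PLComputable {α β : Type} (R : List α × ℕ → List β × ℕ) : Prop :=
  ∃ (M : Transducer (Option α) (Option β)) (f : ℕ → ℕ) (c : ℕ), Computable f ∧
    ∀ z : List α × ℕ, M.Outputs (tapeWord z) (tapeWord (R z)) ∧
      M.UsesSpace (tapeWord z) (f z.2 + c * Nat.log 2 z.1.length)

/-- `P` is pl-reducible to `Q`: there is a parameterized reduction (it preserves and reflects
membership, and the new parameter is bounded by a computable function of the old one) that is
computable in parameterized logspace. -/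
def PLReducible {α β : Type} (P : ParamProblem α) (Q : ParamProblem β) : Prop :=
  ∃ R : List α × ℕ → List β × ℕ,
    (∀ z, z ∈ P ↔ R z ∈ Q) ∧
    (∃ g : ℕ → ℕ, Computable g ∧ ∀ z, (R z).2 ≤ g z.2) ∧
    PLComputable R

/-! ### Elimination forests -/

/-- The `j`-th iterate of a partial parent map. -/
def climb {V : Type} (parent : V → Option V) : ℕ → V → Option V
  | 0, v => some v
  | j + 1, v => (climb parent j v).bind parent

/-- A rooted forest on the vertex set `V`, given by its parent map (`none` at the roots); starting
anywhere and going from parent to parent, one runs past a root after finitely many steps. -/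
structure RootedForest (V : Type) where
  parent : V → Option V
  acyclic : ∀ v, ∃ j, climb parent j v = none

namespace RootedForest

variable {V : Type}

/-- `u` is an ancestor of `v` (each vertex is an ancestor of itself). -/
def IsAncestor (F : RootedForest V) (u v : V) : Prop := ∃ j, climb F.parent j v = some u

open Classical in
/-- The number of vertices on the path from `v` to the root above it. -/
noncomputable def level (F : RootedForest V) (v : V) : ℕ := Nat.find (F.acyclic v)

/-- The depth of a rooted forest: the maximum number of vertices on a path from a root to a
leaf. -/
noncomputable def depth [Fintype V] (F : RootedForest V) : ℕ := Finset.univ.sup F.level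

/-- `F` is an elimination forest of `G`. -/
def IsEliminationForest (F : RootedForest V) (G : SimpleGraph V) : Prop :=
  ∀ u v, G.Adj u v → F.IsAncestor u v ∨ F.IsAncestor v u

end RootedForest

/-! ### Binary CSP and List Coloring -/

/-- A BinCSP instance with variable set `V` and values from `A`: the Gaifman graph `G`, the domains
`D u`, and, for each edge `uv` of `G`, a constraint `C u v ⊆ D u × D v`, where `C v u` is the
converse of `C u v`.  (The value of `C u v` is irrelevant when `uv` is not an edge.) -/
structure BinCSP (V A : Type) where
  G : SimpleGraph V
  D : V → Finset A
  C : V → V → Finset (A × A)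
  C_sub : ∀ u v, G.Adj u v → ∀ a b, (a, b) ∈ C u v → a ∈ D u ∧ b ∈ D v
  C_symm : ∀ u v, G.Adj u v → ∀ a b, (a, b) ∈ C u v ↔ (b, a) ∈ C v u

/-- There is a satisfying assignment. -/
def BinCSP.Satisfiable {V A : Type} (I : BinCSP V A) : Prop :=
  ∃ η : V → A, (∀ u, η u ∈ I.D u) ∧ ∀ u v, I.G.Adj u v → (η u, η v) ∈ I.C u v

/-- A List Coloring instance with vertex set `V` and colors from `A`. -/
structure ListColoring (V A : Type) where
  G : SimpleGraph V
  L : V → Finset A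

/-- There is a proper coloring from the lists. -/
def ListColoring.Colorable {V A : Type} (I : ListColoring V A) : Prop :=
  ∃ f : V → A, (∀ u, f u ∈ I.L u) ∧ ∀ u v, I.G.Adj u v → f u ≠ f v

/-! ### Encoding of instances by bit strings

An instance with vertices `0, …, n - 1` and values (colors) `0, …, m - 1` is written as `n` and
`m` in unary, followed by the truth tables of the relations that it consists of. -/

/-- `n` ones and a zero. -/
def unary (n : ℕ) : List Bool := List.replicate n true ++ [false]

open Classical in
/-- The truth table of a binary relation, row by row. -/
noncomputable def table {n m : ℕ} (r : Fin n → Fin m → Prop) : List Bool :=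
  (List.finRange n).flatMap fun i => (List.finRange m).map fun j => decide (r i j)

/-- The parent relation of a rooted forest as a truth table. -/
noncomputable def RootedForest.encode {n : ℕ} (F : RootedForest (Fin n)) : List Bool :=
  table fun u v => F.parent u = some v

/-- The encoding of a BinCSP instance together with a rooted forest. -/
noncomputable def BinCSP.encode {n m : ℕ} (I : BinCSP (Fin n) (Fin m)) (F : RootedForest (Fin n)) :
    List Bool :=
  unary n ++ unary m ++ table I.G.Adj ++ F.encode ++ (table fun u a => a ∈ I.D u) ++
    (List.finRange n).flatMap fun u => (List.finRange n).flatMap fun v =>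
      table fun a b => I.G.Adj u v ∧ (a, b) ∈ I.C u v

/-- The encoding of a List Coloring instance together with a rooted forest. -/
noncomputable def ListColoring.encode {n m : ℕ} (I : ListColoring (Fin n) (Fin m))
    (F : RootedForest (Fin n)) : List Bool :=
  unary n ++ unary m ++ table I.G.Adj ++ F.encode ++ table fun u a => a ∈ I.L u

/-- BinCSP parameterized by treedepth: given a BinCSP instance and an elimination forest of its
Gaifman graph of depth at most `k`, where `k` is the parameter, decide whether the instance is
satisfiable. -/
def binCSPTreedepth : ParamProblem Bool :=
  {z | ∃ (n m : ℕ) (I : BinCSP (Fin n) (Fin m)) (F : RootedForest (Fin n)),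
    F.IsEliminationForest I.G ∧ F.depth ≤ z.2 ∧ z.1 = I.encode F ∧ I.Satisfiable}

/-- List Coloring parameterized by treedepth: given a List Coloring instance and an elimination
forest of its graph of depth at most `k`, where `k` is the parameter, decide whether there is a
proper coloring from the lists. -/
def listColoringTreedepth : ParamProblem Bool :=
  {z | ∃ (n m : ℕ) (I : ListColoring (Fin n) (Fin m)) (F : RootedForest (Fin n)),
    F.IsEliminationForest I.G ∧ F.depth ≤ z.2 ∧ z.1 = I.encode F ∧ I.Colorable}

/-! ### The class XSLP -/

/-- The class XSLP: the closure of BinCSP parameterized by treedepth under pl-reductions. -/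
def InXSLP {α : Type} (P : ParamProblem α) : Prop := PLReducible P binCSPTreedepth

/-- `P` is XSLP-complete (under pl-reductions): it belongs to XSLP, and every parameterized problem
in XSLP, over any finite alphabet, is pl-reducible to it. -/
def XSLPComplete {α : Type} (P : ParamProblem α) : Prop :=
  InXSLP P ∧ ∀ (β : Type) [Finite β] (Q : ParamProblem β), InXSLP Q → PLReducible Q P

end ParamCplx

/-! Membership in XSLP is immediate mathematically: a List Coloring instance is a binary CSP on the
same graph, forest and lists whose constraints say that adjacent values differ
(`mem_binCSPTreedepth_differCon`).

For hardness, let a CSP with `n` variables and `m` values be given with an elimination forest. The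
colors are pairs (variable, value), coded as `x * m + a`, and the list of a variable `u` contains
only pairs with first entry `u`; hence edges between variables are harmless. For each edge `uv` with
`v` above `u` in the forest and each forbidden pair `(a, b)`, a gadget vertex adjacent to `u` and
`v` has the list `{(u, a), (v, b)}`. It can be colored exactly when `u` and `v` do not take the
values `a` and `b` together. Hung as a leaf below `u`, it has both neighbours as ancestors, so the
depth grows by at most one. All `n * n * m * m` gadgets are present, so that they can be numbered
arithmetically; inactive ones are isolated. The two directions are `binCSP_mem_of_gadget_mem` and
`gadget_mem_of_binCSP_mem`.

Every problem in XSLP comes with a reduction to BinCSP, so it remains to compose that reduction with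
the gadget map in parameterized logspace. The intermediate word is too long to be stored; each time
one of its symbols is needed, the first machine is run again from the start and its output is
counted. Since a halting machine repeats no configuration, the word has length at most exponential
in `f k + log |x|` up to constant factors (`Transducer.Outputs.length_lt`), so binary counters for
numbers polynomial in this length fit into the allowed space. This is `plComputable_comp`.

The machines are obtained in layers: `Prog` has single transducer steps as actions, `Cmd` has
registers kept as binary counters and the command `pass` that reruns the first machine, and `LS`,
`LP`, `LSO` are closure calculi for functions, predicates and outputs with polynomially bounded
registers. Both reductions are written in these calculi. -/

namespace ParamCplx

/-! ### Structured programs for transducers -/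

/-- The memory of a transducer: everything in a configuration but the state. -/
structure Store (β T Γ : Type) where
  inPos : ℕ
  work : T → ℕ → Γ
  pos : T → ℕ
  out : List β

namespace Store

variable {α β T Γ : Type}

/-- The symbols under the heads of the work tapes. -/
def heads (c : Store β T Γ) : T → Γ := fun t => c.work t (c.pos t)

/-- The effect of one transducer step on the memory. -/
def apply (w : List α) (c : Store β T Γ) (r : Move × (T → Γ × Move) × Option β) : Store β T Γ where
  inPos := min (Transducer.moveHead r.1 c.inPos) (w.length + 1)
  work := fun t => Function.update (c.work t) (c.pos t) (r.2.1 t).1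
  pos := fun t => Transducer.moveHead (r.2.1 t).2 (c.pos t)
  out := c.out ++ r.2.2.toList

/-- All heads are within the allotted space. -/
def Within (w : List α) (s : ℕ) (c : Store β T Γ) : Prop :=
  c.inPos ≤ w.length + 1 ∧ ∀ t, c.pos t < s

end Store

/-- Structured programs whose elementary actions are single steps of a transducer. -/
inductive Prog (α β T Γ : Type) : Type
  | act (f : Scan α → (T → Γ) → Move × (T → Γ × Move) × Option β)
  | seq (p q : Prog α β T Γ)
  | ite (b : Scan α → (T → Γ) → Prop) (p q : Prog α β T Γ)
  | loop (b : Scan α → (T → Γ) → Prop) (p : Prog α β T Γ)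

namespace Prog

variable {α β T Γ : Type}

/-- The step that changes nothing. -/
def idle (g : T → Γ) : Move × (T → Γ × Move) × Option β :=
  (Move.stay, fun t => (g t, Move.stay), none)

open Classical in
/-- One step of the machine whose control is a list of programs to be executed one after the
other. -/
noncomputable def next : List (Prog α β T Γ) → Scan α → (T → Γ) →
    Option (List (Prog α β T Γ) × Move × (T → Γ × Move) × Option β)
  | [], _, _ => none
  | act f :: k, s, g => some (k, f s g)
  | seq p q :: k, _, g => some (p :: q :: k, idle g)
  | ite b p q :: k, s, g => some ((if b s g then p else q) :: k, idle g)
  | loop b p :: k, s, g => some (if b s g then p :: loop b p :: k else k, idle g)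

/-- The control lists that may occur between the start of `p` and its end, if `k` has to be
executed afterwards. -/
def conts : Prog α β T Γ → List (Prog α β T Γ) → Set (List (Prog α β T Γ))
  | act f, k => {act f :: k}
  | seq p q, k => insert (seq p q :: k) (conts p (q :: k) ∪ conts q k)
  | ite b p q, k => insert (ite b p q :: k) (conts p k ∪ conts q k)
  | loop b p, k => insert (loop b p :: k) (conts p (loop b p :: k))

theorem cons_mem_conts (p : Prog α β T Γ) (k : List (Prog α β T Γ)) : p :: k ∈ conts p k := by
  cases p <;> simp [conts]

/-- What remains to be executed is determined by the position reached in the program text, because a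
loop returns to the list it started from. The finitely many lists serve as the states of the
transducer. -/
theorem finite_conts (p : Prog α β T Γ) (k : List (Prog α β T Γ)) : (conts p k).Finite := by
  induction p generalizing k with
  | act f => simp [conts]
  | seq p q hp hq => exact ((hp _).union (hq _)).insert _
  | ite b p q hp hq => exact ((hp _).union (hq _)).insert _
  | loop b p hp => exact (hp _).insert _

theorem next_mem_conts (p : Prog α β T Γ) (k l l' : List (Prog α β T Γ)) (s : Scan α) (g : T → Γ)
    (r : Move × (T → Γ × Move) × Option β) (hl : l ∈ conts p k)
    (h : next l s g = some (l', r)) : l' ∈ conts p k ∨ l' = k := by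
  induction p generalizing k with
  | act f =>
    simp only [conts, Set.mem_singleton_iff] at hl
    subst hl
    simp only [next, Option.some.injEq, Prod.mk.injEq] at h
    exact Or.inr h.1.symm
  | seq p q hp hq =>
    rcases hl with rfl | hl | hl
    · simp only [next, Option.some.injEq, Prod.mk.injEq] at h
      rw [← h.1]
      exact Or.inl (Or.inr (Or.inl (cons_mem_conts _ _)))
    · rcases hp _ hl with h | rfl
      · exact Or.inl (Or.inr (Or.inl h))
      · exact Or.inl (Or.inr (Or.inr (cons_mem_conts _ _)))
    · exact (hq _ hl).imp_left fun h => Or.inr (Or.inr h)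
  | ite b p q hp hq =>
    rcases hl with rfl | hl | hl
    · simp only [next, Option.some.injEq, Prod.mk.injEq] at h
      rw [← h.1]
      split_ifs
      · exact Or.inl (Or.inr (Or.inl (cons_mem_conts _ _)))
      · exact Or.inl (Or.inr (Or.inr (cons_mem_conts _ _)))
    · exact (hp _ hl).imp_left fun h => Or.inr (Or.inl h)
    · exact (hq _ hl).imp_left fun h => Or.inr (Or.inr h)
  | loop b p hp =>
    rcases hl with rfl | hl
    · simp only [next, Option.some.injEq, Prod.mk.injEq] at h
      rw [← h.1]
      split_ifs
      · exact Or.inl (Or.inr (cons_mem_conts _ _))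
      · exact Or.inr rfl
    · rcases hp _ hl with h | rfl
      · exact Or.inl (Or.inr h)
      · exact Or.inl (Or.inl rfl)

/-- The control lists that may occur in the execution of `p`. -/
abbrev Ctrl (p : Prog α β T Γ) : Type := {l : List (Prog α β T Γ) // l ∈ conts p [] ∨ l = []}

theorem next_mem_ctrl (p : Prog α β T Γ) (l : Ctrl p) (s : Scan α) (g : T → Γ)
    (x : List (Prog α β T Γ) × Move × (T → Γ × Move) × Option β)
    (h : next l.1 s g = some x) : x.1 ∈ conts p [] ∨ x.1 = [] := by
  obtain ⟨l, hl | rfl⟩ := l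
  · exact next_mem_conts p [] l x.1 s g x.2 hl h
  · simp [next] at h

instance (p : Prog α β T Γ) : Finite (Ctrl p) :=
  ((finite_conts p []).union (Set.finite_singleton [])).to_subtype

/-- The transducer that executes a program. -/
noncomputable def toTransducer [Finite T] [Finite Γ] (blank : Γ) (p : Prog α β T Γ) :
    Transducer α β where
  State := Ctrl p
  Tp := T
  Γ := Γ
  blank := blank
  start := ⟨[p], Or.inl (cons_mem_conts p [])⟩
  δ := fun l s g => (next l.1 s g).pmap
    (fun x hx => (⟨x.1, hx⟩, x.2)) (fun x hx => next_mem_ctrl p l s g x hx)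

/-- Execution of a program on the input `w`, where all heads remain within space `s`. -/
inductive Exec (w : List α) (s : ℕ) : Prog α β T Γ → Store β T Γ → Store β T Γ → Prop
  | act {f c} (h : c.Within w s) :
      Exec w s (act f) c (c.apply w (f (Transducer.scan w c.inPos) c.heads))
  | seq {p q c c' c''} : Exec w s p c c' → Exec w s q c' c'' → Exec w s (seq p q) c c''
  | ite_pos {b p q c c'} (h : b (Transducer.scan w c.inPos) c.heads) :
      Exec w s p c c' → Exec w s (ite b p q) c c'
  | ite_neg {b p q c c'} (h : ¬ b (Transducer.scan w c.inPos) c.heads) :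
      Exec w s q c c' → Exec w s (ite b p q) c c'
  | loop_pos {b p c c' c''} (h : b (Transducer.scan w c.inPos) c.heads) :
      Exec w s p c c' → Exec w s (loop b p) c' c'' → Exec w s (loop b p) c c''
  | loop_neg {b p c} (h : ¬ b (Transducer.scan w c.inPos) c.heads) (hc : c.Within w s) :
      Exec w s (loop b p) c c

/-- Each rule demands or inherits the space bound at its start. Nothing is claimed about the final
store, which `Exec.outputs` treats separately. -/
theorem Exec.within {w : List α} {s : ℕ} {p : Prog α β T Γ} {c c' : Store β T Γ}
    (h : Exec w s p c c') : c.Within w s := by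
  induction h <;> assumption

/-- A finite computation path whose configurations, except possibly the last one, satisfy `P`. -/
inductive Path {σ : Type} (step : σ → Option σ) (P : σ → Prop) : σ → σ → Prop
  | refl (a : σ) : Path step P a a
  | head {a b c : σ} (ha : P a) (h : step a = some b) : Path step P b c → Path step P a c

theorem Path.trans {σ : Type} {step : σ → Option σ} {P : σ → Prop} {a b c : σ}
    (h : Path step P a b) (h' : Path step P b c) : Path step P a c := by
  induction h with
  | refl => exact h'
  | head ha hs _ ih => exact Path.head ha hs (ih h')

theorem Path.reaches {σ : Type} {step : σ → Option σ} {P : σ → Prop} {a b : σ}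
    (h : Path step P a b) : StateTransition.Reaches step a b := by
  induction h with
  | refl => exact Relation.ReflTransGen.refl
  | head ha hs _ ih => exact Relation.ReflTransGen.head hs ih

/-- Steps are deterministic, so a computation that ends in a halting configuration visits only
points of the path. A bound along one execution thus becomes a bound on all reachable
configurations. -/
theorem Path.forall_reaches {σ : Type} {step : σ → Option σ} {P : σ → Prop} {a b c : σ}
    (h : Path step P a b) (hb : step b = none) (hP : P b)
    (hc : StateTransition.Reaches step a c) : P c := by
  induction h with
  | refl a =>
    rcases Relation.ReflTransGen.cases_head hc with rfl | ⟨d, hd, _⟩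
    · exact hP
    · simp [hb] at hd
  | @head a b' e ha hs _ ih =>
    rcases Relation.ReflTransGen.cases_head hc with rfl | ⟨d, hd, hdc⟩
    · exact ha
    · have : d = b' := by simpa [hs] using hd.symm
      subst this
      exact ih hb hP hdc

/-- The step function on control lists and stores. -/
noncomputable def cstep (w : List α) (x : List (Prog α β T Γ) × Store β T Γ) :
    Option (List (Prog α β T Γ) × Store β T Γ) :=
  (next x.1 (Transducer.scan w x.2.inPos) x.2.heads).map fun r => (r.1, x.2.apply w r.2)

/-- Every step clamps the input position to the right end marker, even if no head moves; this is why
`Within` also bounds the input head. -/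
theorem apply_idle {w : List α} {s : ℕ} {c : Store β T Γ} (h : c.Within w s) :
    c.apply w (idle c.heads) = c := by
  cases c
  simp only [Store.apply, idle, Store.heads, Transducer.moveHead, Option.toList_none,
    List.append_nil, Function.update_eq_self, Store.mk.injEq, and_true]
  exact min_eq_left h.1

/-- Big-step execution is traced by single steps; the bookkeeping steps for `seq`, `ite` and `loop`
leave the store alone. The arbitrary continuation `k` lets the induction pass through sequencing. -/
theorem Exec.path {w : List α} {s : ℕ} {p : Prog α β T Γ} {c c' : Store β T Γ}
    (h : Exec w s p c c') (k : List (Prog α β T Γ)) :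
    Path (cstep w) (fun x => x.2.Within w s) (p :: k, c) (k, c') := by
  induction h generalizing k with
  | act h => exact Path.head h rfl (Path.refl _)
  | @seq p q c c' c'' hp hq ihp ihq =>
    refine Path.head hp.within (b := (p :: q :: k, c)) ?_ ((ihp _).trans (ihq _))
    simp [cstep, next, apply_idle hp.within]
  | @ite_pos b p q c c' h hp ihp =>
    refine Path.head hp.within (b := (p :: k, c)) ?_ (ihp _)
    simp [cstep, next, apply_idle hp.within, h]
  | @ite_neg b p q c c' h hp ihp =>
    refine Path.head hp.within (b := (q :: k, c)) ?_ (ihp _)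
    simp [cstep, next, apply_idle hp.within, h]
  | @loop_pos b p c c' c'' h hp hq ihp ihq =>
    refine Path.head hp.within (b := (p :: loop b p :: k, c)) ?_ ((ihp _).trans (ihq _))
    simp [cstep, next, apply_idle hp.within, h]
  | @loop_neg b p c h hc =>
    refine Path.head hc (b := (k, c)) ?_ (Path.refl _)
    simp [cstep, next, apply_idle hc, h]

section
variable [Finite T] [Finite Γ] (blank : Γ) (p : Prog α β T Γ)

/-- The configuration of the transducer with a given control and memory. -/
def toCfg (l : Ctrl p) (c : Store β T Γ) : (toTransducer blank p).Cfg where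
  state := l
  inPos := c.inPos
  work := c.work
  pos := c.pos
  out := c.out

theorem step_toCfg (w : List α) (l : Ctrl p) (c : Store β T Γ) :
    (toTransducer blank p).step w (toCfg blank p l c) =
      (next l.1 (Transducer.scan w c.inPos) c.heads).pmap
        (fun x hx => toCfg blank p ⟨x.1, hx⟩ (c.apply w x.2))
        (fun x hx => next_mem_ctrl p l _ _ x hx) := by
  simp only [Transducer.step, toTransducer, toCfg, Option.map_pmap]
  rfl

theorem Path.toCfg {w : List α} {s : ℕ} {x y : List (Prog α β T Γ) × Store β T Γ}
    (h : Path (cstep w) (fun x => x.2.Within w s) x y) (hx : x.1 ∈ conts p [] ∨ x.1 = []) :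
    ∃ hy : y.1 ∈ conts p [] ∨ y.1 = [],
      Path ((toTransducer blank p).step w) (fun c => ∀ t, c.pos t < s)
        (toCfg blank p ⟨x.1, hx⟩ x.2) (toCfg blank p ⟨y.1, hy⟩ y.2) := by
  induction h with
  | refl a => exact ⟨hx, Path.refl _⟩
  | @head a b c ha hs _ ih =>
    simp only [cstep, Option.map_eq_some_iff] at hs
    obtain ⟨r, hr, rfl⟩ := hs
    obtain ⟨hy, hpath⟩ := ih (next_mem_ctrl p ⟨a.1, hx⟩ _ _ r hr)
    refine ⟨hy, Path.head ha.2 ?_ hpath⟩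
    rw [step_toCfg]
    simp [hr]

/-- A terminating execution of a program yields the output of the transducer and a bound on the
space that it uses. -/
theorem Exec.outputs {w : List α} {s : ℕ} {c : Store β T Γ}
    (h : Exec w s p ⟨0, fun _ _ => blank, fun _ => 0, []⟩ c) (hc : ∀ t, c.pos t < s) :
    (toTransducer blank p).Outputs w c.out ∧ (toTransducer blank p).UsesSpace w s := by
  obtain ⟨hy, hpath⟩ := Path.toCfg blank p (h.path []) (Or.inl (cons_mem_conts p []))
  have hend : (toTransducer blank p).step w (Prog.toCfg blank p ⟨[], hy⟩ c) = none := by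
    rw [step_toCfg]
    simp [next]
  exact ⟨⟨_, hpath.reaches, hend, rfl⟩, fun d hd => hpath.forall_reaches hend hc hd⟩

end

end Prog


/-! ### Binary counters on work tapes -/

/-- The tape symbols of a machine with counters that simulates another machine: `mark` is the left
end of a counter and tells whether the counter is positive, `bit` is a binary digit, `cell` is a
cell of a simulated tape (with a flag for the first cell), `state` is a state of the control of the
simulated machine. -/
inductive Sym (Γ S : Type) : Type
  | blank
  | mark (b : Bool)
  | bit (b : Bool)
  | cell (first : Bool) (g : Γ)
  | state (q : S)

instance {Γ S : Type} [Finite Γ] [Finite S] : Finite (Sym Γ S) := by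
  refine Finite.of_surjective
    (fun x : Unit ⊕ Bool ⊕ Bool ⊕ (Bool × Γ) ⊕ S => match x with
      | .inl _ => Sym.blank
      | .inr (.inl b) => Sym.mark b
      | .inr (.inr (.inl b)) => Sym.bit b
      | .inr (.inr (.inr (.inl x))) => Sym.cell x.1 x.2
      | .inr (.inr (.inr (.inr q))) => Sym.state q) ?_
  rintro (_ | b | b | ⟨b, g⟩ | q)
  · exact ⟨.inl (), rfl⟩
  · exact ⟨.inr (.inl b), rfl⟩
  · exact ⟨.inr (.inr (.inl b)), rfl⟩
  · exact ⟨.inr (.inr (.inr (.inl (b, g)))), rfl⟩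
  · exact ⟨.inr (.inr (.inr (.inr q))), rfl⟩

namespace Store

variable {α β T Γ : Type}

open Classical in
/-- Replace the contents of one tape and the position of its head. -/
noncomputable def setTape (c : Store β T Γ) (v : T) (τ : ℕ → Γ) (p : ℕ) : Store β T Γ :=
  { c with work := Function.update c.work v τ, pos := Function.update c.pos v p }

theorem setTape_self (c : Store β T Γ) (v : T) : c.setTape v (c.work v) (c.pos v) = c := by
  simp [setTape]

theorem setTape_heads (c : Store β T Γ) (v : T) (τ : ℕ → Γ) (p : ℕ) :
    (c.setTape v τ p).heads v = τ p := by
  simp [setTape, heads]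

theorem Within.setTape {w : List α} {s : ℕ} {c : Store β T Γ} (h : c.Within w s) (v : T)
    (τ : ℕ → Γ) {p : ℕ} (hp : p < s) : (c.setTape v τ p).Within w s := by
  refine ⟨h.1, fun t => ?_⟩
  by_cases ht : t = v
  · subst ht; simpa [Store.setTape] using hp
  · simpa [Store.setTape, ht] using h.2 t

end Store

/-- A tape with the symbol `m` in its first cell, followed by a list of bits. -/
def bitTape {Γ S : Type} (m : Sym Γ S) (l : List Bool) : ℕ → Sym Γ S
  | 0 => m
  | i + 1 => (l[i]?).elim Sym.blank Sym.bit

section bitTape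

variable {Γ S : Type} (m : Sym Γ S)

theorem bitTape_append (a : List Bool) (b : List Bool) :
    bitTape m (a ++ b) (a.length + 1) = (b.head?).elim Sym.blank Sym.bit := by
  cases b <;> simp [bitTape]

theorem update_bitTape_zero (m' : Sym Γ S) (l : List Bool) :
    Function.update (bitTape m l) 0 m' = bitTape m' l := by
  funext i
  cases i <;> simp [bitTape]

theorem update_bitTape (a : List Bool) (x y : Bool) (b : List Bool) :
    Function.update (bitTape m (a ++ x :: b)) (a.length + 1) (Sym.bit y) =
      bitTape m (a ++ y :: b) := by
  funext i
  rcases i with _ | i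
  · simp [bitTape]
  · rcases lt_trichotomy i a.length with h | rfl | h
    · simp [bitTape, h, h.ne, List.getElem?_append_left]
    · simp [bitTape]
    · obtain ⟨j, rfl⟩ := Nat.exists_eq_add_of_lt h
      simp [bitTape, Function.update_of_ne, List.getElem?_append_right, add_assoc]

theorem update_bitTape_end (a : List Bool) (y : Bool) :
    Function.update (bitTape m a) (a.length + 1) (Sym.bit y) = bitTape m (a ++ [y]) := by
  funext i
  rcases i with _ | i
  · simp [bitTape]
  · rcases lt_trichotomy i a.length with h | rfl | h
    · simp [bitTape, h, h.ne, List.getElem?_append_left]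
    · simp [bitTape]
    · obtain ⟨j, rfl⟩ := Nat.exists_eq_add_of_lt h
      simp [bitTape, Function.update_of_ne, add_assoc]

end bitTape

/-- The number with given binary digits, least significant digit first. -/
def bitsVal : List Bool → ℕ
  | [] => 0
  | b :: l => b.toNat + 2 * bitsVal l

/-- Stated for the successor of the value, so that a carry through `j` ones needs no subtraction. -/
theorem bitsVal_replicate_true (j : ℕ) (l : List Bool) :
    bitsVal (List.replicate j true ++ l) + 1 = 2 ^ j * (bitsVal l + 1) := by
  induction j with
  | zero => simp
  | succ j ih =>
    simp only [List.replicate_succ, List.cons_append, bitsVal, Bool.toNat_true, pow_succ]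
    linarith

theorem bitsVal_replicate_false (j : ℕ) (l : List Bool) :
    bitsVal (List.replicate j false ++ l) = 2 ^ j * bitsVal l := by
  induction j with
  | zero => simp
  | succ j ih =>
    simp only [List.replicate_succ, List.cons_append, bitsVal, Bool.toNat_false, pow_succ]
    rw [ih]; ring

/-- The maximal initial block of equal digits is the block through which a carry or a borrow
propagates. -/
theorem exists_eq_replicate_append (x : Bool) (l : List Bool) :
    ∃ j b, l = List.replicate j x ++ b ∧ b.head? ≠ some x := by
  induction l with
  | nil => exact ⟨0, [], by simp⟩
  | cons y l ih =>
    by_cases h : y = x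
    · subst h
      obtain ⟨j, b, rfl, hb⟩ := ih
      exact ⟨j + 1, b, rfl, hb⟩
    · exact ⟨0, y :: l, by simp, by simpa using h⟩

/-- The tape holds the number `N` in at most `W` binary digits. -/
def IsCounter {Γ S : Type} (W : ℕ) (τ : ℕ → Sym Γ S) (N : ℕ) : Prop :=
  ∃ l : List Bool, l.length ≤ W ∧ bitsVal l = N ∧ τ = bitTape (Sym.mark (decide (N ≠ 0))) l

theorem IsCounter.apply_zero {Γ S : Type} {W : ℕ} {τ : ℕ → Sym Γ S} {N : ℕ}
    (h : IsCounter W τ N) : τ 0 = Sym.mark (decide (N ≠ 0)) := by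
  obtain ⟨l, _, _, rfl⟩ := h
  rfl

/-! ### Increment and decrement of binary counters -/

namespace Prog

section

variable {α β T Γ : Type}

open Classical in
/-- Rewrite the scanned cell of the tape `v` and move its head. -/
noncomputable def touch (v : T) (g : Γ → Γ × Move) : Prog α β T Γ :=
  act fun _ h => (Move.stay, fun t => if t = v then g (h v) else (h t, Move.stay), none)

open Classical in
theorem exec_touch {w : List α} {s : ℕ} {c : Store β T Γ} (hc : c.Within w s) (v : T)
    (g : Γ → Γ × Move) (τ : ℕ → Γ) {p : ℕ} (hp : p < s) :
    Exec w s (touch v g) (c.setTape v τ p)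
      (c.setTape v (Function.update τ p (g (τ p)).1) (Transducer.moveHead (g (τ p)).2 p)) := by
  have h := Exec.act (f := fun _ h => (Move.stay, fun t => if t = v then g (h v) else
    (h t, Move.stay), none)) (hc.setTape v τ hp)
  convert h using 1
  · rfl
  simp only [Store.apply, Store.setTape_heads]
  rw [Store.setTape, Store.mk.injEq]
  refine ⟨(min_eq_left hc.1).symm, ?_, ?_, by simp [Store.setTape]⟩
  · funext t
    by_cases ht : t = v
    · subst ht; simp [Store.setTape]
    · simp [Store.setTape, ht, Store.heads]
  · funext t
    by_cases ht : t = v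
    · subst ht; simp [Store.setTape]
    · simp [Store.setTape, ht, Transducer.moveHead]

end

section

variable {α β T Γ S : Type}

/-- Pass over digits `x`, replacing them by `y`. -/
noncomputable def sweep (v : T) (x y : Bool) : Prog α β T (Sym Γ S) :=
  loop (fun _ h => h v = Sym.bit x) (touch v fun _ => (Sym.bit y, Move.right))

/-- Go back to the mark at the left end and replace it. -/
noncomputable def rewind (v : T) (b : Bool) : Prog α β T (Sym Γ S) :=
  seq (loop (fun _ h => ∀ b, h v ≠ Sym.mark b) (touch v fun g => (g, Move.left)))
    (touch v fun _ => (Sym.mark b, Move.stay))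

/-- Increment a counter. -/
noncomputable def incr (v : T) : Prog α β T (Sym Γ S) :=
  seq (touch v fun g => (g, Move.right)) (seq (sweep v true false)
    (seq (touch v fun _ => (Sym.bit true, Move.left)) (rewind v true)))

/-- Decrement a counter. -/
noncomputable def decr (v : T) : Prog α β T (Sym Γ S) :=
  ite (fun _ h => h v = Sym.mark true)
    (seq (touch v fun g => (g, Move.right)) (seq (sweep v false true)
      (seq (touch v fun _ => (Sym.bit false, Move.left)) (seq (rewind v true)
        (seq (touch v fun g => (g, Move.right)) (seq (sweep v false false)
          (ite (fun _ h => h v = Sym.bit true) (rewind v true) (rewind v false))))))))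
    (touch v fun g => (g, Move.stay))

variable {w : List α} {s W : ℕ} {c : Store β T (Sym Γ S)}

/-- The prefix `a` accumulates the digits already passed. Maximality of the block stops the loop,
either on a different digit or on the blank after the last one. -/
theorem exec_sweep (hc : c.Within w s) (v : T) (m : Sym Γ S) (x y : Bool) (a : List Bool) (j : ℕ)
    (b : List Bool) (hb : b.head? ≠ some x) (hs : a.length + j + 1 < s) :
    Exec w s (sweep v x y) (c.setTape v (bitTape m (a ++ (List.replicate j x ++ b))) (a.length + 1))
      (c.setTape v (bitTape m (a ++ (List.replicate j y ++ b))) (a.length + j + 1)) := by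
  induction j generalizing a with
  | zero =>
    refine Exec.loop_neg ?_ (hc.setTape v _ (by omega))
    rw [Store.setTape_heads]
    simp only [List.replicate_zero, List.nil_append, bitTape_append]
    cases b <;> simp_all
  | succ j ih =>
    refine Exec.loop_pos ?_ (exec_touch hc v _ _ (by omega)) ?_
    · rw [Store.setTape_heads, bitTape_append]
      simp [List.replicate_succ]
    · have := ih (a ++ [y]) (by simp; omega)
      simp only [List.length_append, List.length_singleton, List.append_assoc,
        List.singleton_append] at this
      simp only [List.replicate_succ, List.cons_append, update_bitTape, Transducer.moveHead]
      rw [show a.length + 1 + j + 1 = a.length + (j + 1) + 1 by omega] at this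
      exact this

/-- Only cell 0 carries a mark, so the head finds the left end from any position. -/
theorem exec_rewind (hc : c.Within w s) (v : T) (b b' : Bool) (l : List Bool) (q : ℕ)
    (hq : q < s) :
    Exec w s (rewind v b') (c.setTape v (bitTape (Sym.mark b) l) q)
      (c.setTape v (bitTape (Sym.mark b') l) 0) := by
  refine Exec.seq (c' := c.setTape v (bitTape (Sym.mark b) l) 0) ?_ ?_
  · induction q with
    | zero =>
      refine Exec.loop_neg ?_ (hc.setTape v _ hq)
      rw [Store.setTape_heads]
      simp [bitTape]
    | succ q ih =>
      refine Exec.loop_pos ?_ (exec_touch hc v _ _ hq) ?_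
      · rw [Store.setTape_heads]
        cases h : l[q]? <;> simp [bitTape, h]
      · simpa [Transducer.moveHead] using ih (by omega)
  · have := exec_touch hc v (fun _ => (Sym.mark b', Move.stay)) (bitTape (Sym.mark b) l)
      (p := 0) (by omega)
    rwa [update_bitTape_zero] at this

/-- The initial ones become zeros and the digit after them becomes a one; a numeral consisting only
of ones grows by one digit. -/
theorem exec_incr (hc : c.Within w s) (hs : W + 2 ≤ s) (v : T) {τ : ℕ → Sym Γ S} {N : ℕ}
    (hτ : IsCounter W τ N) (hN : N + 1 < 2 ^ W) :
    ∃ τ', IsCounter W τ' (N + 1) ∧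
      Exec w s (incr v) (c.setTape v τ 0) (c.setTape v τ' 0) := by
  obtain ⟨l, hl, rfl, rfl⟩ := hτ
  obtain ⟨j, b, rfl, hb⟩ := exists_eq_replicate_append true l
  set m : Sym Γ S := Sym.mark (decide (bitsVal (List.replicate j true ++ b) ≠ 0)) with hm
  simp only [List.length_append, List.length_replicate] at hl
  -- Only an all-ones numeral gets longer. Then `N + 1 = 2 ^ j`, and the bound on `N + 1` leaves
  -- room for one more digit.
  have hW : j + b.tail.length + 1 ≤ W := by
    rcases b with _ | ⟨x, b⟩
    · rw [bitsVal_replicate_true] at hN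
      have := (Nat.pow_lt_pow_iff_right (a := 2) (by norm_num)).1 (by simpa [bitsVal] using hN)
      simpa using this
    · simpa [add_assoc] using hl
  refine ⟨bitTape (Sym.mark true) (List.replicate j false ++ true :: b.tail), ?_, ?_⟩
  · refine ⟨List.replicate j false ++ true :: b.tail, by simp; omega, ?_, by simp⟩
    rw [bitsVal_replicate_true, bitsVal_replicate_false]
    rcases b with _ | ⟨x, b⟩
    · simp [bitsVal]
    · cases x
      · simp [bitsVal, add_comm]
      · simp at hb
  · refine Exec.seq (exec_touch hc v _ _ (by omega)) ?_
    simp only [Function.update_eq_self, Transducer.moveHead]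
    refine Exec.seq (exec_sweep hc v m true false [] j b hb (by simp; omega)) ?_
    refine Exec.seq (exec_touch hc v _ _ (by simp; omega)) ?_
    have : Function.update (bitTape m ([] ++ (List.replicate j false ++ b)))
        (([] : List Bool).length + j + 1) (Sym.bit true) =
        bitTape m (List.replicate j false ++ true :: b.tail) := by
      rcases b with _ | ⟨x, b⟩
      · simpa using update_bitTape_end m (List.replicate j false) true
      · simpa using update_bitTape m (List.replicate j false) x true b
    rw [this]
    exact exec_rewind hc v _ _ _ _ (by simp [Transducer.moveHead]; omega)

/-- A borrow turns the initial zeros into ones and the first one into a zero. The result may consist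
of zeros only, so a second scan for a one determines the new mark. Zero stays zero, as in truncated
subtraction. -/
theorem exec_decr (hc : c.Within w s) (hs : W + 2 ≤ s) (v : T) {τ : ℕ → Sym Γ S} {N : ℕ}
    (hτ : IsCounter W τ N) :
    ∃ τ', IsCounter W τ' (N - 1) ∧
      Exec w s (decr v) (c.setTape v τ 0) (c.setTape v τ' 0) := by
  by_cases hN : N = 0
  · subst hN
    refine ⟨τ, hτ, Exec.ite_neg ?_ ?_⟩
    · rw [Store.setTape_heads, hτ.apply_zero]
      simp
    · have := exec_touch hc v (fun g => (g, Move.stay)) τ (p := 0) (by omega)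
      rwa [Function.update_eq_self] at this
  have h0 := hτ.apply_zero
  obtain ⟨l, hl, rfl, rfl⟩ := hτ
  obtain ⟨j, b, rfl, hb⟩ := exists_eq_replicate_append false l
  set m : Sym Γ S := Sym.mark (decide (bitsVal (List.replicate j false ++ b) ≠ 0)) with hm
  rw [bitsVal_replicate_false] at hN
  rcases b with _ | ⟨_ | _, b⟩
  · simp [bitsVal] at hN
  · simp at hb
  have hval : bitsVal (List.replicate j false ++ true :: b) - 1 =
      bitsVal (List.replicate j true ++ false :: b) := by
    have := bitsVal_replicate_true j (false :: b)
    rw [bitsVal_replicate_false]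
    simp only [bitsVal, Bool.toNat_false, Bool.toNat_true] at this ⊢
    rw [show 2 ^ j * (1 + 2 * bitsVal b) = 2 ^ j * (0 + 2 * bitsVal b + 1) by ring, ← this]
    simp
  set l' := List.replicate j true ++ false :: b with hl'
  have hlen : l'.length ≤ W := by simpa [hl'] using hl
  rw [hval]
  refine ⟨_, ⟨l', hlen, rfl, rfl⟩, Exec.ite_pos ?_ ?_⟩
  · rw [Store.setTape_heads, h0, hm, bitsVal_replicate_false, decide_eq_true hN]
  have hj : j + 1 ≤ l'.length := by simp [hl']
  refine Exec.seq (exec_touch hc v _ _ (by omega)) ?_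
  simp only [Function.update_eq_self, Transducer.moveHead]
  refine Exec.seq (exec_sweep hc v m false true [] j _ hb (by simp; omega)) ?_
  refine Exec.seq (exec_touch hc v _ _ (by simp; omega)) ?_
  have : Function.update (bitTape m ([] ++ (List.replicate j true ++ true :: b)))
      (([] : List Bool).length + j + 1) (Sym.bit false) = bitTape m l' := by
    simpa using update_bitTape m (List.replicate j true) true false b
  rw [this]
  refine Exec.seq (exec_rewind hc v _ true _ _ (by simp [Transducer.moveHead]; omega)) ?_
  refine Exec.seq (exec_touch hc v _ _ (by omega)) ?_
  simp only [Function.update_eq_self, Transducer.moveHead]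
  -- Sweeping zeros to zeros changes nothing; it brings the head to the first digit one, or to a
  -- blank if the new value is zero.
  obtain ⟨i, d, hid, hd⟩ := exists_eq_replicate_append false l'
  have hi : i ≤ l'.length := by rw [hid]; simp
  have h1 := exec_sweep hc v (Sym.mark true) false false [] i d hd (by simp; omega)
  rw [List.nil_append, ← hid] at h1
  refine Exec.seq h1 ?_
  have h2 := bitTape_append (Sym.mark true : Sym Γ S) (List.replicate i false) d
  rw [← hid] at h2
  have h3 : bitsVal l' ≠ 0 ↔ d.head? = some true := by
    rw [hid, bitsVal_replicate_false]
    rcases d with _ | ⟨_ | _, d⟩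
    · simp [bitsVal]
    · simp at hd
    · simp [bitsVal]
  by_cases h4 : bitsVal l' = 0
  · refine Exec.ite_neg ?_ ?_
    · rw [Store.setTape_heads]
      simp only [List.length_nil, zero_add]
      simp only [List.length_replicate] at h2
      rw [h2]
      rcases d with _ | ⟨_ | _, d⟩ <;> simp_all
    · rw [decide_eq_false (by simpa using h4)]
      exact exec_rewind hc v _ _ _ _ (by simp; omega)
  · refine Exec.ite_pos ?_ ?_
    · rw [Store.setTape_heads]
      simp only [List.length_nil, zero_add]
      simp only [List.length_replicate] at h2
      rw [h2, h3.1 h4]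
      rfl
    · rw [decide_eq_true h4]
      exact exec_rewind hc v _ _ _ _ (by simp; omega)

end

end Prog


/-! ### Register programs that read the output of a transducer -/

/-- The number that stands for a tape symbol: `0` if there is none, `1` for a tally mark, `2` and
`3` for the bits. -/
def symCode : Option (Option Bool) → ℕ
  | none => 0
  | some none => 1
  | some (some false) => 2
  | some (some true) => 3

/-- Programs for a machine with finitely many registers for natural numbers and an output tape.
`pass p r n` stores the length of the input word in `n` and (the code of) the symbol at the position
given by `p` in `r`. -/
inductive Cmd : Type
  | skip
  | inc (v : ℕ)
  | dec (v : ℕ)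
  | out (b : Option Bool)
  | seq (p q : Cmd)
  | ite (v : ℕ) (p q : Cmd)
  | loop (v : ℕ) (p : Cmd)
  | pass (p r n : ℕ)

namespace Cmd

/-- An upper bound for the registers of a program. -/
def bound : Cmd → ℕ
  | skip => 0
  | inc v => v
  | dec v => v
  | out _ => 0
  | seq p q => max p.bound q.bound
  | ite v p q => max v (max p.bound q.bound)
  | loop v p => max v p.bound
  | pass p r n => max p (max r n)

/-- The registers after the part `l` of the input word has been read. -/
def passEnv (ρ : ℕ → ℕ) (p r n : ℕ) (l : List (Option Bool)) : ℕ → ℕ :=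
  Function.update (Function.update (Function.update ρ p (ρ p - l.length)) r
    (symCode l[ρ p]?)) n l.length

/-- Execution of a program on the input word `w`, starting with the registers `ρ`, ending with the
registers `ρ'`, with output `o`, where the registers never hold numbers above `B`. -/
inductive Big (w : List (Option Bool)) (B : ℕ) :
    Cmd → (ℕ → ℕ) → List (Option Bool) → (ℕ → ℕ) → Prop
  | skip {ρ} : Big w B skip ρ [] ρ
  | inc {ρ v} (h : ρ v + 1 ≤ B) : Big w B (inc v) ρ [] (Function.update ρ v (ρ v + 1))
  | dec {ρ v} : Big w B (dec v) ρ [] (Function.update ρ v (ρ v - 1))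
  | out {ρ b} : Big w B (out b) ρ [b] ρ
  | seq {p q ρ o ρ' o' ρ''} : Big w B p ρ o ρ' → Big w B q ρ' o' ρ'' →
      Big w B (seq p q) ρ (o ++ o') ρ''
  | ite_pos {v p q ρ o ρ'} (h : ρ v ≠ 0) : Big w B p ρ o ρ' → Big w B (ite v p q) ρ o ρ'
  | ite_neg {v p q ρ o ρ'} (h : ρ v = 0) : Big w B q ρ o ρ' → Big w B (ite v p q) ρ o ρ'
  | loop_pos {v p ρ o ρ' o' ρ''} (h : ρ v ≠ 0) : Big w B p ρ o ρ' → Big w B (loop v p) ρ' o' ρ'' →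
      Big w B (loop v p) ρ (o ++ o') ρ''
  | loop_neg {v p ρ} (h : ρ v = 0) : Big w B (loop v p) ρ [] ρ
  | pass {ρ p r n} (hpr : p ≠ r) (hpn : p ≠ n) (hrn : r ≠ n) (hr : ρ r = 0) (hn : ρ n = 0)
      (hw : w.length ≤ B) (hB : 3 ≤ B) : Big w B (pass p r n) ρ [] (passEnv ρ p r n w)

theorem Big.mono {w : List (Option Bool)} {B B' : ℕ} (hB : B ≤ B') {p : Cmd} {ρ ρ' : ℕ → ℕ}
    {o : List (Option Bool)} (h : Big w B p ρ o ρ') : Big w B' p ρ o ρ' := by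
  induction h with
  | skip => exact .skip
  | inc h => exact .inc (h.trans hB)
  | dec => exact .dec
  | out => exact .out
  | seq _ _ h h' => exact .seq h h'
  | ite_pos h _ h' => exact .ite_pos h h'
  | ite_neg h _ h' => exact .ite_neg h h'
  | loop_pos h _ _ h' h'' => exact .loop_pos h h' h''
  | loop_neg h => exact .loop_neg h
  | pass hpr hpn hrn hr hn hw h3 => exact .pass hpr hpn hrn hr hn (hw.trans hB) (h3.trans hB)

end Cmd

/-! ### Implementation of register programs -/

/-- The tapes of a machine that simulates another machine and has counters and a tape for the
control of the simulated machine. -/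
inductive Tape (T : Type) (K : ℕ) : Type
  | sim (t : T)
  | reg (i : Fin (K + 1))
  | ctl

instance {T : Type} {K : ℕ} [Finite T] : Finite (Tape T K) := by
  refine Finite.of_surjective
    (fun x : T ⊕ Fin (K + 1) ⊕ Unit => match x with
      | .inl t => Tape.sim t
      | .inr (.inl i) => Tape.reg i
      | .inr (.inr _) => Tape.ctl) ?_
  rintro (t | i | _)
  · exact ⟨.inl t, rfl⟩
  · exact ⟨.inr (.inl i), rfl⟩
  · exact ⟨.inr (.inr ()), rfl⟩

namespace Sym

variable {Γ S : Type}

/-- Is this the blank symbol? -/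
def isBlank : Sym Γ S → Bool
  | blank => true
  | _ => false

/-- Is this the first cell of a simulated tape? -/
def isFirst : Sym Γ S → Bool
  | cell b _ => b
  | _ => false

/-- The symbol of the simulated machine. -/
def content (b : Γ) : Sym Γ S → Γ
  | cell _ g => g
  | _ => b

/-- The state of the simulated machine. -/
def control (q : S) : Sym Γ S → S
  | state q => q
  | _ => q

end Sym

namespace Simulation

open Prog

variable {α : Type} (M : Transducer α (Option Bool)) (K : ℕ)

/-- The alphabet of the simulating machine. -/
abbrev Alph : Type := Sym M.Γ (M.State × Option (Option Bool))

/-- The programs of the simulating machine. -/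
abbrev SProg : Type := Prog α (Option Bool) (Tape M.Tp K) (Alph M)

/-- The memory of the simulating machine. -/
abbrev SStore : Type := Store (Option Bool) (Tape M.Tp K) (Alph M)

/-- The tape of a register. -/
def regTape (T : Type) (K v : ℕ) : Tape T K :=
  Tape.reg ⟨min v K, Nat.lt_succ_of_le (min_le_right v K)⟩

/-- The state of the simulated machine and the symbol that it has just written. -/
def ctlState (h : Tape M.Tp K → Alph M) : M.State × Option (Option Bool) :=
  (h Tape.ctl).control (M.start, none)

/-- The next step of the simulated machine. -/
def simNext (s : Scan α) (h : Tape M.Tp K → Alph M) :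
    Option (M.State × Move × (M.Tp → M.Γ × Move) × Option (Option Bool)) :=
  M.δ (ctlState M K h).1 s (fun t => (h (Tape.sim t)).content M.blank)

/-- The program that does nothing. -/
def nop : SProg M K := act fun _ h => idle h

/-- Act in the same way on all simulated tapes. -/
def simwise (f : Alph M → Alph M × Move) : SProg M K :=
  act fun _ h => (Move.stay, fun
    | .sim t => f (h (.sim t))
    | x => (h x, Move.stay), none)

/-- Bring the simulated machine into its initial configuration. -/
def reset : SProg M K :=
  seq (loop (fun _ h => ∃ t, (h (.sim t)).isBlank = false)
      (simwise M K fun g => (g, if g.isBlank then Move.stay else Move.right)))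
    (seq (loop (fun _ h => ∃ t, (h (.sim t)).isFirst = false)
      (simwise M K fun g => if g.isFirst then (g, Move.stay) else (Sym.blank, Move.left)))
    (seq (simwise M K fun _ => (Sym.cell true M.blank, Move.stay))
    (seq (loop (fun s _ => s ≠ Scan.leftEnd)
      (act fun _ h => (Move.left, fun t => (h t, Move.stay), none)))
    (act fun _ h => (Move.stay, fun
      | .ctl => (Sym.state (M.start, none), Move.stay)
      | x => (h x, Move.stay), none)))))

/-- Simulate one step. -/
def simStep : SProg M K :=
  act fun s h => match simNext M K s h with
    | none => idle h
    | some r => (r.2.1, fun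
      | .sim t => (Sym.cell (h (.sim t)).isFirst (r.2.2.1 t).1, (r.2.2.1 t).2)
      | .reg i => (h (.reg i), Move.stay)
      | .ctl => (Sym.state (r.1, r.2.2.2), Move.stay), none)

/-- Process an output symbol of the simulated machine. -/
noncomputable def handle (p r n : Tape M.Tp K) : SProg M K :=
  ite (fun _ h => (ctlState M K h).2 = none) (nop M K) (seq (incr n)
    (ite (fun _ h => h p = Sym.mark true) (decr p)
    (ite (fun _ h => h r = Sym.mark true) (nop M K)
    (ite (fun _ h => (ctlState M K h).2 = some none) (incr r)
    (ite (fun _ h => (ctlState M K h).2 = some (some false)) (seq (incr r) (incr r))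
      (seq (incr r) (seq (incr r) (incr r))))))))

/-- Simulate the machine and process its output. -/
noncomputable def simulate (p r n : Tape M.Tp K) : SProg M K :=
  seq (reset M K) (loop (fun s h => simNext M K s h ≠ none) (seq (simStep M K) (handle M K p r n)))

/-- The program for the simulating machine that implements a register program. -/
noncomputable def compile : Cmd → SProg M K
  | .skip => nop M K
  | .inc v => incr (regTape M.Tp K v)
  | .dec v => decr (regTape M.Tp K v)
  | .out b => act fun _ h => (Move.stay, fun t => (h t, Move.stay), some b)
  | .seq p q => seq (compile p) (compile q)
  | .ite v p q => ite (fun _ h => h (regTape M.Tp K v) = Sym.mark true) (compile p) (compile q)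
  | .loop v p => loop (fun _ h => h (regTape M.Tp K v) = Sym.mark true) (compile p)
  | .pass p r n => simulate M K (regTape M.Tp K p) (regTape M.Tp K r) (regTape M.Tp K n)

/-- The initial step of the simulating machine. -/
def prepare : SProg M K :=
  act fun _ h => (Move.stay, fun
    | .sim _ => (Sym.cell true M.blank, Move.stay)
    | .reg _ => (Sym.mark false, Move.stay)
    | .ctl => (h .ctl, Move.stay), none)

variable {M K}

/-- The first `h` cells of a simulated tape, and no others, are in use. -/
def Visited {Γ S : Type} (τ : ℕ → Sym Γ S) (h : ℕ) : Prop :=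
  ∀ i, (i < h → (τ i).isBlank = false ∧ ((τ i).isFirst = true ↔ i = 0)) ∧ (h ≤ i → τ i = Sym.blank)

theorem Visited.isBlank_iff {Γ S : Type} {τ : ℕ → Sym Γ S} {h : ℕ} (hτ : Visited τ h) (i : ℕ) :
    (τ i).isBlank = true ↔ h ≤ i := by
  refine ⟨fun hi => ?_, fun hi => by rw [(hτ i).2 hi]; rfl⟩
  by_contra hlt
  simp [((hτ i).1 (by omega)).1] at hi

theorem Visited.isFirst_iff {Γ S : Type} {τ : ℕ → Sym Γ S} {h : ℕ} (hτ : Visited τ h) (h1 : 1 ≤ h)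
    (i : ℕ) : (τ i).isFirst = true ↔ i = 0 := by
  by_cases hi : i < h
  · exact ((hτ i).1 hi).2
  · rw [(hτ i).2 (by omega)]
    simp only [Sym.isFirst, Bool.false_eq_true, false_iff]
    omega

/-- The memory represents the register contents `ρ`. -/
structure Inv (w : List α) (s s₁ W : ℕ) (c : SStore M K) (ρ : ℕ → ℕ) : Prop where
  within : c.Within w s
  reg : ∀ i : Fin (K + 1), IsCounter W (c.work (.reg i)) (ρ i)
  pos_reg : ∀ i : Fin (K + 1), c.pos (.reg i) = 0
  pos_ctl : c.pos .ctl = 0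
  sim : ∀ t, ∃ h, 1 ≤ h ∧ h ≤ s₁ ∧ c.pos (.sim t) ≤ h ∧ Visited (c.work (.sim t)) h

/-- The memory represents the configuration `d` of the simulated machine. -/
structure Sim (d : M.Cfg) (c : SStore M K) : Prop where
  inPos : c.inPos = d.inPos
  state : ∃ o, c.work .ctl 0 = Sym.state (d.state, o)
  pos : ∀ t, c.pos (.sim t) = d.pos t
  work : ∀ t i, (c.work (.sim t) i).content M.blank = d.work t i

variable {w : List α} {s s₁ W : ℕ} {c : SStore M K} {ρ : ℕ → ℕ}

theorem Inv.heads_regTape (h : Inv w s s₁ W c ρ) {v : ℕ} (hv : v ≤ K) :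
    c.heads (regTape M.Tp K v) = Sym.mark true ↔ ρ v ≠ 0 := by
  rw [Store.heads, regTape, h.pos_reg, (h.reg _).apply_zero]
  simp [min_eq_left hv]

theorem Inv.setTape (h : Inv w s s₁ W c ρ) {v : ℕ} (hv : v ≤ K) {τ : ℕ → Alph M} {N : ℕ}
    (hτ : IsCounter W τ N) (hs : 0 < s) :
    Inv w s s₁ W (c.setTape (regTape M.Tp K v) τ 0) (Function.update ρ v N) := by
  refine ⟨h.within.setTape _ _ hs, fun i => ?_, fun i => ?_, ?_, fun t => ?_⟩
  · by_cases hi : i = ⟨min v K, Nat.lt_succ_of_le (min_le_right v K)⟩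
    · subst hi
      simpa [Store.setTape, regTape, min_eq_left hv] using hτ
    · have hi' : i.val ≠ v := fun h => hi (by ext; simp [h, min_eq_left hv])
      simpa [Store.setTape, regTape, hi, hi'] using h.reg i
  · by_cases hi : i = ⟨min v K, Nat.lt_succ_of_le (min_le_right v K)⟩
    · simp [Store.setTape, regTape, hi]
    · simpa [Store.setTape, regTape, hi] using h.pos_reg i
  · simpa [Store.setTape, regTape] using h.pos_ctl
  · simpa [Store.setTape, regTape] using h.sim t

theorem Sim.setTape {d : M.Cfg} (h : Sim d c) (v : ℕ) (τ : ℕ → Alph M) (p : ℕ) :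
    Sim d (c.setTape (regTape M.Tp K v) τ p) := by
  refine ⟨h.inPos, ?_, fun t => ?_, fun t i => ?_⟩
  · simpa [Store.setTape, regTape] using h.state
  · simpa [Store.setTape, regTape] using h.pos t
  · simpa [Store.setTape, regTape] using h.work t i

/-- The part of the memory that is not changed by operations on registers. -/
def SameSim (c c' : SStore M K) : Prop :=
  c'.out = c.out ∧ c'.work .ctl = c.work .ctl ∧ c'.pos .ctl = c.pos .ctl ∧
    ∀ d : M.Cfg, Sim d c → Sim d c'

theorem SameSim.refl (c : SStore M K) : SameSim c c := ⟨rfl, rfl, rfl, fun _ h => h⟩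

theorem SameSim.trans {c c' c'' : SStore M K} (h : SameSim c c') (h' : SameSim c' c'') :
    SameSim c c'' :=
  ⟨h'.1.trans h.1, h'.2.1.trans h.2.1, h'.2.2.1.trans h.2.2.1, fun d hd => h'.2.2.2 d (h.2.2.2 d hd)⟩

theorem sameSim_setTape (c : SStore M K) (v : ℕ) (τ : ℕ → Alph M) (p : ℕ) :
    SameSim c (c.setTape (regTape M.Tp K v) τ p) :=
  ⟨rfl, by simp [Store.setTape, regTape], by simp [Store.setTape, regTape],
    fun _ h => h.setTape v τ p⟩

theorem SameSim.ctlState {c c' : SStore M K} (h : SameSim c c') :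
    ctlState M K c'.heads = ctlState M K c.heads := by
  simp [Simulation.ctlState, Store.heads, h.2.1, h.2.2.1]

theorem Inv.setTape_self (h : Inv w s s₁ W c ρ) (v : ℕ) :
    c.setTape (regTape M.Tp K v) (c.work (regTape M.Tp K v)) 0 = c := by
  have : c.pos (regTape M.Tp K v) = 0 := h.pos_reg _
  rw [← this, Store.setTape_self]

theorem Inv.counter (h : Inv w s s₁ W c ρ) {v : ℕ} (hv : v ≤ K) :
    IsCounter W (c.work (regTape M.Tp K v)) (ρ v) := by
  have := h.reg ⟨min v K, Nat.lt_succ_of_le (min_le_right v K)⟩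
  simpa only [regTape, min_eq_left hv] using this

theorem Inv.exec_incr (h : Inv w s s₁ W c ρ) (hs : W + 2 ≤ s) {v : ℕ} (hv : v ≤ K)
    (hW : ρ v + 1 < 2 ^ W) :
    ∃ c', Exec w s (incr (regTape M.Tp K v)) c c' ∧
      Inv w s s₁ W c' (Function.update ρ v (ρ v + 1)) ∧ SameSim c c' := by
  obtain ⟨τ', hτ', hex⟩ := Prog.exec_incr h.within hs (regTape M.Tp K v) (h.counter hv) hW
  rw [h.setTape_self] at hex
  exact ⟨_, hex, h.setTape hv hτ' (by omega), sameSim_setTape _ _ _ _⟩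

theorem Inv.exec_decr (h : Inv w s s₁ W c ρ) (hs : W + 2 ≤ s) {v : ℕ} (hv : v ≤ K) :
    ∃ c', Exec w s (decr (regTape M.Tp K v)) c c' ∧
      Inv w s s₁ W c' (Function.update ρ v (ρ v - 1)) ∧ SameSim c c' := by
  obtain ⟨τ', hτ', hex⟩ := Prog.exec_decr h.within hs (regTape M.Tp K v) (h.counter hv)
  rw [h.setTape_self] at hex
  exact ⟨_, hex, h.setTape hv hτ' (by omega), sameSim_setTape _ _ _ _⟩

theorem exec_nop (h : c.Within w s) : Exec w s (nop M K) c c := by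
  have := Exec.act (f := fun _ h => idle h) h
  rwa [apply_idle h] at this

end Simulation


/-! ### Restarting the simulated machine -/

namespace Simulation

open Prog

variable {α : Type} {M : Transducer α (Option Bool)} {K : ℕ}
variable {w : List α} {s s₁ W : ℕ} {c : SStore M K} {ρ : ℕ → ℕ}

/-- Replace the contents and the head positions of the simulated tapes. -/
def setSim (c : SStore M K) (τ : M.Tp → ℕ → Alph M) (p : M.Tp → ℕ) : SStore M K :=
  { c with
    work := fun
      | .sim t => τ t
      | x => c.work x
    pos := fun
      | .sim t => p t
      | x => c.pos x }

theorem setSim_self (c : SStore M K) :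
    setSim c (fun t => c.work (.sim t)) (fun t => c.pos (.sim t)) = c := by
  cases c
  simp only [setSim, Store.mk.injEq, true_and, and_true]
  exact ⟨by funext x; cases x <;> rfl, by funext x; cases x <;> rfl⟩

theorem within_setSim (h : c.Within w s) (τ : M.Tp → ℕ → Alph M) {p : M.Tp → ℕ}
    (hp : ∀ t, p t < s) : (setSim c τ p).Within w s := by
  refine ⟨h.1, ?_⟩
  rintro (t | i | _)
  · exact hp t
  · exact h.2 _
  · exact h.2 _

theorem exec_simwise (h : c.Within w s) (f : Alph M → Alph M × Move) (τ : M.Tp → ℕ → Alph M)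
    {p : M.Tp → ℕ} (hp : ∀ t, p t < s) :
    Exec w s (simwise M K f) (setSim c τ p)
      (setSim c (fun t => Function.update (τ t) (p t) (f (τ t (p t))).1)
        (fun t => Transducer.moveHead (f (τ t (p t))).2 (p t))) := by
  have := Exec.act (f := fun _ h => (Move.stay, fun
    | .sim t => f (h (.sim t))
    | x => (h x, Move.stay), none)) (within_setSim h τ hp)
  convert this using 1
  · rfl
  simp only [Store.apply]
  rw [setSim, Store.mk.injEq]
  refine ⟨(min_eq_left h.1).symm, ?_, ?_, by simp [setSim]⟩
  · funext x
    cases x <;> simp [setSim, Store.heads]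
  · funext x
    cases x <;> simp [setSim, Store.heads, Transducer.moveHead]

/-- All simulated heads move in lockstep, and those already on a blank wait. The induction is on a
common bound for the remaining distances. -/
theorem exec_advance (h : c.Within w s) (τ : M.Tp → ℕ → Alph M) (p q : M.Tp → ℕ)
    (hτ : ∀ t, Visited (τ t) (q t)) (hpq : ∀ t, p t ≤ q t) (hq : ∀ t, q t < s) :
    Exec w s (loop (fun _ h => ∃ t, (h (.sim t)).isBlank = false)
      (simwise M K fun g => (g, if g.isBlank then Move.stay else Move.right)))
      (setSim c τ p) (setSim c τ q) := by
  suffices H : ∀ N p, (∀ t, p t ≤ q t) → (∀ t, q t ≤ p t + N) → Exec w s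
      (loop (fun _ h => ∃ t, (h (.sim t)).isBlank = false)
      (simwise M K fun g => (g, if g.isBlank then Move.stay else Move.right)))
      (setSim c τ p) (setSim c τ q) from H s p hpq fun t => by have := hq t; omega
  intro N
  induction N with
  | zero =>
    intro p hpq hN
    obtain rfl : p = q := by funext t; have := hpq t; have := hN t; omega
    refine Exec.loop_neg ?_ (within_setSim h τ hq)
    rintro ⟨t, ht⟩
    have := ((hτ t).isBlank_iff (p t)).2 le_rfl
    simp only [Store.heads, setSim] at ht
    simp [ht] at this
  | succ N ih =>
    intro p hpq hN
    by_cases hex : ∃ t, (τ t (p t)).isBlank = false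
    · refine Exec.loop_pos hex (exec_simwise h _ τ fun t => (hpq t).trans_lt (hq t)) ?_
      simp only [Function.update_eq_self]
      refine ih _ (fun t => ?_) (fun t => ?_)
      · by_cases hb : (τ t (p t)).isBlank = true
        · simpa [hb, Transducer.moveHead] using hpq t
        · have := (not_congr ((hτ t).isBlank_iff (p t))).1 hb
          simp only [hb]
          simp [Transducer.moveHead]; omega
      · have := hN t
        by_cases hb : (τ t (p t)).isBlank = true
        · have := ((hτ t).isBlank_iff (p t)).1 hb
          simp only [hb]
          simp [Transducer.moveHead]; omega
        · simp only [hb]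
          simp [Transducer.moveHead]; omega
    · obtain rfl : p = q := by
        funext t
        have h1 : (τ t (p t)).isBlank = true := by
          by_contra hb
          exact hex ⟨t, by simpa using hb⟩
        exact le_antisymm (hpq t) (((hτ t).isBlank_iff (p t)).1 h1)
      exact Exec.loop_neg hex (within_setSim h τ hq)

/-- Cells are blanked from right to left. The flag of the first cell is what stops a head, so that
cell is kept. -/
theorem exec_erase (h : c.Within w s) (τ : M.Tp → ℕ → Alph M) (p : M.Tp → ℕ)
    (hτ : ∀ t, Visited (τ t) (p t)) (h1 : ∀ t, 1 ≤ p t) (hp : ∀ t, p t < s) :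
    ∃ τ', (∀ t, Visited (τ' t) 1) ∧
    Exec w s (loop (fun _ h => ∃ t, (h (.sim t)).isFirst = false)
      (simwise M K fun g => if g.isFirst then (g, Move.stay) else (Sym.blank, Move.left)))
      (setSim c τ p) (setSim c τ' fun _ => 0) := by
  -- The generalization `p ≤ q ≤ p + 1` allows a head to stand on the first blank cell, as at the
  -- start, or on the last used cell, as after an erasing step.
  suffices H : ∀ N (τ : M.Tp → ℕ → Alph M) (p q : M.Tp → ℕ), (∀ t, Visited (τ t) (q t)) → (∀ t, 1 ≤ q t) → (∀ t, p t ≤ q t) →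
      (∀ t, q t ≤ p t + 1) → (∀ t, p t < s) → (∀ t, p t ≤ N) → ∃ τ', (∀ t, Visited (τ' t) 1) ∧
      Exec w s (loop (fun _ h => ∃ t, (h (.sim t)).isFirst = false)
      (simwise M K fun g => if g.isFirst then (g, Move.stay) else (Sym.blank, Move.left)))
      (setSim c τ p) (setSim c τ' fun _ => 0) from
    H s τ p p hτ h1 (fun _ => le_rfl) (fun _ => Nat.le_succ _) hp fun t => (hp t).le
  intro N
  induction N with
  | zero =>
    intro τ p q hτ h1 hpq hqp hp hN
    obtain rfl : p = fun _ => 0 := by funext t; simpa using hN t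
    refine ⟨τ, fun t => ?_, Exec.loop_neg ?_ (within_setSim h τ hp)⟩
    · have : q t = 1 := (hqp t).antisymm (h1 t)
      rw [← this]; exact hτ t
    · rintro ⟨t, ht⟩
      have := ((hτ t).isFirst_iff (h1 t) 0).2 rfl
      simp only [Store.heads, setSim] at ht
      simp [ht] at this
  | succ N ih =>
    intro τ p q hτ h1 hpq hqp hp hN
    by_cases hex : ∃ t, (τ t (p t)).isFirst = false
    · have hstep := exec_simwise h (fun g => if g.isFirst then (g, Move.stay) else
        (Sym.blank, Move.left)) τ hp
      -- Blanking cell `p` leaves the cells below `p` in use; at cell 0 nothing is erased and the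
      -- frontier is 1.
      refine Exists.elim (ih
        (fun t => Function.update (τ t) (p t)
          ((fun g : Alph M => if g.isFirst then (g, Move.stay) else (Sym.blank, Move.left))
            (τ t (p t))).1)
        (fun t => Transducer.moveHead
          ((fun g : Alph M => if g.isFirst then (g, Move.stay) else (Sym.blank, Move.left))
            (τ t (p t))).2 (p t))
        (fun t => if p t = 0 then 1 else p t) ?_ ?_ ?_ ?_ ?_ ?_)
        fun τ' hτ' => ⟨τ', hτ'.1, Exec.loop_pos hex hstep hτ'.2⟩
      all_goals
        intro t
        have hf := (hτ t).isFirst_iff (h1 t) (p t)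
        have := h1 t
        have := hpq t
        have := hqp t
        have := hp t
        have := hN t
        by_cases h0 : p t = 0
      · have hf0 := hf.2 h0
        have : q t = 1 := by omega
        rw [h0] at hf0
        simpa only [hf0, if_true, Function.update_eq_self, h0, this] using hτ t
      · have hf0 : (τ t (p t)).isFirst = false := by
          rw [← Bool.not_eq_true]; exact fun h => h0 (hf.1 h)
        simp only [hf0, Bool.false_eq_true, if_false, h0]
        intro i
        constructor
        · intro hi
          rw [Function.update_of_ne hi.ne]
          exact (hτ t i).1 (hi.trans_le (hpq t))
        · intro hi
          rcases hi.eq_or_lt with rfl | hi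
          · simp
          · rw [Function.update_of_ne hi.ne']
            exact (hτ t i).2 ((hqp t).trans hi)
      all_goals
        first
        | have hf0 := hf.2 h0
          rw [h0] at hf0
          simp only [hf0, h0, if_true, Transducer.moveHead]
          try omega
        | have hf0 : (τ t (p t)).isFirst = false := by
            rw [← Bool.not_eq_true]; exact fun h => h0 (hf.1 h)
          simp only [hf0, h0, if_false, Bool.false_eq_true, Transducer.moveHead]
          try omega
    · have hall : ∀ t, p t = 0 := by
        intro t
        rw [← (hτ t).isFirst_iff (h1 t)]
        by_contra hb
        exact hex ⟨t, by simpa using hb⟩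
      refine ⟨τ, fun t => ?_, ?_⟩
      · have : q t = 1 := by have := hqp t; have := hall t; have := h1 t; omega
        rw [← this]; exact hτ t
      · obtain rfl : p = fun _ => 0 := funext hall
        exact Exec.loop_neg hex (within_setSim h τ hp)

theorem exec_inputHome (h : c.Within w s) :
    Exec w s (loop (fun s _ => s ≠ Scan.leftEnd)
      (act fun _ h => (Move.left, fun t => (h t, Move.stay), none))) c { c with inPos := 0 } := by
  obtain ⟨i, work, pos, out⟩ := c
  induction i with
  | zero => exact Exec.loop_neg (by simp [Transducer.scan]) h
  | succ i ih =>
    refine Exec.loop_pos ?_ (Exec.act h) ?_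
    · simp only [Transducer.scan]
      cases w[i]? <;> simp
    · have h' : Store.Within w s (⟨i, work, pos, out⟩ : SStore M K) :=
        ⟨(Nat.le_succ i).trans h.1, h.2⟩
      convert ih h' using 1
      simp only [Store.apply, Store.heads, Function.update_eq_self, Transducer.moveHead,
        Store.mk.injEq, Option.toList_none, List.append_nil, and_true]
      have := h'.1
      simp only at this
      omega

/-- No record of the previous run is needed: the used cells form an initial segment that the head
never leaves by more than one cell, so running to the first blank and erasing backwards clears each
tape. Positivity of `s₁` is asked for only if there is a tape at all. -/
theorem Inv.exec_reset (h : Inv w s s₁ W c ρ) (hs : s₁ < s) (hs₁ : ∀ _ : M.Tp, 0 < s₁) :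
    ∃ c', Exec w s (reset M K) c c' ∧ Inv w s s₁ W c' ρ ∧ Sim M.init c' ∧ c'.out = c.out := by
  choose q hq1 hqs hpq hvis using h.sim
  have e1 := exec_advance h.within (fun t => c.work (.sim t)) (fun t => c.pos (.sim t)) q hvis hpq
    fun t => (hqs t).trans_lt hs
  rw [setSim_self] at e1
  obtain ⟨τ', hτ', e2⟩ := exec_erase h.within (fun t => c.work (.sim t)) q hvis hq1
    fun t => (hqs t).trans_lt hs
  have h0 : ∀ _ : M.Tp, 0 < s := fun t => (hs₁ t).trans hs
  have e3 := exec_simwise h.within (fun _ => (Sym.cell true M.blank, Move.stay)) τ' h0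
  set c₁ := setSim c (fun t => Function.update (τ' t) 0 (Sym.cell true M.blank)) (fun _ => 0)
    with hc₁
  have hw₁ : c₁.Within w s := within_setSim h.within _ h0
  have e4 := exec_inputHome hw₁
  set c₂ : SStore M K := { c₁ with inPos := 0 } with hc₂
  have hw₂ : c₂.Within w s := ⟨Nat.zero_le _, hw₁.2⟩
  have e5 := Exec.act (f := fun _ h => (Move.stay, fun
      | .ctl => (Sym.state (M.start, none), Move.stay)
      | x => (h x, Move.stay), none)) hw₂
  refine ⟨_, Exec.seq e1 (Exec.seq e2 (Exec.seq e3 (Exec.seq e4 e5))), ?_, ?_, ?_⟩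
  · refine ⟨⟨min_le_right _ _, ?_⟩, fun i => ?_, fun i => ?_, ?_, fun t => ⟨1, le_rfl, hs₁ t, ?_, ?_⟩⟩
    · rintro (t | i | _)
      · exact hw₂.2 (.sim t)
      · exact hw₂.2 (.reg i)
      · exact hw₂.2 .ctl
    · simpa [Store.apply, Store.heads, hc₂, hc₁, setSim] using h.reg i
    · simpa [Store.apply, hc₂, hc₁, setSim, Transducer.moveHead] using h.pos_reg i
    · simpa [Store.apply, hc₂, hc₁, setSim, Transducer.moveHead] using h.pos_ctl
    · simp [Store.apply, hc₂, hc₁, setSim, Transducer.moveHead]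
    · intro i
      constructor
      · intro hi
        obtain rfl : i = 0 := by omega
        simp [Store.apply, Store.heads, hc₂, hc₁, setSim, Sym.isBlank, Sym.isFirst]
      · intro hi
        have hi0 : i ≠ 0 := by omega
        simpa [Store.apply, Store.heads, hc₂, hc₁, setSim, hi0] using (hτ' t i).2 hi
  · refine ⟨by simp [Store.apply, hc₂, Transducer.init, Transducer.moveHead], ⟨none, ?_⟩,
      fun t => ?_, fun t i => ?_⟩
    · have : c.pos .ctl = 0 := h.pos_ctl
      simp [Store.apply, hc₂, hc₁, setSim, Transducer.init, this]
    · simp [Store.apply, hc₂, hc₁, setSim, Transducer.init, Transducer.moveHead]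
    · by_cases hi0 : i = 0
      · subst hi0
        simp [Store.apply, Store.heads, hc₂, hc₁, setSim, Transducer.init, Sym.content]
      · have := (hτ' t i).2 (by omega)
        simp [Store.apply, Store.heads, hc₂, hc₁, setSim, Transducer.init, hi0, this, Sym.content]
  · simp [Store.apply, hc₂, hc₁, setSim]

end Simulation


/-! ### Simulated steps and correctness of compiled register programs -/

namespace Simulation

open Prog

variable {α : Type} {M : Transducer α (Option Bool)} {K : ℕ}
variable {w : List α} {s s₁ W : ℕ} {c : SStore M K} {ρ : ℕ → ℕ}

theorem Sim.simNext_eq {d : M.Cfg} (h : Sim d c) (hi : Inv w s s₁ W c ρ) :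
    simNext M K (Transducer.scan w c.inPos) c.heads =
      M.δ d.state (Transducer.scan w d.inPos) (fun t => d.work t (d.pos t)) := by
  obtain ⟨o, ho⟩ := h.state
  have h1 : ctlState M K c.heads = (d.state, o) := by
    simp [ctlState, Store.heads, hi.pos_ctl, ho, Sym.control]
  have h2 : (fun t => (c.heads (.sim t)).content M.blank) = fun t => d.work t (d.pos t) := by
    funext t
    rw [Store.heads, h.work, h.pos]
  rw [simNext, h1, h2, h.inPos]

theorem Inv.exec_simStep {d d' : M.Cfg} (hi : Inv w s s₁ W c ρ) (h : Sim d c)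
    (hd : M.step w d = some d') (hs : s₁ < s) (hpos : ∀ t, d.pos t < s₁)
    (hpos' : ∀ t, d'.pos t < s₁) :
    ∃ c', Exec w s (simStep M K) c c' ∧ Inv w s s₁ W c' ρ ∧ Sim d' c' ∧ c'.out = c.out ∧
      d'.out = d.out ++ (ctlState M K c'.heads).2.toList := by
  have hnext := h.simNext_eq hi
  simp only [Transducer.step, Option.map_eq_some_iff] at hd
  obtain ⟨r, hr, rfl⟩ := hd
  rw [hr] at hnext
  have hex := Exec.act (f := fun s h => match simNext M K s h with
    | none => idle h
    | some r => (r.2.1, fun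
      | .sim t => (Sym.cell (h (.sim t)).isFirst (r.2.2.1 t).1, (r.2.2.1 t).2)
      | .reg i => (h (.reg i), Move.stay)
      | .ctl => (Sym.state (r.1, r.2.2.2), Move.stay), none)) hi.within
  rw [hnext] at hex
  refine ⟨_, hex, ⟨⟨min_le_right _ _, ?_⟩, fun i => ?_, fun i => ?_, ?_, fun t => ?_⟩,
    ⟨?_, ⟨r.2.2.2, ?_⟩, fun t => ?_, fun t i => ?_⟩, ?_, ?_⟩
  · rintro (t | i | _)
    · have := hpos' t
      simp only [Store.apply, h.pos]
      simp only at this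
      omega
    · exact hi.within.2 (.reg i)
    · exact hi.within.2 .ctl
  · simpa [Store.apply, Store.heads] using hi.reg i
  · simpa [Store.apply, Transducer.moveHead] using hi.pos_reg i
  · simpa [Store.apply, Transducer.moveHead] using hi.pos_ctl
  · obtain ⟨q, hq1, hqs, hpq, hvis⟩ := hi.sim t
    have h1 := hpos t
    rw [← h.pos] at h1
    -- The written cell counts as used even if it was the first blank one. It keeps its flag, and a
    -- blank is not flagged as first.
    refine ⟨max q (c.pos (.sim t) + 1), by omega, by omega, ?_, fun i => ⟨fun hlt => ?_, fun hle => ?_⟩⟩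
    · simp only [Store.apply]
      cases (r.2.2.1 t).2 <;> simp only [Transducer.moveHead] <;> omega
    · by_cases hip : i = c.pos (.sim t)
      · subst hip
        simp only [Store.apply, Function.update_self]
        exact ⟨rfl, hvis.isFirst_iff hq1 _⟩
      · simp only [Store.apply, Function.update_of_ne hip]
        exact (hvis i).1 (by omega)
    · have hip : i ≠ c.pos (.sim t) := by omega
      simp only [Store.apply, Function.update_of_ne hip]
      exact (hvis i).2 (by omega)
  · simp [Store.apply, h.inPos]
  · simp [Store.apply, hi.pos_ctl]
  · simp [Store.apply, h.pos]
  · by_cases hip : i = d.pos t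
    · subst hip
      simp [Store.apply, h.pos, Sym.content]
    · simp [Store.apply, h.pos, hip, h.work]
  · simp [Store.apply]
  · have : (Store.apply w c (r.2.1, fun
      | .sim t => (Sym.cell (c.heads (.sim t)).isFirst (r.2.2.1 t).1, (r.2.2.1 t).2)
      | .reg i => (c.heads (.reg i), Move.stay)
      | .ctl => (Sym.state (r.1, r.2.2.2), Move.stay), none) : SStore M K).heads .ctl =
        Sym.state (r.1, r.2.2.2) := by
      simp [Store.apply, Store.heads, Transducer.moveHead]
    simp only [ctlState]
    rw [this]
    rfl

/-- Zero is reserved for a missing symbol, so a result register that is still zero means that the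
requested symbol has not been met. -/
theorem symCode_pos (b : Option Bool) : symCode (some b) ≠ 0 := by
  rcases b with _ | _ | _ <;> simp [symCode]

theorem symCode_le (b : Option (Option Bool)) : symCode b ≤ 3 := by
  rcases b with _ | _ | _ | _ <;> simp [symCode]

theorem update_twice {n p r : ℕ} (hpn : p ≠ n) (hrn : r ≠ n) (a b d a' b' d' : ℕ) :
    Function.update (Function.update (Function.update (Function.update (Function.update
      (Function.update ρ p a) r b) n d) n d') p a') r b' =
    Function.update (Function.update (Function.update ρ p a') r b') n d' := by
  funext i
  simp only [Function.update_apply]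
  split_ifs <;> simp_all

/-- While `p` is positive, it counts the symbols still to be skipped. Once it is zero, the register
`r` decides: if `r` is zero, the current symbol is the requested one; otherwise the request has been
answered before. -/
theorem Inv.exec_handle {p r n : ℕ} {l : List (Option Bool)} (hp : p ≤ K) (hr : r ≤ K) (hn : n ≤ K)
    (hpr : p ≠ r) (hpn : p ≠ n) (hrn : r ≠ n)
    (hi : Inv w s s₁ W c (Cmd.passEnv ρ p r n l)) (hs : W + 2 ≤ s) (h3 : 3 < 2 ^ W)
    (hl : (l ++ (ctlState M K c.heads).2.toList).length < 2 ^ W) :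
    ∃ c', Exec w s (handle M K (regTape M.Tp K p) (regTape M.Tp K r) (regTape M.Tp K n)) c c' ∧
      Inv w s s₁ W c' (Cmd.passEnv ρ p r n (l ++ (ctlState M K c.heads).2.toList)) ∧
      SameSim c c' := by
  cases ho : (ctlState M K c.heads).2 with
  | none =>
    refine ⟨c, Exec.ite_pos ho (exec_nop hi.within), ?_, SameSim.refl c⟩
    simpa using hi
  | some b =>
    rw [ho] at hl
    simp only [Option.toList_some, List.length_append, List.length_singleton] at hl ⊢
    have en : Cmd.passEnv ρ p r n l n = l.length := by simp [Cmd.passEnv]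
    have ep : ∀ x, Function.update (Cmd.passEnv ρ p r n l) n x p = ρ p - l.length := by
      simp [Cmd.passEnv, hpr, hpn]
    have er : ∀ x, Function.update (Cmd.passEnv ρ p r n l) n x r = symCode l[ρ p]? := by
      simp [Cmd.passEnv, hrn]
    obtain ⟨c₁, hc₁, hi₁, hsame₁⟩ := hi.exec_incr hs hn (by rw [en]; exact hl)
    rw [en] at hi₁
    have ho₁ : (ctlState M K c₁.heads).2 = some b := by rw [hsame₁.ctlState, ho]
    have hlen : (l ++ [b]).length = l.length + 1 := by simp
    have goal_eq : ∀ a' b', a' = ρ p - (l.length + 1) → b' = symCode (l ++ [b])[ρ p]? →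
        Function.update (Function.update (Function.update (Cmd.passEnv ρ p r n l) n
          (l.length + 1)) p a') r b' = Cmd.passEnv ρ p r n (l ++ [b]) := by
      rintro _ _ rfl rfl
      rw [Cmd.passEnv, update_twice hpn hrn, Cmd.passEnv, hlen]
    suffices H : ∃ c', Exec w s (ite (fun _ h => h (regTape M.Tp K p) = Sym.mark true)
        (decr (regTape M.Tp K p))
        (ite (fun _ h => h (regTape M.Tp K r) = Sym.mark true) (nop M K)
        (ite (fun _ h => (ctlState M K h).2 = some none) (incr (regTape M.Tp K r))
        (ite (fun _ h => (ctlState M K h).2 = some (some false))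
          (seq (incr (regTape M.Tp K r)) (incr (regTape M.Tp K r)))
          (seq (incr (regTape M.Tp K r)) (seq (incr (regTape M.Tp K r))
            (incr (regTape M.Tp K r)))))))) c₁ c' ∧
        Inv w s s₁ W c' (Cmd.passEnv ρ p r n (l ++ [b])) ∧ SameSim c₁ c' by
      obtain ⟨c', hc', hi', hsame'⟩ := H
      exact ⟨c', Exec.ite_neg (by rw [ho]; simp) (Exec.seq hc₁ hc'), hi', hsame₁.trans hsame'⟩
    by_cases hlt : ρ p - l.length = 0
    · by_cases hr0 : symCode l[ρ p]? = 0
      · have hpl : ρ p = l.length := by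
          rcases Nat.lt_or_ge (ρ p) l.length with hh | hh
          · rw [List.getElem?_eq_getElem hh] at hr0
            exact absurd hr0 (symCode_pos _)
          · omega
        have hcode : (l ++ [b])[ρ p]? = some b := by simp [hpl]
        have fin : Inv w s s₁ W c₁ (Function.update (Function.update (Function.update
            (Cmd.passEnv ρ p r n l) n (l.length + 1)) p 0) r 0) := by
          convert hi₁ using 1
          rw [Function.update_eq_self_iff.2 (by rw [Function.update_of_ne hpr.symm, er, hr0]),
            Function.update_eq_self_iff.2 (by rw [ep, hlt])]
        set ρ' := Function.update (Function.update (Cmd.passEnv ρ p r n l) n (l.length + 1)) p 0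
          with hρ'
        have up : ∀ m c₂, Inv w s s₁ W c₂ (Function.update ρ' r m) → m < 3 →
            ∃ c₃, Exec w s (incr (regTape M.Tp K r)) c₂ c₃ ∧
            Inv w s s₁ W c₃ (Function.update ρ' r (m + 1)) ∧ SameSim c₂ c₃ := by
          intro m c₂ h₂ hm
          have := h₂.exec_incr hs hr (by simp; omega)
          simpa using this
        have test : ¬ c₁.heads (regTape M.Tp K p) = Sym.mark true := by
          rw [hi₁.heads_regTape hp, ep, hlt]; simp
        have test' : ¬ c₁.heads (regTape M.Tp K r) = Sym.mark true := by
          rw [hi₁.heads_regTape hr, er, hr0]; simp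
        obtain ⟨c₂, e₂, i₂, s₂⟩ := up 0 c₁ fin (by norm_num)
        obtain ⟨c₃, e₃, i₃, s₃⟩ := up 1 c₂ i₂ (by norm_num)
        obtain ⟨c₄, e₄, i₄, s₄⟩ := up 2 c₃ i₃ (by norm_num)
        rcases b with _ | _ | _
        · refine ⟨c₂, Exec.ite_neg test (Exec.ite_neg test' (Exec.ite_pos ho₁ e₂)), ?_, s₂⟩
          rwa [goal_eq 0 1 (by omega) (by rw [hcode]; rfl)] at i₂
        · refine ⟨c₃, Exec.ite_neg test (Exec.ite_neg test' (Exec.ite_neg (by rw [ho₁]; simp)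
            (Exec.ite_pos ho₁ (Exec.seq e₂ e₃)))), ?_, s₂.trans s₃⟩
          rwa [goal_eq 0 2 (by omega) (by rw [hcode]; rfl)] at i₃
        · refine ⟨c₄, Exec.ite_neg test (Exec.ite_neg test' (Exec.ite_neg (by rw [ho₁]; simp)
            (Exec.ite_neg (by rw [ho₁]; simp) (Exec.seq e₂ (Exec.seq e₃ e₄))))), ?_,
            (s₂.trans s₃).trans s₄⟩
          rwa [goal_eq 0 3 (by omega) (by rw [hcode]; rfl)] at i₄
      · refine ⟨c₁, Exec.ite_neg ?_ (Exec.ite_pos ?_ (exec_nop hi₁.within)), ?_, SameSim.refl _⟩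
        · rw [hi₁.heads_regTape hp, ep, hlt]; simp
        · rwa [hi₁.heads_regTape hr, er]
        · rw [← goal_eq (ρ p - l.length) (symCode l[ρ p]?) (by omega) ?_]
          · rwa [Function.update_eq_self_iff.2 (by rw [Function.update_of_ne hpr.symm, er]),
              Function.update_eq_self_iff.2 (by rw [ep])]
          · have : ρ p < l.length := by
              by_contra hh
              exact hr0 (by rw [List.getElem?_eq_none (by omega)]; rfl)
            rw [List.getElem?_append_left this]
    · obtain ⟨c₂, hc₂, hi₂, hsame₂⟩ := hi₁.exec_decr hs hp
      refine ⟨c₂, Exec.ite_pos ?_ hc₂, ?_, hsame₂⟩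
      · rwa [hi₁.heads_regTape hp, ep]
      · rw [ep] at hi₂
        rw [← goal_eq (ρ p - l.length - 1) (symCode l[ρ p]?) (by omega) ?_]
        · rwa [Function.update_eq_self_iff.2]
          rw [Function.update_of_ne hpr.symm, er]
        · rw [List.getElem?_eq_none (by omega), List.getElem?_eq_none (by simp; omega)]

/-- Induction along the computation of the simulated machine; the registers always describe the
answer for the output produced so far. Since the output only grows, its final length bounds all
intermediate counts. -/
theorem Inv.exec_simulation {d e : M.Cfg} {p r n : ℕ} (hp : p ≤ K) (hr : r ≤ K) (hn : n ≤ K)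
    (hpr : p ≠ r) (hpn : p ≠ n) (hrn : r ≠ n) (hs : W + 2 ≤ s) (hs₁ : s₁ < s) (h3 : 3 < 2 ^ W)
    (he : M.step w e = none) (hl : e.out.length < 2 ^ W)
    (hde : StateTransition.Reaches (M.step w) d e)
    (hpos : ∀ d', StateTransition.Reaches (M.step w) d d' → ∀ t, d'.pos t < s₁)
    (h : Sim d c) (hi : Inv w s s₁ W c (Cmd.passEnv ρ p r n d.out)) :
    ∃ c', Exec w s (loop (fun s h => simNext M K s h ≠ none) (seq (simStep M K)
        (handle M K (regTape M.Tp K p) (regTape M.Tp K r) (regTape M.Tp K n)))) c c' ∧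
      Inv w s s₁ W c' (Cmd.passEnv ρ p r n e.out) ∧ c'.out = c.out := by
  have hlen : ∀ d : M.Cfg, StateTransition.Reaches (M.step w) d e →
      d.out.length ≤ e.out.length := by
    intro d hde
    induction hde using Relation.ReflTransGen.head_induction_on with
    | refl => exact le_rfl
    | head hd _ ih =>
      simp only [Transducer.step, Option.mem_def, Option.map_eq_some_iff] at hd
      obtain ⟨x, -, rfl⟩ := hd
      exact le_trans (by simp) ih
  induction hde using Relation.ReflTransGen.head_induction_on generalizing c with
  | refl =>
    refine ⟨c, Exec.loop_neg ?_ hi.within, hi, rfl⟩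
    rw [h.simNext_eq hi, not_not]
    simpa [Transducer.step] using he
  | @head d d' hd hde ih =>
    obtain ⟨c₁, e₁, i₁, h₁, o₁, ho₁⟩ := hi.exec_simStep h hd hs₁
      (hpos d Relation.ReflTransGen.refl) (hpos d' (Relation.ReflTransGen.single hd))
    obtain ⟨c₂, e₂, i₂, s₂⟩ := i₁.exec_handle hp hr hn hpr hpn hrn hs h3
      (by rw [← ho₁]; exact (hlen _ hde).trans_lt hl)
    rw [← ho₁] at i₂
    obtain ⟨c₃, e₃, i₃, o₃⟩ := ih (fun x hx => hpos x (Relation.ReflTransGen.head hd hx))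
      (s₂.2.2.2 _ h₁) i₂
    refine ⟨c₃, Exec.loop_pos ?_ (Exec.seq e₁ e₂) e₃, i₃, by rw [o₃, s₂.1, o₁]⟩
    rw [h.simNext_eq hi]
    intro hnone
    simp [Transducer.step, hnone] at hd

/-- The machine implements register programs. -/
theorem Inv.exec_compile {v : List (Option Bool)} {B : ℕ} (hout : M.Outputs w v)
    (hspace : M.UsesSpace w s₁) (hs : W + 2 ≤ s) (hs₁ : s₁ < s) (hB : B < 2 ^ W)
    {p : Cmd} {o : List (Option Bool)} {ρ' : ℕ → ℕ}
    (hp : p.Big v B ρ o ρ') (hK : p.bound ≤ K) (hi : Inv w s s₁ W c ρ) :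
    ∃ c', Exec w s (compile M K p) c c' ∧ Inv w s s₁ W c' ρ' ∧ c'.out = c.out ++ o := by
  induction hp generalizing c with
  | skip => exact ⟨c, exec_nop hi.within, hi, by simp⟩
  | inc h =>
    obtain ⟨c', hc', hi', hsame⟩ := hi.exec_incr hs hK (h.trans_lt hB)
    exact ⟨c', hc', hi', by simp [hsame.1]⟩
  | dec =>
    obtain ⟨c', hc', hi', hsame⟩ := hi.exec_decr hs hK
    exact ⟨c', hc', hi', by simp [hsame.1]⟩
  | @out ρ b =>
    have := Exec.act (f := fun _ h => (Move.stay, fun t => (h t, Move.stay), some b)) hi.within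
    have heq : c.apply w (Move.stay, fun t => (c.heads t, Move.stay), some b) =
        { c with out := c.out ++ [b] } := by
      have h1 := hi.within.1
      simp [Store.apply, Store.heads, Transducer.moveHead, h1]
    rw [heq] at this
    exact ⟨_, this, ⟨hi.within, hi.reg, hi.pos_reg, hi.pos_ctl, hi.sim⟩, rfl⟩
  | seq _ _ ihp ihq =>
    simp only [Cmd.bound, max_le_iff] at hK
    obtain ⟨c₁, e₁, i₁, o₁⟩ := ihp hK.1 hi
    obtain ⟨c₂, e₂, i₂, o₂⟩ := ihq hK.2 i₁
    exact ⟨c₂, Exec.seq e₁ e₂, i₂, by rw [o₂, o₁, List.append_assoc]⟩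
  | ite_pos h _ ih =>
    simp only [Cmd.bound, max_le_iff] at hK
    obtain ⟨c₁, e₁, i₁, o₁⟩ := ih hK.2.1 hi
    exact ⟨c₁, Exec.ite_pos ((hi.heads_regTape hK.1).2 h) e₁, i₁, o₁⟩
  | ite_neg h _ ih =>
    simp only [Cmd.bound, max_le_iff] at hK
    obtain ⟨c₁, e₁, i₁, o₁⟩ := ih hK.2.2 hi
    exact ⟨c₁, Exec.ite_neg (fun h' => (hi.heads_regTape hK.1).1 h' h) e₁, i₁, o₁⟩
  | loop_pos h _ _ ihp ihq =>
    have hK' := hK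
    simp only [Cmd.bound, max_le_iff] at hK'
    obtain ⟨c₁, e₁, i₁, o₁⟩ := ihp hK'.2 hi
    obtain ⟨c₂, e₂, i₂, o₂⟩ := ihq hK i₁
    exact ⟨c₂, Exec.loop_pos ((hi.heads_regTape hK'.1).2 h) e₁ e₂, i₂,
      by rw [o₂, o₁, List.append_assoc]⟩
  | loop_neg h =>
    simp only [Cmd.bound, max_le_iff] at hK
    exact ⟨c, Exec.loop_neg (fun h' => (hi.heads_regTape hK.1).1 h' h) hi.within, hi, by simp⟩
  | @pass ρ p r n hpr hpn hrn hr hn hw h3 =>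
    simp only [Cmd.bound, max_le_iff] at hK
    obtain ⟨e, hreach, hstep, rfl⟩ := hout
    obtain ⟨c₁, e₁, i₁, h₁, o₁⟩ := hi.exec_reset hs₁ fun t =>
      (Nat.zero_le _).trans_lt (hspace M.init Relation.ReflTransGen.refl t)
    -- As `r` and `n` start at zero and nothing has been written, `ρ` is already the environment for
    -- the empty prefix.
    have henv : ρ = Cmd.passEnv ρ p r n M.init.out := by
      funext i
      simp only [Cmd.passEnv, Transducer.init, Function.update_apply]
      split_ifs <;> simp_all [symCode]
    obtain ⟨c₂, e₂, i₂, o₂⟩ := Inv.exec_simulation (ρ := ρ) hK.1 hK.2.1 hK.2.2 hpr hpn hrn hs hs₁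
      (h3.trans_lt hB) hstep (hw.trans_lt hB) hreach hspace h₁ (by rwa [← henv])
    exact ⟨c₂, Exec.seq e₁ e₂, i₂, by rw [o₂, o₁]; simp⟩

/-- The simulating machine computes the output of a register program. -/
theorem outputs_compile {v : List (Option Bool)} {B : ℕ} (hout : M.Outputs w v)
    (hspace : M.UsesSpace w s₁) (hs : W + 2 ≤ s) (hs₁ : s₁ < s) (hB : B < 2 ^ W)
    {p : Cmd} {o : List (Option Bool)} {ρ' : ℕ → ℕ} (hp : p.Big v B (fun _ => 0) o ρ')
    (hK : p.bound ≤ K) [Finite M.State] [Finite M.Tp] [Finite M.Γ] :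
    (toTransducer (Sym.blank : Alph M) (seq (prepare M K) (compile M K p))).Outputs w o ∧
    (toTransducer (Sym.blank : Alph M) (seq (prepare M K) (compile M K p))).UsesSpace w s := by
  set c₀ : SStore M K := ⟨0, fun _ _ => Sym.blank, fun _ => 0, []⟩ with hc₀
  have hw₀ : c₀.Within w s := ⟨Nat.zero_le _, fun _ => by simp only [hc₀]; omega⟩
  have e₀ := Exec.act (f := fun _ h => (Move.stay, fun
    | .sim _ => (Sym.cell true M.blank, Move.stay)
    | .reg _ => (Sym.mark false, Move.stay)
    | .ctl => (h .ctl, Move.stay), none)) hw₀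
  have i₀ : Inv w s s₁ W (c₀.apply w (Move.stay, fun
      | .sim _ => (Sym.cell true M.blank, Move.stay)
      | .reg _ => (Sym.mark false, Move.stay)
      | .ctl => (c₀.heads .ctl, Move.stay), none)) fun _ => 0 := by
    refine ⟨⟨min_le_right _ _, ?_⟩, fun i => ?_, fun i => ?_, ?_, fun t => ?_⟩
    · rintro (t | i | _)
      · exact hw₀.2 (.sim t)
      · exact hw₀.2 (.reg i)
      · exact hw₀.2 .ctl
    · refine ⟨[], by simp, rfl, ?_⟩
      funext i
      rcases i with _ | i <;> simp [Store.apply, hc₀, bitTape]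
    · simp [Store.apply, hc₀, Transducer.moveHead]
    · simp [Store.apply, hc₀, Transducer.moveHead]
    · refine ⟨1, le_rfl, ?_, by simp [Store.apply, hc₀, Transducer.moveHead], fun i =>
        ⟨fun hi => ?_, fun hi => ?_⟩⟩
      · exact (Nat.zero_le _).trans_lt (hspace M.init Relation.ReflTransGen.refl t)
      · obtain rfl : i = 0 := by omega
        simp [Store.apply, hc₀, Sym.isBlank, Sym.isFirst]
      · have : i ≠ 0 := by omega
        simp [Store.apply, hc₀, this]
  obtain ⟨c', e', i', o'⟩ := i₀.exec_compile hout hspace hs hs₁ hB hp hK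
  have ho : c'.out = o := by rw [o']; simp [Store.apply, hc₀]
  rw [← ho]
  exact Exec.outputs _ _ (Exec.seq e₀ e') i'.within.2

end Simulation


/-! ### Running time and length of the output -/

namespace Transducer

variable {α β : Type} (M : Transducer α β) (w : List α)

/-- The machine halts after exactly `n` steps. -/
def HaltsIn : ℕ → M.Cfg → Prop
  | 0, c => M.step w c = none
  | n + 1, c => ∃ c', M.step w c = some c' ∧ HaltsIn n c'

variable {M w}

/-- A step appends at most one symbol, so the running time bounds the length of the output. -/
theorem exists_haltsIn {c e : M.Cfg} (h : StateTransition.Reaches (M.step w) c e)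
    (he : M.step w e = none) :
    ∃ n, M.HaltsIn w n c ∧ e.out.length ≤ c.out.length + n := by
  induction h using Relation.ReflTransGen.head_induction_on with
  | refl => exact ⟨0, he, le_rfl⟩
  | @head c c' hc _ ih =>
    obtain ⟨n, hn, hlen⟩ := ih
    refine ⟨n + 1, ⟨c', hc, hn⟩, hlen.trans ?_⟩
    simp only [step, Option.mem_def, Option.map_eq_some_iff] at hc
    obtain ⟨r, -, rfl⟩ := hc
    have : r.2.2.2.toList.length ≤ 1 := by cases r.2.2.2 <;> simp
    simp only [List.length_append]
    omega

theorem HaltsIn.exists_reaches {n : ℕ} {c : M.Cfg} (h : M.HaltsIn w n c) {i : ℕ} (hi : i ≤ n) :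
    ∃ d, StateTransition.Reaches (M.step w) c d ∧ M.HaltsIn w i d := by
  induction n generalizing c with
  | zero =>
    obtain rfl : i = 0 := by omega
    exact ⟨c, Relation.ReflTransGen.refl, h⟩
  | succ n ih =>
    rcases hi.eq_or_lt with rfl | hlt
    · exact ⟨c, Relation.ReflTransGen.refl, h⟩
    · obtain ⟨c', hc, hc'⟩ := h
      obtain ⟨d, hd, hi⟩ := ih hc' (by omega)
      exact ⟨d, Relation.ReflTransGen.head hc hd, hi⟩

/-- The output is never read. The rest of the configuration determines the future, in particular the
remaining running time. -/
theorem HaltsIn.unique {n m : ℕ} {c d : M.Cfg} (hc : M.HaltsIn w n c) (hd : M.HaltsIn w m d)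
    (h1 : c.state = d.state) (h2 : c.inPos = d.inPos) (h3 : c.work = d.work) (h4 : c.pos = d.pos) :
    n = m := by
  obtain ⟨q, i, τ, p, o⟩ := c
  obtain ⟨q', i', τ', p', o'⟩ := d
  simp only at h1 h2 h3 h4
  subst h1 h2 h3 h4
  induction n generalizing m q i τ p o o' with
  | zero =>
    rcases m with _ | m
    · rfl
    · obtain ⟨d', hd', -⟩ := hd
      simp only [HaltsIn, step, Option.map_eq_none_iff] at hc
      simp [step, hc] at hd'
  | succ n ih =>
    obtain ⟨c', hc', hcn⟩ := hc
    simp only [step, Option.map_eq_some_iff] at hc'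
    obtain ⟨r, hr, rfl⟩ := hc'
    rcases m with _ | m
    · simp only [HaltsIn, step, Option.map_eq_none_iff] at hd
      simp [hd] at hr
    · obtain ⟨d', hd', hdm⟩ := hd
      simp only [step, hr, Option.map_some, Option.some.injEq] at hd'
      subst hd'
      rw [ih _ _ _ _ _ hcn _ hdm]

theorem Reaches.inPos_le {c : M.Cfg} (h : M.Reaches w c) : c.inPos < w.length + 2 := by
  rcases Relation.ReflTransGen.cases_tail h with h | ⟨d, _, hd⟩
  · rw [h]; simp [init]
  · simp only [step, Option.mem_def, Option.map_eq_some_iff] at hd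
    obtain ⟨r, -, rfl⟩ := hd
    simp only
    omega

theorem Reaches.work_eq {s : ℕ} {c : M.Cfg} (h : M.Reaches w c) (hs : M.UsesSpace w s) (t : M.Tp)
    (i : ℕ) (hi : s ≤ i) : c.work t i = M.blank := by
  induction h with
  | refl => rfl
  | @tail d c hd hdc ih =>
    have := hs d hd t
    simp only [step, Option.mem_def, Option.map_eq_some_iff] at hdc
    obtain ⟨r, -, rfl⟩ := hdc
    simpa [show i ≠ d.pos t by omega] using ih

/-- Two moments of a halting run that agree in state, heads and tapes have the same remaining time
and therefore coincide. So the running time, and with it the output, is shorter than the number of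
configurations within the space bound. -/
theorem Outputs.length_lt {s : ℕ} {v : List β} (h : M.Outputs w v) (hs : M.UsesSpace w s) :
    v.length < Nat.card M.State * ((w.length + 2) * ((Nat.card M.Γ ^ s) ^ Nat.card M.Tp *
      s ^ Nat.card M.Tp)) := by
  have := M.finiteState
  have := M.finiteTp
  have := M.finiteΓ
  obtain ⟨e, hreach, he, rfl⟩ := h
  obtain ⟨n, hn, hlen⟩ := exists_haltsIn hreach he
  have : Nonempty M.Cfg := ⟨M.init⟩
  choose! d hd hdn using fun i (hi : i ≤ n) => hn.exists_reaches hi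
  -- The configuration `d i` has exactly `i` steps to go, so it determines `i` even without its
  -- output component.
  let F : Fin (n + 1) → M.State × Fin (w.length + 2) × (M.Tp → Fin s → M.Γ) × (M.Tp → Fin s) :=
    fun i => ⟨(d i).state, ⟨(d i).inPos, Reaches.inPos_le (hd i (by omega))⟩,
      fun t j => (d i).work t j, fun t => ⟨(d i).pos t, hs _ (hd i (by omega)) t⟩⟩
  have hF : Function.Injective F := by
    intro i j hij
    simp only [F, Prod.mk.injEq, Fin.mk.injEq] at hij
    obtain ⟨h1, h2, h3, h4⟩ := hij
    ext
    refine (hdn i (by omega)).unique (hdn j (by omega)) h1 h2 ?_ ?_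
    · funext t k
      rcases Nat.lt_or_ge k s with hk | hk
      · exact congrFun (congrFun h3 t) ⟨k, hk⟩
      · rw [Reaches.work_eq (hd i (by omega)) hs t k hk, Reaches.work_eq (hd j (by omega)) hs t k hk]
    · funext t
      exact Fin.mk.inj_iff.1 (congrFun h4 t)
  have hcard := Nat.card_le_card_of_injective F hF
  simp only [Nat.card_prod, Nat.card_fun, Nat.card_fin] at hcard
  simp only [init, List.length_nil] at hlen
  omega

end Transducer

/-- Absorbs the number of input head positions into an exponent that is linear in `k` and `log x`.
-/
theorem add_le_two_pow_mul (x k : ℕ) : x + k + 2 ≤ 2 ^ (k + Nat.log 2 x + 2) := by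
  have h1 : x < 2 ^ (Nat.log 2 x + 1) := Nat.lt_pow_succ_log_self (by norm_num) x
  have h2 : k + 1 < 2 ^ (k + 1) := Nat.lt_two_pow_self
  have h3 : 2 ^ (Nat.log 2 x + 1) ≤ 2 ^ (k + Nat.log 2 x + 1) :=
    Nat.pow_le_pow_right (by norm_num) (by omega)
  have h4 : 2 ^ (k + 1) ≤ 2 ^ (k + Nat.log 2 x + 1) :=
    Nat.pow_le_pow_right (by norm_num) (by omega)
  rw [pow_succ 2 (k + Nat.log 2 x + 1)]
  omega

theorem length_tapeWord {α : Type} (z : List α × ℕ) : (tapeWord z).length = z.1.length + z.2 := by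
  simp [tapeWord]

/-- The composition of a reduction in parameterized logspace with a map that is computed by a
register program with polynomially bounded registers. -/
theorem plComputable_comp {α : Type} {R₁ : List α × ℕ → List Bool × ℕ} (h₁ : PLComputable R₁)
    {R : List Bool × ℕ → List Bool × ℕ} (p : Cmd) (e : ℕ)
    (hp : ∀ y, ∃ ρ', p.Big (tapeWord y) (((tapeWord y).length + 2) ^ e) (fun _ => 0)
      (tapeWord (R y)) ρ') :
    PLComputable (R ∘ R₁) := by
  obtain ⟨M, f, c, hf, hM⟩ := h₁
  have := M.finiteState
  have := M.finiteTp
  have := M.finiteΓ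
  set a := Nat.card M.State with ha
  set g := Nat.card M.Γ with hg
  set t := Nat.card M.Tp with ht
  -- The space is that of the first machine, plus the counter width, plus 3. The width is `e` times
  -- a bound for the logarithm of the intermediate length, plus 1; its part that depends on `k` goes
  -- into the new function, its coefficient of `log` into the new constant.
  refine ⟨Prog.toTransducer (Sym.blank : Simulation.Alph M)
    (.seq (Simulation.prepare M p.bound) (Simulation.compile M p.bound p)),
    fun k => f k + e * (a + 4 + (g + 1) * t * f k + k) + 4, c + e * ((g + 1) * t * c + 1), ?_, ?_⟩
  · have hlin : Computable fun x : ℕ × ℕ => x.2 + e * (a + 4 + (g + 1) * t * x.2 + x.1) + 4 := by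
      refine Primrec.to_comp ?_
      refine Primrec.nat_add.comp (Primrec.nat_add.comp Primrec.snd (Primrec.nat_mul.comp
        (Primrec.const e) (Primrec.nat_add.comp (Primrec.nat_add.comp (Primrec.const _)
        (Primrec.nat_mul.comp (Primrec.const _) Primrec.snd)) Primrec.fst))) (Primrec.const 4)
    exact hlin.comp (Computable.id.pair hf)
  · intro z
    obtain ⟨hout, hspace⟩ := hM z
    obtain ⟨ρ', hbig⟩ := hp (R₁ z)
    set L := Nat.log 2 z.1.length with hL
    set s₁ := f z.2 + c * L with hs₁
    set W := e * (a + 4 + (g + 1) * t * s₁ + z.2 + L) + 1 with hW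
    -- Counting configurations gives the exponent with `a + 2` in place of `a + 4`; the factor 4
    -- gained here absorbs the summand 2 on the left.
    have hlen : (tapeWord (R₁ z)).length + 2 ≤ 2 ^ (a + 4 + (g + 1) * t * s₁ + z.2 + L) := by
      have h := hout.length_lt hspace
      rw [length_tapeWord z, ← ha, ← hg, ← ht] at h
      have h1 : a ≤ 2 ^ a := Nat.lt_two_pow_self.le
      have h2 := add_le_two_pow_mul z.1.length z.2
      have h3 : (g ^ s₁) ^ t ≤ ((2 ^ g) ^ s₁) ^ t :=
        Nat.pow_le_pow_left (Nat.pow_le_pow_left Nat.lt_two_pow_self.le _) _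
      have h4 : s₁ ^ t ≤ (2 ^ s₁) ^ t := Nat.pow_le_pow_left Nat.lt_two_pow_self.le _
      have h5 := h.trans_le (Nat.mul_le_mul h1 (Nat.mul_le_mul h2 (Nat.mul_le_mul h3 h4)))
      have h6 : 2 ^ a * (2 ^ (z.2 + L + 2) * (((2 ^ g) ^ s₁) ^ t * (2 ^ s₁) ^ t)) =
          2 ^ (a + 2 + (g + 1) * t * s₁ + z.2 + L) := by
        rw [← pow_mul, ← pow_mul, ← pow_mul, ← pow_add, ← pow_add, ← pow_add]
        congr 1
        ring
      rw [← hL, h6] at h5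
      have h7 : 2 ^ (a + 4 + (g + 1) * t * s₁ + z.2 + L) =
          4 * 2 ^ (a + 2 + (g + 1) * t * s₁ + z.2 + L) := by
        rw [show a + 4 + (g + 1) * t * s₁ + z.2 + L =
          2 + (a + 2 + (g + 1) * t * s₁ + z.2 + L) by ring, pow_add]
        norm_num
      rw [h7]
      omega
    have hB : ((tapeWord (R₁ z)).length + 2) ^ e < 2 ^ W := by
      refine (Nat.pow_le_pow_left hlen e).trans_lt ?_
      rw [← pow_mul, hW, mul_comm]
      exact Nat.pow_lt_pow_right (by norm_num) (Nat.lt_succ_self _)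
    have hspace' : f z.2 + e * (a + 4 + (g + 1) * t * f z.2 + z.2) + 4 +
        (c + e * ((g + 1) * t * c + 1)) * L = s₁ + W + 3 := by
      rw [hW, hs₁]; ring
    rw [hspace']
    exact Simulation.outputs_compile hout hspace (by omega) (by omega) hB hbig le_rfl

/-- Copying the input to the output. -/
theorem plComputable_id {α : Type} : PLComputable (id : List α × ℕ → List α × ℕ) := by
  let M : Transducer (Option α) (Option α) :=
    { State := Unit
      Tp := Empty
      Γ := Unit
      blank := ()
      start := ()
      δ := fun _ s _ => match s with
        | Scan.leftEnd => some ((), Move.right, fun _ => ((), Move.stay), none)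
        | Scan.sym a => some ((), Move.right, fun _ => ((), Move.stay), some a)
        | Scan.rightEnd => none }
  refine ⟨M, fun _ => 0, 0, Computable.const 0, fun z => ⟨?_, fun _ _ t => t.elim⟩⟩
  set w := tapeWord z with hw
  have key : ∀ i, i ≤ w.length → M.Reaches w ⟨(), i + 1, fun t => t.elim, fun t => t.elim,
      w.take i⟩ := by
    intro i
    induction i with
    | zero =>
      intro _
      refine Relation.ReflTransGen.single ?_
      simp only [Transducer.step, Transducer.init, Transducer.scan, Transducer.moveHead, M,
        Option.map_some, Option.mem_def, Option.some.injEq, Transducer.Cfg.mk.injEq, true_and]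
      refine ⟨by omega, funext fun t => t.elim, funext fun t => t.elim, by simp⟩
    | succ i ih =>
      intro hi
      refine Relation.ReflTransGen.tail (ih (by omega)) ?_
      have hget : w[i]? = some w[i] := List.getElem?_eq_getElem _
      simp only [Transducer.step, Transducer.scan, Transducer.moveHead, M, hget,
        Option.map_some, Option.mem_def, Option.some.injEq, Transducer.Cfg.mk.injEq, true_and]
      refine ⟨by omega, funext fun t => t.elim, ?_⟩
      rw [Option.toList_some, List.take_append_getElem]
  refine ⟨_, key w.length le_rfl, ?_, by simp [hw]⟩
  simp [Transducer.step, Transducer.scan, M]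


/-! ### Functions that are computed with polynomially bounded registers -/

/-- Input words of register programs. -/
abbrev Word : Type := List (Option Bool)

/-- The registers `ρ` below `n`, followed by the registers in the list `l`, followed by zeros. -/
def regs (ρ : ℕ → ℕ) (n : ℕ) (l : List ℕ) : ℕ → ℕ :=
  fun i => if i < n then ρ i else l.getD (i - n) 0

section regs

variable (ρ : ℕ → ℕ) (n : ℕ) (l : List ℕ)

theorem regs_of_lt {i : ℕ} (h : i < n) : regs ρ n l i = ρ i := if_pos h

theorem regs_add (j : ℕ) : regs ρ n l (n + j) = l.getD j 0 := by
  simp [regs]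

theorem regs_congr {l l' : List ℕ} (h : ∀ j, l.getD j 0 = l'.getD j 0) :
    regs ρ n l = regs ρ n l' := by
  funext i
  simp only [regs, h]

theorem update_regs {j : ℕ} (h : j < l.length) (x : ℕ) :
    Function.update (regs ρ n l) (n + j) x = regs ρ n (l.set j x) := by
  funext i
  simp only [Function.update_apply, regs]
  by_cases hi : i = n + j
  · subst hi
    simp [h]
  · by_cases hin : i < n
    · simp [hi, hin]
    · have : j ≠ i - n := by omega
      simp [hi, hin, this]

/-- Registers in use above `n` become part of the protected frame of a subprogram that works from `n
+ m` on. -/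
theorem regs_regs (l' : List ℕ) {m : ℕ} (h : l.length = m) :
    regs (regs ρ n l) (n + m) l' = regs ρ n (l ++ l') := by
  subst h
  funext i
  simp only [regs]
  by_cases hin : i < n
  · simp [hin, show i < n + l.length by omega]
  · by_cases hil : i < n + l.length
    · have : i - n < l.length := by omega
      simp [hin, hil, List.getElem?_append_left this]
    · have : l.length ≤ i - n := by omega
      simp [hin, hil, List.getElem?_append_right this, Nat.sub_sub]

end regs

/-! ### Loops and moves of register programs -/

namespace Cmd

variable {w : Word} {B : ℕ} {ρ : ℕ → ℕ} {n : ℕ} {l : List ℕ}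

theorem Big.then {p q : Cmd} {ρ ρ' ρ'' : ℕ → ℕ} {o : Word} (h : Big w B p ρ [] ρ')
    (h' : Big w B q ρ' o ρ'') : Big w B (Cmd.seq p q) ρ o ρ'' := Big.seq h h'

theorem Big.andThen {p q : Cmd} {ρ ρ' ρ'' : ℕ → ℕ} {o : Word} (h : Big w B p ρ o ρ')
    (h' : Big w B q ρ' [] ρ'') : Big w B (Cmd.seq p q) ρ o ρ'' := by
  simpa using Big.seq h h'

theorem Big.regs_congr {p : Cmd} {o : Word} {l₁ l₂ l₁' l₂' : List ℕ}
    (h : Big w B p (regs ρ n l₁) o (regs ρ n l₂)) (h₁ : ∀ j, l₁.getD j 0 = l₁'.getD j 0)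
    (h₂ : ∀ j, l₂.getD j 0 = l₂'.getD j 0) : Big w B p (regs ρ n l₁') o (regs ρ n l₂') := by
  rwa [← ParamCplx.regs_congr ρ n h₁, ← ParamCplx.regs_congr ρ n h₂]

theorem big_inc {j : ℕ} (hj : j < l.length) (hB : l.getD j 0 + 1 ≤ B) :
    Big w B (inc (n + j)) (regs ρ n l) [] (regs ρ n (l.set j (l.getD j 0 + 1))) := by
  have := Big.inc (w := w) (ρ := regs ρ n l) (v := n + j) (B := B) (by rwa [regs_add])
  rwa [regs_add, update_regs _ _ _ hj] at this

theorem big_dec {j : ℕ} (hj : j < l.length) :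
    Big w B (dec (n + j)) (regs ρ n l) [] (regs ρ n (l.set j (l.getD j 0 - 1))) := by
  have := Big.dec (w := w) (ρ := regs ρ n l) (v := n + j) (B := B)
  rwa [regs_add, update_regs _ _ _ hj] at this

/-- Here `R j` holds the registers after `j` rounds. The induction goes backwards from the exit,
because the loop rule unfolds at the front. -/
theorem big_loop {v : ℕ} {p : Cmd} (N : ℕ) (R : ℕ → ℕ → ℕ) (o : ℕ → Word)
    (hv : ∀ j, R j v = N - j) (h : ∀ j < N, Big w B p (R j) (o j) (R (j + 1))) :
    Big w B (loop v p) (R 0) ((List.range N).flatMap o) (R N) := by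
  suffices H : ∀ m, m ≤ N → Big w B (loop v p) (R (N - m)) ((List.range' (N - m) m).flatMap o)
      (R N) by
    have := H N le_rfl
    rwa [Nat.sub_self, ← List.range_eq_range'] at this
  intro m
  induction m with
  | zero => exact fun _ => Big.loop_neg (by rw [hv]; omega)
  | succ m ih =>
    intro hm
    rw [List.range'_succ, List.flatMap_cons]
    have h1 := ih (by omega)
    rw [show N - m = N - (m + 1) + 1 by omega] at h1
    exact Big.loop_pos (by rw [hv]; omega) (h _ (by omega)) h1

theorem big_loop_nil {v : ℕ} {p : Cmd} (N : ℕ) (R : ℕ → ℕ → ℕ)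
    (hv : ∀ j, R j v = N - j) (h : ∀ j < N, Big w B p (R j) [] (R (j + 1))) :
    Big w B (loop v p) (R 0) [] (R N) := by
  have := big_loop (w := w) (B := B) N R (fun _ => []) hv h
  rwa [List.flatMap_eq_nil_iff.2 (fun _ _ => rfl)] at this

/-- Set a register to zero. -/
def clear (v : ℕ) : Cmd := loop v (dec v)

theorem big_clear {j : ℕ} (hj : j < l.length) :
    Big w B (clear (n + j)) (regs ρ n l) [] (regs ρ n (l.set j 0)) := by
  have := big_loop_nil (w := w) (B := B) (v := n + j) (p := dec (n + j)) (l.getD j 0)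
    (fun i => regs ρ n (l.set j (l.getD j 0 - i)))
    (fun i => by simp [regs_add, hj]) (fun i _ => by
      convert big_dec (l := l.set j (l.getD j 0 - i)) (by simpa using hj) using 2
      rw [List.set_set]
      congr 1
      simp [hj, Nat.sub_sub])
  simpa [clear, hj] using this

/-- Add one register to another one and set it to zero. -/
def move (a b : ℕ) : Cmd := loop a (seq (dec a) (inc b))

theorem big_move {i j : ℕ} (hij : i ≠ j) (hi : i < l.length) (hj : j < l.length)
    (hB : l.getD i 0 + l.getD j 0 ≤ B) :
    Big w B (move (n + i) (n + j)) (regs ρ n l) []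
      (regs ρ n ((l.set i 0).set j (l.getD i 0 + l.getD j 0))) := by
  have := big_loop_nil (w := w) (B := B) (v := n + i) (p := seq (dec (n + i)) (inc (n + j)))
    (l.getD i 0) (fun k => regs ρ n ((l.set i (l.getD i 0 - k)).set j (k + l.getD j 0)))
    (fun k => by simp [regs_add, hi, hij.symm]) (fun k hk => by
      refine Big.then (big_dec (by simpa using hi)) ?_
      convert big_inc (l := ((l.set i (l.getD i 0 - k)).set j (k + l.getD j 0)).set i _)
        (j := j) (by simpa using hj) ?_ using 2
      · rw [List.set_comm _ _ hij.symm, List.set_set, List.set_set]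
        simp [hi, hj, hij.symm, Nat.sub_sub, add_right_comm]
      · simp only [List.getD_eq_getElem?_getD, List.getElem?_set] at hB hk ⊢
        simp [hi, hj, hij] at hB hk ⊢
        omega)
  simpa [move, hi, hj] using this

end Cmd

open Cmd

/-- Put a number in front of an environment. -/
def Env.cons (a : ℕ) (v : ℕ → ℕ) : ℕ → ℕ
  | 0 => a
  | i + 1 => v i

/-- The function `f` of a word and an environment can be computed by register programs whose
registers are polynomially bounded.  Here `σ` tells in which registers the environment is stored;
the registers from `n` on are used for the computation and the result. -/
def LS (f : Word → (ℕ → ℕ) → ℕ) : Prop :=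
  ∀ (n : ℕ) (σ : ℕ → ℕ), (∀ i, σ i < n) → ∃ (c : Cmd) (e : ℕ), ∀ (w : Word) (B : ℕ)
    (ρ v : ℕ → ℕ), w.length + 2 ≤ B → (∀ i, ρ (σ i) = v i) → (∀ i, v i ≤ B) →
    f w v ≤ B ^ e ∧ c.Big w (B ^ e) (regs ρ n []) [] (regs ρ n [f w v])

/-- The output `g` is produced by register programs whose registers are polynomially bounded. -/
def LSO (g : Word → (ℕ → ℕ) → Word) : Prop :=
  ∀ (n : ℕ) (σ : ℕ → ℕ), (∀ i, σ i < n) → ∃ (c : Cmd) (e : ℕ), ∀ (w : Word) (B : ℕ)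
    (ρ v : ℕ → ℕ), w.length + 2 ≤ B → (∀ i, ρ (σ i) = v i) → (∀ i, v i ≤ B) →
    c.Big w (B ^ e) (regs ρ n []) (g w v) (regs ρ n [])

/-- Shifts the computation past `m` registers with intermediate results, which the environment may
then refer to as well. -/
theorem LS.run {f : Word → (ℕ → ℕ) → ℕ} (hf : LS f) (n m : ℕ) (σ : ℕ → ℕ)
    (hσ : ∀ i, σ i < n + m) : ∃ (c : Cmd) (e : ℕ), ∀ (w : Word) (B : ℕ) (ρ v : ℕ → ℕ)
    (l : List ℕ), l.length = m → w.length + 2 ≤ B → (∀ i, regs ρ n l (σ i) = v i) →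
    (∀ i, v i ≤ B) →
    f w v ≤ B ^ e ∧ c.Big w (B ^ e) (regs ρ n l) [] (regs ρ n (l ++ [f w v])) := by
  obtain ⟨c, e, h⟩ := hf (n + m) σ hσ
  refine ⟨c, e, fun w B ρ v l hl hB hv hvB => ?_⟩
  have := h w B (regs ρ n l) v hB hv hvB
  rwa [regs_regs _ _ _ _ hl, regs_regs _ _ _ _ hl, List.append_nil] at this

theorem LSO.run {f : Word → (ℕ → ℕ) → Word} (hf : LSO f) (n m : ℕ) (σ : ℕ → ℕ)
    (hσ : ∀ i, σ i < n + m) : ∃ (c : Cmd) (e : ℕ), ∀ (w : Word) (B : ℕ) (ρ v : ℕ → ℕ)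
    (l : List ℕ), l.length = m → w.length + 2 ≤ B → (∀ i, regs ρ n l (σ i) = v i) →
    (∀ i, v i ≤ B) →
    c.Big w (B ^ e) (regs ρ n l) (f w v) (regs ρ n l) := by
  obtain ⟨c, e, h⟩ := hf (n + m) σ hσ
  refine ⟨c, e, fun w B ρ v l hl hB hv hvB => ?_⟩
  have := h w B (regs ρ n l) v hB hv hvB
  rwa [regs_regs _ _ _ _ hl, List.append_nil] at this

theorem regs_env {ρ σ v : ℕ → ℕ} {n : ℕ} (hσ : ∀ i, σ i < n) (hv : ∀ i, ρ (σ i) = v i)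
    (l : List ℕ) (i : ℕ) : regs ρ n l (σ i) = v i := by
  rw [regs_of_lt _ _ _ (hσ i), hv]

theorem regs_env_cons {ρ σ v : ℕ → ℕ} {n : ℕ} (hσ : ∀ i, σ i < n) (hv : ∀ i, ρ (σ i) = v i)
    (l : List ℕ) (j : ℕ) (i : ℕ) :
    regs ρ n l (Env.cons (n + j) σ i) = Env.cons (l.getD j 0) v i := by
  cases i with
  | zero => exact regs_add _ _ _ _
  | succ i => exact regs_env hσ hv l i

theorem env_cons_lt {σ : ℕ → ℕ} {n m j : ℕ} (hσ : ∀ i, σ i < n) (hj : j < m) (i : ℕ) :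
    Env.cons (n + j) σ i < n + m := by
  cases i with
  | zero => exact Nat.add_lt_add_left hj n
  | succ i => exact (hσ i).trans_le (Nat.le_add_right n m)

theorem env_cons_le {v : ℕ → ℕ} {a B B' : ℕ} (hv : ∀ i, v i ≤ B) (hB : B ≤ B') (ha : a ≤ B')
    (i : ℕ) : Env.cons a v i ≤ B' := by
  cases i with
  | zero => exact ha
  | succ i => exact (hv i).trans hB

/-! ### Closure properties of the functions in `LS` -/

namespace LS

variable {f g c : Word → (ℕ → ℕ) → ℕ}

theorem zero : LS fun _ _ => 0 := fun n σ hσ =>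
  ⟨skip, 0, fun w B ρ v _ _ _ => ⟨Nat.zero_le _, by
    rw [regs_congr ρ n (l := [0]) (l' := []) (by intro j; rcases j with _ | j <;> rfl)]
    exact Big.skip⟩⟩

theorem succ (hf : LS f) : LS fun w v => f w v + 1 := by
  intro n σ hσ
  obtain ⟨p, e, hp⟩ := hf.run n 0 σ hσ
  refine ⟨seq p (inc (n + 0)), e + 1, fun w B ρ v hB hv hvB => ?_⟩
  obtain ⟨h1, h2⟩ := hp w B ρ v [] rfl hB (regs_env hσ hv _) hvB
  have h3 : f w v + 1 ≤ B ^ (e + 1) := by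
    rw [pow_succ]
    have : 1 ≤ B ^ e := Nat.one_le_pow _ _ (by omega)
    nlinarith
  refine ⟨h3, Big.then (h2.mono (Nat.pow_le_pow_right (by omega) (by omega))) ?_⟩
  exact big_inc (l := [f w v]) (j := 0) (by simp) h3

theorem const (a : ℕ) : LS fun _ _ => a := by
  induction a with
  | zero => exact zero
  | succ a ih => exact ih.succ

/-- Reading out a register empties it, so the content is poured into two registers and one copy is
poured back. -/
theorem var (i : ℕ) : LS fun _ v => v i := by
  intro n σ hσ
  refine ⟨seq (loop (σ i) (seq (dec (σ i)) (seq (inc (n + 0)) (inc (n + 1)))))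
    (loop (n + 1) (seq (dec (n + 1)) (inc (σ i)))), 1, fun w B ρ v hB hv hvB => ?_⟩
  rw [pow_one]
  refine ⟨hvB i, ?_⟩
  have hx := hvB i
  set x := v i with hxdef
  have hupd : ∀ (a : ℕ) (l : List ℕ) (b : ℕ), Function.update (regs (Function.update ρ (σ i) a) n l)
      (σ i) b = regs (Function.update ρ (σ i) b) n l := by
    intro a l b
    funext k
    by_cases hk : k = σ i
    · subst hk; simp [regs, hσ i]
    · simp [regs, hk]
  have h1 := big_loop_nil (w := w) (B := B) (v := σ i)
    (p := seq (dec (σ i)) (seq (inc (n + 0)) (inc (n + 1)))) x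
    (fun j => regs (Function.update ρ (σ i) (x - j)) n [j, j])
    (fun j => by simp [regs, hσ i]) (fun j hj => by
      refine Big.then Big.dec ?_
      rw [hupd, regs_of_lt _ _ _ (hσ i), Function.update_self, Nat.sub_sub]
      refine Big.then (big_inc (l := [j, j]) (j := 0) (by simp) (by simp; omega)) ?_
      exact big_inc (l := [j + 1, j]) (j := 1) (by simp) (by simp; omega))
  have h2 := big_loop_nil (w := w) (B := B) (v := n + 1)
    (p := seq (dec (n + 1)) (inc (σ i))) x
    (fun j => regs (Function.update ρ (σ i) j) n [x, x - j])
    (fun j => by simp [regs_add]) (fun j hj => by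
      refine Big.then (big_dec (l := [x, x - j]) (j := 1) (by simp)) ?_
      have h3 : ∀ l, regs (Function.update ρ (σ i) j) n l (σ i) = j := fun l => by
        simp [regs, hσ i]
      have := Big.inc (w := w) (B := B)
        (ρ := regs (Function.update ρ (σ i) j) n [x, x - (j + 1)]) (v := σ i) (by rw [h3]; omega)
      rwa [hupd, h3] at this)
  have hρ : ρ (σ i) = x := hv i
  rw [regs_congr ρ n (l := []) (l' := [0, 0]) (by intro j; rcases j with _ | _ | j <;> rfl),
    regs_congr ρ n (l := [x]) (l' := [x, 0]) (by intro j; rcases j with _ | _ | j <;> rfl)]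
  simp only [Nat.sub_zero, Nat.sub_self] at h1 h2
  have hself : Function.update ρ (σ i) x = ρ := by rw [← hρ, Function.update_eq_self]
  rw [hself] at h1 h2
  exact Big.then h1 h2

theorem sub (hf : LS f) (hg : LS g) : LS fun w v => f w v - g w v := by
  intro n σ hσ
  obtain ⟨p, e, hp⟩ := hf.run n 0 σ hσ
  obtain ⟨q, e', hq⟩ := hg.run n 1 σ fun i => (hσ i).trans_le (Nat.le_add_right _ _)
  refine ⟨seq p (seq q (loop (n + 1) (seq (dec (n + 1)) (dec (n + 0))))), e + e',
    fun w B ρ v hB hv hvB => ?_⟩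
  obtain ⟨h1, h2⟩ := hp w B ρ v [] rfl hB (regs_env hσ hv _) hvB
  obtain ⟨h3, h4⟩ := hq w B ρ v [f w v] rfl hB (regs_env hσ hv _) hvB
  have he : B ^ e ≤ B ^ (e + e') := Nat.pow_le_pow_right (by omega) (by omega)
  have he' : B ^ e' ≤ B ^ (e + e') := Nat.pow_le_pow_right (by omega) (by omega)
  refine ⟨(Nat.sub_le _ _).trans (h1.trans he), Big.then (h2.mono he) (Big.then (h4.mono he') ?_)⟩
  have h5 := big_loop_nil (w := w) (B := B ^ (e + e')) (v := n + 1)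
    (p := seq (dec (n + 1)) (dec (n + 0))) (g w v)
    (fun j => regs ρ n [f w v - j, g w v - j])
    (fun j => by simp [regs_add]) (fun j hj => by
      exact Big.then (big_dec (l := [f w v - j, g w v - j]) (j := 1) (by simp))
        (big_dec (l := [f w v - j, g w v - (j + 1)]) (j := 0) (by simp)))
  rw [regs_congr ρ n (l := [f w v - g w v]) (l' := [f w v - g w v, g w v - g w v])
    (by intro j; rcases j with _ | _ | j <;> simp)]
  exact h5

open Classical in
theorem ite_ne_zero (hc : LS c) (hf : LS f) (hg : LS g) :
    LS fun w v => if c w v ≠ 0 then f w v else g w v := by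
  intro n σ hσ
  obtain ⟨r, e, hr⟩ := hc.run n 0 σ hσ
  obtain ⟨p, e₁, hp⟩ := hf.run n 0 σ hσ
  obtain ⟨q, e₂, hq⟩ := hg.run n 0 σ hσ
  refine ⟨seq r (Cmd.ite (n + 0) (seq (clear (n + 0)) p) q), e + e₁ + e₂, fun w B ρ v hB hv hvB => ?_⟩
  obtain ⟨h1, h2⟩ := hr w B ρ v [] rfl hB (regs_env hσ hv _) hvB
  obtain ⟨h3, h4⟩ := hp w B ρ v [] rfl hB (regs_env hσ hv _) hvB
  obtain ⟨h5, h6⟩ := hq w B ρ v [] rfl hB (regs_env hσ hv _) hvB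
  have he : B ^ e ≤ B ^ (e + e₁ + e₂) := Nat.pow_le_pow_right (by omega) (by omega)
  have he₁ : B ^ e₁ ≤ B ^ (e + e₁ + e₂) := Nat.pow_le_pow_right (by omega) (by omega)
  have he₂ : B ^ e₂ ≤ B ^ (e + e₁ + e₂) := Nat.pow_le_pow_right (by omega) (by omega)
  have hnil : regs ρ n [0] = regs ρ n [] :=
    regs_congr ρ n (by intro j; rcases j with _ | j <;> rfl)
  by_cases hcw : c w v = 0
  · simp only [hcw, ne_eq, not_true_eq_false, if_false]
    refine ⟨h5.trans he₂, Big.then (h2.mono he) (Big.ite_neg ?_ ?_)⟩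
    · rw [regs_add]; exact hcw
    · rw [List.nil_append, hcw, hnil]
      exact h6.mono he₂
  · simp only [hcw, ne_eq, not_false_eq_true, if_true]
    refine ⟨h3.trans he₁, Big.then (h2.mono he) (Big.ite_pos ?_ ?_)⟩
    · rw [regs_add]; exact hcw
    · refine Big.then (big_clear (l := [c w v]) (j := 0) (by simp)) ?_
      rw [List.set_cons_zero, hnil]
      exact h4.mono he₁

theorem rename (hf : LS f) (τ : ℕ → ℕ) : LS fun w v => f w (fun i => v (τ i)) := by
  intro n σ hσ
  obtain ⟨p, e, hp⟩ := hf n (fun i => σ (τ i)) fun i => hσ _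
  exact ⟨p, e, fun w B ρ v hB hv hvB => hp w B ρ _ hB (fun i => hv (τ i)) fun i => hvB (τ i)⟩

/-- The intermediate value may be as large as `B ^ e`, so the second program runs with the bound `B
^ (e + 1)`, which also dominates the old environment. Exponents therefore multiply. -/
theorem bind {F : Word → ℕ → (ℕ → ℕ) → ℕ} (hg : LS g)
    (hF : LS fun w v => F w (v 0) (fun i => v (i + 1))) : LS fun w v => F w (g w v) v := by
  intro n σ hσ
  obtain ⟨p, e, hp⟩ := hg.run n 0 σ hσ
  obtain ⟨q, e', hq⟩ := hF.run n 1 (Env.cons (n + 0) σ) (env_cons_lt hσ (by norm_num))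
  refine ⟨seq p (seq q (seq (clear (n + 0)) (move (n + 1) (n + 0)))), e + (e + 1) * e',
    fun w B ρ v hB hv hvB => ?_⟩
  obtain ⟨h1, h2⟩ := hp w B ρ v [] rfl hB (regs_env hσ hv _) hvB
  have hBB : B ≤ B ^ (e + 1) := Nat.le_self_pow (by omega) B
  obtain ⟨h3, h4⟩ := hq w (B ^ (e + 1)) ρ _ [g w v] rfl (hB.trans hBB) (regs_env_cons hσ hv _ _)
    (env_cons_le hvB hBB (h1.trans (Nat.pow_le_pow_right (by omega) (by omega))))
  rw [← pow_mul] at h3 h4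
  change F w (g w v) v ≤ _ at h3
  change Big w _ q _ [] (regs ρ n [g w v, F w (g w v) v]) at h4
  have he : B ^ e ≤ B ^ (e + (e + 1) * e') := Nat.pow_le_pow_right (by omega) (by omega)
  have he' : B ^ ((e + 1) * e') ≤ B ^ (e + (e + 1) * e') :=
    Nat.pow_le_pow_right (by omega) (by omega)
  refine ⟨h3.trans he', Big.then (h2.mono he) (Big.then (h4.mono he') ?_)⟩
  refine Big.then (big_clear (l := [g w v, F w (g w v) v]) (j := 0) (by simp)) ?_
  rw [regs_congr ρ n (l := [F w (g w v) v]) (l' := [F w (g w v) v, 0])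
    (by intro j; rcases j with _ | _ | j <;> rfl)]
  exact big_move (l := [0, F w (g w v) v]) (i := 1) (j := 0) (by norm_num) (by simp) (by simp)
    (by simpa using h3.trans he')

/-- Polynomially many summands of polynomial size have a polynomial sum, so no growth hypothesis is
needed. Bounded quantifiers, counting, addition and multiplication are all derived from this. The
three registers hold the partial sum, the index and the number of rounds left. -/
theorem sum {b : Word → ℕ → (ℕ → ℕ) → ℕ} (hc : LS c)
    (hb : LS fun w v => b w (v 0) (fun i => v (i + 1))) :
    LS fun w v => ∑ i ∈ Finset.range (c w v), b w i v := by
  intro n σ hσ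
  obtain ⟨p, e, hp⟩ := hc.run n 2 σ fun i => (hσ i).trans_le (Nat.le_add_right _ _)
  obtain ⟨q, e', hq⟩ := hb.run n 3 (Env.cons (n + 1) σ) (env_cons_lt hσ (by norm_num))
  refine ⟨seq p (seq (loop (n + 2) (seq (dec (n + 2)) (seq q (seq (move (n + 3) (n + 0))
    (inc (n + 1)))))) (clear (n + 1))), e + (e + 1) * e', fun w B ρ v hB hv hvB => ?_⟩
  obtain ⟨h1, h2⟩ := hp w B ρ v [0, 0] rfl hB (regs_env hσ hv _) hvB
  set N := c w v with hN
  have hBB : B ≤ B ^ (e + 1) := Nat.le_self_pow (by omega) B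
  have he : B ^ e ≤ B ^ (e + (e + 1) * e') := Nat.pow_le_pow_right (by omega) (by omega)
  have he' : B ^ ((e + 1) * e') ≤ B ^ (e + (e + 1) * e') :=
    Nat.pow_le_pow_right (by omega) (by omega)
  have hbody : ∀ j ≤ N, ∀ a r, b w j v ≤ B ^ ((e + 1) * e') ∧
      Big w (B ^ ((e + 1) * e')) q (regs ρ n [a, j, r]) [] (regs ρ n [a, j, r, b w j v]) := by
    intro j hj a r
    have := hq w (B ^ (e + 1)) ρ _ [a, j, r] rfl (hB.trans hBB) (regs_env_cons hσ hv _ _)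
      (env_cons_le hvB hBB ((hj.trans h1).trans (Nat.pow_le_pow_right (by omega) (by omega))))
    rwa [← pow_mul] at this
  have hsum : ∀ j ≤ N, ∑ i ∈ Finset.range j, b w i v ≤ B ^ (e + (e + 1) * e') := by
    intro j hj
    refine (Finset.sum_le_card_nsmul _ _ _ fun i hi =>
      (hbody i ((Finset.mem_range.1 hi).le.trans hj) 0 0).1).trans ?_
    rw [Finset.card_range, smul_eq_mul, pow_add]
    exact Nat.mul_le_mul (hj.trans h1) le_rfl
  refine ⟨hsum N le_rfl, ?_⟩
  rw [regs_congr ρ n (l := []) (l' := [0, 0]) (by intro j; rcases j with _ | _ | j <;> rfl)]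
  refine Big.then (h2.mono he) ?_
  have h5 := big_loop_nil (w := w) (B := B ^ (e + (e + 1) * e')) (v := n + 2)
    (p := seq (dec (n + 2)) (seq q (seq (move (n + 3) (n + 0)) (inc (n + 1))))) N
    (fun j => regs ρ n [∑ i ∈ Finset.range j, b w i v, j, N - j])
    (fun j => by simp [regs_add]) (fun j hj => by
      set S := ∑ i ∈ Finset.range j, b w i v with hS
      have hS' : ∑ i ∈ Finset.range (j + 1), b w i v = b w j v + S := by
        rw [Finset.sum_range_succ, add_comm]
      have hle := hsum (j + 1) hj
      rw [hS'] at hle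
      simp only [hS']
      refine Big.then (big_dec (l := [S, j, N - j]) (j := 2) (by simp)) ?_
      refine Big.then ((hbody j hj.le S (N - j - 1)).2.mono he') ?_
      refine Big.then (big_move (l := [S, j, N - j - 1, b w j v]) (i := 3) (j := 0) (by norm_num)
        (by simp) (by simp) hle) ?_
      have h6 := big_inc (w := w) (B := B ^ (e + (e + 1) * e')) (ρ := ρ) (n := n)
        (l := [b w j v + S, j, N - (j + 1), 0]) (j := 1) (by simp)
        ((Nat.succ_le_of_lt hj).trans (h1.trans he))
      exact h6.regs_congr (by intro i; rcases i with _ | _ | _ | _ | i <;> rfl)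
        (by intro i; rcases i with _ | _ | _ | _ | i <;> rfl))
  refine Big.then h5 ?_
  have h7 := big_clear (w := w) (B := B ^ (e + (e + 1) * e')) (ρ := ρ) (n := n)
    (l := [∑ i ∈ Finset.range N, b w i v, N, N - N]) (j := 1) (by simp)
  exact h7.regs_congr (by intro i; rcases i with _ | _ | _ | _ | i <;> rfl)
    (by intro i; rcases i with _ | _ | _ | _ | i <;> first | rfl | simp)

/-- Unlike a sum, an iteration can raise the exponent in every round; hence a bound on all iterates,
uniform in their number, has to be supplied. -/
theorem iterate {a : Word → (ℕ → ℕ) → ℕ} {s : Word → ℕ → (ℕ → ℕ) → ℕ} (hc : LS c) (ha : LS a)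
    (hs : LS fun w v => s w (v 0) (fun i => v (i + 1))) (k : ℕ)
    (hk : ∀ (w : Word) (v : ℕ → ℕ) (B : ℕ), w.length + 2 ≤ B → (∀ i, v i ≤ B) →
      ∀ j, (fun x => s w x v)^[j] (a w v) ≤ B ^ k) :
    LS fun w v => (fun x => s w x v)^[c w v] (a w v) := by
  intro n σ hσ
  obtain ⟨p, e₁, hp⟩ := ha.run n 0 σ hσ
  obtain ⟨r, e₂, hr⟩ := hc.run n 1 σ fun i => (hσ i).trans_le (Nat.le_add_right _ _)
  obtain ⟨q, e₃, hq⟩ := hs.run n 2 (Env.cons (n + 0) σ) (env_cons_lt hσ (by norm_num))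
  refine ⟨seq p (seq r (loop (n + 1) (seq (dec (n + 1)) (seq q (seq (clear (n + 0))
    (move (n + 2) (n + 0))))))), e₁ + e₂ + (k + 1) * e₃ + k, fun w B ρ v hB hv hvB => ?_⟩
  set E := e₁ + e₂ + (k + 1) * e₃ + k with hE
  obtain ⟨-, h2⟩ := hp w B ρ v [] rfl hB (regs_env hσ hv _) hvB
  obtain ⟨-, h4⟩ := hr w B ρ v [a w v] rfl hB (regs_env hσ hv _) hvB
  have hpow : ∀ {i}, i ≤ E → B ^ i ≤ B ^ E := fun h => Nat.pow_le_pow_right (by omega) h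
  have hBB : B ≤ B ^ (k + 1) := Nat.le_self_pow (by omega) B
  set N := c w v with hN
  set it : ℕ → ℕ := fun j => (fun x => s w x v)^[j] (a w v) with hit
  have hle : ∀ j, it j ≤ B ^ k := hk w v B hB hvB
  have hsucc : ∀ j, s w (it j) v = it (j + 1) := fun j =>
    (Function.iterate_succ_apply' (fun x => s w x v) j (a w v)).symm
  refine ⟨(hle N).trans (hpow (by omega)), Big.then (h2.mono (hpow (by omega)))
    (Big.then (h4.mono (hpow (by omega))) ?_)⟩
  have h5 := big_loop_nil (w := w) (B := B ^ E) (v := n + 1)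
    (p := seq (dec (n + 1)) (seq q (seq (clear (n + 0)) (move (n + 2) (n + 0))))) N
    (fun j => regs ρ n [it j, N - j])
    (fun j => by simp [regs_add]) (fun j hj => by
      refine Big.then (big_dec (l := [it j, N - j]) (j := 1) (by simp)) ?_
      obtain ⟨-, h6⟩ := hq w (B ^ (k + 1)) ρ _ [it j, N - (j + 1)] rfl (hB.trans hBB)
        (regs_env_cons hσ hv _ _)
        (env_cons_le hvB hBB ((hle j).trans (Nat.pow_le_pow_right (by omega) (by omega))))
      rw [← pow_mul] at h6
      change Big w _ q _ [] (regs ρ n [it j, N - (j + 1), s w (it j) v]) at h6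
      rw [hsucc] at h6
      refine Big.then (h6.mono (hpow (by omega))) ?_
      refine Big.then (big_clear (l := [it j, N - (j + 1), it (j + 1)]) (j := 0) (by simp)) ?_
      have h7 := big_move (w := w) (B := B ^ E) (ρ := ρ) (n := n)
        (l := [0, N - (j + 1), it (j + 1)]) (i := 2) (j := 0) (by norm_num)
        (by simp) (by simp) (by simpa using (hle (j + 1)).trans (hpow (by omega)))
      exact h7.regs_congr (by intro i; rcases i with _ | _ | _ | _ | i <;> rfl)
        (by intro i; rcases i with _ | _ | _ | _ | i <;> rfl))
  rw [regs_congr ρ n (l := [it N]) (l' := [it N, N - N])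
    (by intro j; rcases j with _ | _ | j <;> simp)]
  exact h5

theorem big_pass {w : Word} {B : ℕ} (ρ : ℕ → ℕ) (n : ℕ) (x : ℕ) (hw : w.length ≤ B) (h3 : 3 ≤ B) :
    Big w B (pass (n + 1) (n + 0) (n + 2)) (regs ρ n [0, x]) []
      (regs ρ n [symCode w[x]?, x - w.length, w.length]) := by
  rw [regs_congr ρ n (l := [0, x]) (l' := [0, x, 0])
    (by intro j; rcases j with _ | _ | _ | j <;> rfl)]
  have := Big.pass (w := w) (B := B) (ρ := regs ρ n [0, x, 0]) (p := n + 1) (r := n + 0)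
    (n := n + 2) (by omega) (by omega) (by omega) (by rw [regs_add]; rfl) (by rw [regs_add]; rfl)
    hw h3
  rwa [passEnv, regs_add, update_regs _ _ _ (by simp), update_regs _ _ _ (by simp),
    update_regs _ _ _ (by simp)] at this

/-- Reading a symbol of the input word. -/
theorem read (hf : LS f) : LS fun w v => symCode w[f w v]? := by
  intro n σ hσ
  obtain ⟨p, e, hp⟩ := hf.run n 1 σ fun i => (hσ i).trans_le (Nat.le_add_right _ _)
  refine ⟨seq p (seq (pass (n + 1) (n + 0) (n + 2)) (seq (clear (n + 1)) (clear (n + 2)))), e + 2,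
    fun w B ρ v hB hv hvB => ?_⟩
  have h4 : 4 ≤ B ^ (e + 2) := calc
    4 = 2 ^ 2 := by norm_num
    _ ≤ B ^ 2 := Nat.pow_le_pow_left (by omega) 2
    _ ≤ B ^ (e + 2) := Nat.pow_le_pow_right (by omega) (by omega)
  have hw : w.length ≤ B ^ (e + 2) :=
    (show w.length ≤ B by omega).trans (Nat.le_self_pow (by omega) B)
  obtain ⟨-, h2⟩ := hp w B ρ v [0] rfl hB (regs_env hσ hv _) hvB
  refine ⟨(Simulation.symCode_le _).trans (by omega), ?_⟩
  rw [regs_congr ρ n (l := []) (l' := [0]) (by intro j; rcases j with _ | j <;> rfl)]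
  refine Big.then (h2.mono (Nat.pow_le_pow_right (by omega) (by omega))) ?_
  refine Big.then (big_pass ρ n (f w v) hw (by omega)) ?_
  set y := symCode w[f w v]? with hy
  refine Big.then (big_clear (l := [y, f w v - w.length, w.length]) (j := 1) (by simp)) ?_
  have h7 := big_clear (w := w) (B := B ^ (e + 2)) (ρ := ρ) (n := n)
    (l := [y, 0, w.length]) (j := 2) (by simp)
  exact h7.regs_congr (by intro i; rcases i with _ | _ | _ | _ | i <;> rfl)
    (by intro i; rcases i with _ | _ | _ | _ | i <;> rfl)

/-- The length of the input word. -/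
theorem length : LS fun w _ => w.length := by
  intro n σ hσ
  refine ⟨seq (pass (n + 1) (n + 0) (n + 2)) (seq (clear (n + 0)) (move (n + 2) (n + 0))), 2,
    fun w B ρ v hB hv hvB => ?_⟩
  have h4 : 4 ≤ B ^ 2 := calc
    4 = 2 ^ 2 := by norm_num
    _ ≤ B ^ 2 := Nat.pow_le_pow_left (by omega) 2
  have hw : w.length ≤ B ^ 2 :=
    (show w.length ≤ B by omega).trans (Nat.le_self_pow (by omega) B)
  refine ⟨hw, ?_⟩
  rw [regs_congr ρ n (l := []) (l' := [0, 0]) (by intro j; rcases j with _ | _ | j <;> rfl)]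
  refine Big.then (big_pass ρ n 0 hw (by omega)) ?_
  refine Big.then (big_clear (l := [symCode w[0]?, 0 - w.length, w.length]) (j := 0) (by simp)) ?_
  have h7 := big_move (w := w) (B := B ^ 2) (ρ := ρ) (n := n)
    (l := [0, 0 - w.length, w.length]) (i := 2) (j := 0) (by norm_num)
    (by simp) (by simp) (by simpa using hw)
  exact h7.regs_congr (by intro i; rcases i with _ | _ | _ | _ | i <;> rfl)
    (by intro i; rcases i with _ | _ | _ | _ | i <;> simp)

end LS

/-! ### Closure properties of the outputs in `LSO` -/

namespace LSO

variable {c : Word → (ℕ → ℕ) → ℕ} {f g : Word → (ℕ → ℕ) → Word}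

theorem nil : LSO fun _ _ => [] := fun _ _ _ => ⟨skip, 0, fun _ _ _ _ _ _ _ => Big.skip⟩

theorem emit (b : Option Bool) : LSO fun _ _ => [b] :=
  fun _ _ _ => ⟨out b, 0, fun _ _ _ _ _ _ _ => Big.out⟩

theorem append (hf : LSO f) (hg : LSO g) : LSO fun w v => f w v ++ g w v := by
  intro n σ hσ
  obtain ⟨p, e, hp⟩ := hf n σ hσ
  obtain ⟨q, e', hq⟩ := hg n σ hσ
  refine ⟨seq p q, e + e', fun w B ρ v hB hv hvB => ?_⟩
  exact Big.seq ((hp w B ρ v hB hv hvB).mono (Nat.pow_le_pow_right (by omega) (by omega)))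
    ((hq w B ρ v hB hv hvB).mono (Nat.pow_le_pow_right (by omega) (by omega)))

open Classical in
theorem ite_ne_zero (hc : LS c) (hf : LSO f) (hg : LSO g) :
    LSO fun w v => if c w v ≠ 0 then f w v else g w v := by
  intro n σ hσ
  obtain ⟨r, e, hr⟩ := hc.run n 0 σ hσ
  obtain ⟨p, e₁, hp⟩ := hf n σ hσ
  obtain ⟨q, e₂, hq⟩ := hg n σ hσ
  refine ⟨seq r (Cmd.ite (n + 0) (seq (clear (n + 0)) p) q), e + e₁ + e₂, fun w B ρ v hB hv hvB => ?_⟩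
  obtain ⟨h1, h2⟩ := hr w B ρ v [] rfl hB (regs_env hσ hv _) hvB
  have he : B ^ e ≤ B ^ (e + e₁ + e₂) := Nat.pow_le_pow_right (by omega) (by omega)
  have he₁ : B ^ e₁ ≤ B ^ (e + e₁ + e₂) := Nat.pow_le_pow_right (by omega) (by omega)
  have he₂ : B ^ e₂ ≤ B ^ (e + e₁ + e₂) := Nat.pow_le_pow_right (by omega) (by omega)
  have hnil : regs ρ n [0] = regs ρ n [] :=
    regs_congr ρ n (by intro j; rcases j with _ | j <;> rfl)
  by_cases hcw : c w v = 0
  · simp only [hcw, ne_eq, not_true_eq_false, if_false]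
    refine Big.then (h2.mono he) (Big.ite_neg ?_ ?_)
    · rw [regs_add]; exact hcw
    · rw [List.nil_append, hcw, hnil]
      exact (hq w B ρ v hB hv hvB).mono he₂
  · simp only [hcw, ne_eq, not_false_eq_true, if_true]
    refine Big.then (h2.mono he) (Big.ite_pos ?_ ?_)
    · rw [regs_add]; exact hcw
    · refine Big.then (big_clear (l := [c w v]) (j := 0) (by simp)) ?_
      rw [List.set_cons_zero, hnil]
      exact (hp w B ρ v hB hv hvB).mono he₁

theorem flatMap {b : Word → ℕ → (ℕ → ℕ) → Word} (hc : LS c)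
    (hb : LSO fun w v => b w (v 0) (fun i => v (i + 1))) :
    LSO fun w v => (List.range (c w v)).flatMap fun i => b w i v := by
  intro n σ hσ
  obtain ⟨p, e, hp⟩ := hc.run n 1 σ fun i => (hσ i).trans_le (Nat.le_add_right _ _)
  obtain ⟨q, e', hq⟩ := hb.run n 2 (Env.cons (n + 0) σ) (env_cons_lt hσ (by norm_num))
  refine ⟨seq p (seq (loop (n + 1) (seq (dec (n + 1)) (seq q (inc (n + 0))))) (clear (n + 0))),
    e + (e + 1) * e', fun w B ρ v hB hv hvB => ?_⟩
  obtain ⟨h1, h2⟩ := hp w B ρ v [0] rfl hB (regs_env hσ hv _) hvB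
  set N := c w v with hN
  have hBB : B ≤ B ^ (e + 1) := Nat.le_self_pow (by omega) B
  have he : B ^ e ≤ B ^ (e + (e + 1) * e') := Nat.pow_le_pow_right (by omega) (by omega)
  have he' : B ^ ((e + 1) * e') ≤ B ^ (e + (e + 1) * e') :=
    Nat.pow_le_pow_right (by omega) (by omega)
  rw [regs_congr ρ n (l := []) (l' := [0]) (by intro j; rcases j with _ | j <;> rfl)]
  refine Big.then (h2.mono he) ?_
  have h5 := big_loop (w := w) (B := B ^ (e + (e + 1) * e')) (v := n + 1)
    (p := seq (dec (n + 1)) (seq q (inc (n + 0)))) N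
    (fun j => regs ρ n [j, N - j]) (fun i => b w i v)
    (fun j => by simp [regs_add]) (fun j hj => by
      refine Big.then (big_dec (l := [j, N - j]) (j := 1) (by simp)) ?_
      have h6 := hq w (B ^ (e + 1)) ρ _ [j, N - (j + 1)] rfl (hB.trans hBB)
        (regs_env_cons hσ hv _ _)
        (env_cons_le hvB hBB ((hj.le.trans h1).trans (Nat.pow_le_pow_right (by omega) (by omega))))
      rw [← pow_mul] at h6
      refine Big.andThen (h6.mono he') ?_
      exact big_inc (l := [j, N - (j + 1)]) (j := 0) (by simp)
        ((Nat.succ_le_of_lt hj).trans (h1.trans he)))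
  refine Big.andThen h5 ?_
  have h7 := big_clear (w := w) (B := B ^ (e + (e + 1) * e')) (ρ := ρ) (n := n)
    (l := [N, N - N]) (j := 0) (by simp)
  exact h7.regs_congr (by intro i; rcases i with _ | _ | _ | _ | i <;> rfl)
    (by intro i; rcases i with _ | _ | _ | _ | i <;> simp)

/-- A map that is given by outputs of register programs with polynomially bounded registers can be
composed with a reduction in parameterized logspace. -/
theorem plComputable_comp {α : Type} {R₁ : List α × ℕ → List Bool × ℕ} (h₁ : PLComputable R₁)
    {R : List Bool × ℕ → List Bool × ℕ} {g : Word → Word} (hg : LSO fun w _ => g w)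
    (hR : ∀ y, tapeWord (R y) = g (tapeWord y)) : PLComputable (R ∘ R₁) := by
  obtain ⟨c, e, h⟩ := hg 1 (fun _ => 0) fun _ => Nat.one_pos
  refine ParamCplx.plComputable_comp h₁ c e fun y => ⟨fun _ => 0, ?_⟩
  have := h (tapeWord y) _ (fun _ => 0) (fun _ => 0) le_rfl (fun _ => rfl) fun _ => Nat.zero_le _
  simp only [← hR] at this
  have h0 : regs (fun _ => 0) 1 [] = fun _ => 0 := by
    funext i
    simp [regs]
  simpa only [h0] using this

end LSO


/-! ### Arithmetic and logic with polynomially bounded registers -/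

open Classical in
/-- The relation `p` between words and environments can be decided by register programs whose
registers are polynomially bounded. -/
def LP (p : Word → (ℕ → ℕ) → Prop) : Prop := LS fun w v => if p w v then 1 else 0

theorem LP.indicator {p : Word → (ℕ → ℕ) → Prop} [∀ w v, Decidable (p w v)] (hp : LP p) :
    LS fun w v => if p w v then 1 else 0 := by
  unfold LP at hp
  convert hp

theorem LP.of_indicator {p : Word → (ℕ → ℕ) → Prop} [∀ w v, Decidable (p w v)]
    (hp : LS fun w v => if p w v then 1 else 0) : LP p := by
  unfold LP
  convert hp

open Classical in
theorem LS.ite {p : Word → (ℕ → ℕ) → Prop} {f g : Word → (ℕ → ℕ) → ℕ} (hp : LP p) (hf : LS f)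
    (hg : LS g) : LS fun w v => if p w v then f w v else g w v := by
  have := LS.ite_ne_zero hp hf hg
  convert this using 4 with w v
  by_cases h : p w v <;> simp [h]

open Classical in
theorem LSO.ite {p : Word → (ℕ → ℕ) → Prop} {f g : Word → (ℕ → ℕ) → Word} (hp : LP p)
    (hf : LSO f) (hg : LSO g) : LSO fun w v => if p w v then f w v else g w v := by
  have := LSO.ite_ne_zero hp hf hg
  convert this using 4 with w v
  by_cases h : p w v <;> simp [h]

theorem LP.of_ne_zero {c : Word → (ℕ → ℕ) → ℕ} (hc : LS c) : LP fun w v => c w v ≠ 0 :=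
  LP.of_indicator (by
    have := LS.ite_ne_zero hc (LS.const 1) (LS.const 0)
    convert this)

theorem LP.congr {p q : Word → (ℕ → ℕ) → Prop} (hp : LP p) (h : ∀ w v, p w v ↔ q w v) : LP q := by
  have : p = q := by funext w v; exact propext (h w v)
  rwa [← this]

theorem LP.not {p : Word → (ℕ → ℕ) → Prop} (hp : LP p) : LP fun w v => ¬ p w v :=
  (LP.of_ne_zero (LS.ite hp (LS.const 0) (LS.const 1))).congr fun w v => by
    by_cases h : p w v <;> simp [h]

theorem LP.and {p q : Word → (ℕ → ℕ) → Prop} (hp : LP p) (hq : LP q) :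
    LP fun w v => p w v ∧ q w v :=
  (LP.of_ne_zero (LS.ite hp hq (LS.const 0))).congr fun w v => by
    by_cases h : p w v <;> simp [h]

theorem LP.or {p q : Word → (ℕ → ℕ) → Prop} (hp : LP p) (hq : LP q) :
    LP fun w v => p w v ∨ q w v :=
  (LP.of_ne_zero (LS.ite hp (LS.const 1) hq)).congr fun w v => by
    by_cases h : p w v <;> simp [h]

theorem LP.imp {p q : Word → (ℕ → ℕ) → Prop} (hp : LP p) (hq : LP q) :
    LP fun w v => p w v → q w v :=
  (hp.not.or hq).congr fun _ _ => imp_iff_not_or.symm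

theorem LP.lt {f g : Word → (ℕ → ℕ) → ℕ} (hf : LS f) (hg : LS g) : LP fun w v => f w v < g w v :=
  (LP.of_ne_zero (hg.sub hf)).congr fun w v => by omega

theorem LP.le {f g : Word → (ℕ → ℕ) → ℕ} (hf : LS f) (hg : LS g) : LP fun w v => f w v ≤ g w v :=
  (LP.lt hg hf).not.congr fun _ _ => not_lt

theorem LP.eq {f g : Word → (ℕ → ℕ) → ℕ} (hf : LS f) (hg : LS g) : LP fun w v => f w v = g w v :=
  ((LP.le hf hg).and (LP.le hg hf)).congr fun _ _ => le_antisymm_iff.symm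

/-- The number of witnesses is a bounded sum. -/
theorem LP.exists_lt {c : Word → (ℕ → ℕ) → ℕ} {P : Word → ℕ → (ℕ → ℕ) → Prop} (hc : LS c)
    (hP : LP fun w v => P w (v 0) (fun i => v (i + 1))) :
    LP fun w v => ∃ i < c w v, P w i v := by
  classical
  refine (LP.of_ne_zero (LS.sum (b := fun w i v => if P w i v then 1 else 0) hc hP)).congr
    fun w v => ?_
  simp

theorem LP.forall_lt {c : Word → (ℕ → ℕ) → ℕ} {P : Word → ℕ → (ℕ → ℕ) → Prop} (hc : LS c)
    (hP : LP fun w v => P w (v 0) (fun i => v (i + 1))) :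
    LP fun w v => ∀ i < c w v, P w i v :=
  (LP.exists_lt (P := fun w i v => ¬ P w i v) hc hP.not).not.congr fun w v => by
    simp

theorem LS.add {f g : Word → (ℕ → ℕ) → ℕ} (hf : LS f) (hg : LS g) :
    LS fun w v => f w v + g w v := by
  classical
  have := LS.sum (c := fun _ _ => 2) (b := fun w i v => if i ≠ 0 then g w v else f w v)
    (LS.const 2) (LS.ite_ne_zero (LS.var 0) (hg.rename _) (hf.rename _))
  convert this using 3 with w v
  simp [Finset.sum_range_succ]

theorem LS.mul {f g : Word → (ℕ → ℕ) → ℕ} (hf : LS f) (hg : LS g) :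
    LS fun w v => f w v * g w v := by
  have := LS.sum (b := fun w _ v => g w v) hf (hg.rename _)
  simpa using this

/-- The second binding puts the value of `g` in front of that of `f`; the renaming restores the
order of the two arguments. -/
theorem LS.comp₂ {F : Word → ℕ → ℕ → ℕ} (hF : LS fun w v => F w (v 0) (v 1))
    {f g : Word → (ℕ → ℕ) → ℕ} (hf : LS f) (hg : LS g) : LS fun w v => F w (f w v) (g w v) :=
  LS.bind (F := fun w a v => F w a (g w v)) hf
    (LS.bind (F := fun w b v => F w (v 0) b) (hg.rename _)
      (hF.rename fun i => if i = 0 then 1 else 0))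

theorem LP.comp₂ {P : Word → ℕ → ℕ → Prop} (hP : LP fun w v => P w (v 0) (v 1))
    {f g : Word → (ℕ → ℕ) → ℕ} (hf : LS f) (hg : LS g) : LP fun w v => P w (f w v) (g w v) := by
  classical
  exact LS.comp₂ (F := fun w a b => if P w a b then 1 else 0) hP hf hg

/-- A number is the count of the indices below it. With bounded sums, this computes any bounded
quantity that can be compared with indices, such as a quotient or the length of a run of ones. -/
theorem sum_ite_lt {x n : ℕ} (h : n ≤ x) (p : ℕ → Prop) [DecidablePred p] (hp : ∀ i < x, p i ↔ i < n) :
    ∑ i ∈ Finset.range x, (if p i then 1 else 0) = n := by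
  rw [Finset.sum_boole]
  have : Finset.filter p (Finset.range x) = Finset.range n := by
    ext i
    simp only [Finset.mem_filter, Finset.mem_range]
    refine ⟨fun hi => (hp i hi.1).1 hi.2, fun hi => ?_⟩
    have hx : i < x := by omega
    exact ⟨hx, (hp i hx).2 hi⟩
  simp [this]

/-- The quotient counts the `i` with `(i + 1) * g ≤ f`. A zero divisor would make every `i` count
and is treated apart. -/
theorem LS.div {f g : Word → (ℕ → ℕ) → ℕ} (hf : LS f) (hg : LS g) :
    LS fun w v => f w v / g w v := by
  classical
  have h := LS.ite (LP.lt (LS.const 0) hg) (LS.sum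
    (b := fun w i v => if (i + 1) * g w v ≤ f w v then 1 else 0) hf
    (LP.indicator (LP.le (((LS.var 0).succ).mul (hg.rename _)) (hf.rename _)))) (LS.const 0)
  convert h using 3 with w v
  split_ifs with h0
  · refine (sum_ite_lt (Nat.div_le_self _ _) _ fun i _ => ?_).symm
    rw [← Nat.le_div_iff_mul_le h0, Nat.succ_le_iff]
  · rw [show g w v = 0 by omega, Nat.div_zero]

theorem LS.mod {f g : Word → (ℕ → ℕ) → ℕ} (hf : LS f) (hg : LS g) :
    LS fun w v => f w v % g w v := by
  have h := hf.sub (hg.mul (hf.div hg))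
  convert h using 3 with w v
  exact Nat.mod_eq_sub_mul_div

/-! ### Truth tables -/

open Classical in
/-- The truth table of a relation between the numbers below `n` and the numbers below `m`. -/
noncomputable def natTable (n m : ℕ) (r : ℕ → ℕ → Prop) : List Bool :=
  (List.range n).flatMap fun i => (List.range m).map fun j => decide (r i j)

/-- The word for a graph, a forest and lists that are given by their truth tables. -/
noncomputable def graphWord (n m : ℕ) (adj par dom : ℕ → ℕ → Prop) : List Bool :=
  unary n ++ unary m ++ natTable n n adj ++ natTable n n par ++ natTable n m dom

/-- The word for constraints that are given by their truth tables. -/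
noncomputable def constraintWord (n m : ℕ) (con : ℕ → ℕ → ℕ → ℕ → Prop) : List Bool :=
  (List.range n).flatMap fun u => (List.range n).flatMap fun v => natTable m m (con u v)

open Classical in
theorem LSO.bit {p : Word → (ℕ → ℕ) → Prop} (hp : LP p) :
    LSO fun w v => [some (decide (p w v))] := by
  have := LSO.ite hp (LSO.emit (some true)) (LSO.emit (some false))
  convert this using 3 with w v
  by_cases h : p w v <;> simp [h]

theorem LSO.replicate {c : Word → (ℕ → ℕ) → ℕ} (hc : LS c) (b : Option Bool) :
    LSO fun w v => List.replicate (c w v) b := by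
  have := LSO.flatMap (b := fun _ _ _ => [b]) hc (LSO.emit b)
  convert this using 3 with w v
  induction c w v with
  | zero => rfl
  | succ n ih => rw [List.range_succ, List.flatMap_append, ← ih, List.replicate_succ']; rfl

theorem LSO.unary {c : Word → (ℕ → ℕ) → ℕ} (hc : LS c) :
    LSO fun w v => (unary (c w v)).map some := by
  have := (LSO.replicate hc (some true)).append (LSO.emit (some false))
  convert this using 3 with w v
  simp [ParamCplx.unary]

/-- The column loop is the inner one, so the column is entry 0 of the environment, the row is entry
1, and the outer environment is shifted by two. -/
theorem LSO.natTable {n m : Word → (ℕ → ℕ) → ℕ} {r : Word → (ℕ → ℕ) → ℕ → ℕ → Prop} (hn : LS n)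
    (hm : LS m) (hr : LP fun w v => r w (fun i => v (i + 2)) (v 1) (v 0)) :
    LSO fun w v => (natTable (n w v) (m w v) (r w v)).map some := by
  classical
  have := LSO.flatMap (b := fun w i v => (List.range (m w v)).flatMap fun j =>
    [some (decide (r w v i j))]) hn (LSO.flatMap (b := fun w j v =>
      [some (decide (r w (fun i => v (i + 1)) (v 0) j))]) (hm.rename _) (LSO.bit hr))
  convert this using 3 with w v
  simp only [ParamCplx.natTable, List.map_flatMap, List.map_map]
  congr 1
  funext i
  induction List.range (m w v) with
  | nil => rfl
  | cons a l ih => simp_all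

theorem LSO.graphWord {n m : Word → (ℕ → ℕ) → ℕ} {adj par dom : Word → (ℕ → ℕ) → ℕ → ℕ → Prop}
    (hn : LS n) (hm : LS m) (hadj : LP fun w v => adj w (fun i => v (i + 2)) (v 1) (v 0))
    (hpar : LP fun w v => par w (fun i => v (i + 2)) (v 1) (v 0))
    (hdom : LP fun w v => dom w (fun i => v (i + 2)) (v 1) (v 0)) :
    LSO fun w v => (graphWord (n w v) (m w v) (adj w v) (par w v) (dom w v)).map some := by
  have := ((((LSO.unary hn).append (LSO.unary hm)).append (LSO.natTable hn hn hadj)).append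
    (LSO.natTable hn hn hpar)).append (LSO.natTable hn hm hdom)
  convert this using 3 with w v
  simp [ParamCplx.graphWord]

theorem LSO.constraintWord {n m : Word → (ℕ → ℕ) → ℕ}
    {con : Word → (ℕ → ℕ) → ℕ → ℕ → ℕ → ℕ → Prop} (hn : LS n) (hm : LS m)
    (hcon : LP fun w v => con w (fun i => v (i + 4)) (v 3) (v 2) (v 1) (v 0)) :
    LSO fun w v => (constraintWord (n w v) (m w v) (con w v)).map some := by
  have := LSO.flatMap (b := fun w x v => (List.range (n w v)).flatMap fun y =>
    (ParamCplx.natTable (m w v) (m w v) (con w v x y)).map some) hn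
    (LSO.flatMap (b := fun w y v => (ParamCplx.natTable (m w fun i => v (i + 1))
      (m w fun i => v (i + 1)) (con w (fun i => v (i + 1)) (v 0) y)).map some) (hn.rename _)
    (LSO.natTable (r := fun w v => con w (fun i => v (i + 2)) (v 1) (v 0))
      (hm.rename fun i => i + 2) (hm.rename fun i => i + 2) hcon))
  convert this using 3 with w v
  simp [ParamCplx.constraintWord, List.map_flatMap]


/-! ### Properties of truth tables -/

theorem flatMap_take_drop {γ : Type} {n L : ℕ} (y : List γ) (f : ℕ → List γ)
    (hy : y.length = n * L) (hf : ∀ i < n, (y.drop (i * L)).take L = f i) :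
    y = (List.range n).flatMap f := by
  induction n generalizing y f with
  | zero => simpa using hy
  | succ n ih =>
    rw [List.range_succ_eq_map, List.flatMap_cons, List.flatMap_map, ← hf 0 (by omega)]
    rw [← ih (y.drop L) (fun i => f (i + 1)) ?_ ?_]
    · simp
    · rw [List.length_drop, hy, Nat.succ_mul, Nat.add_sub_cancel]
    · intro i hi
      rw [← hf (i + 1) (by omega), List.drop_drop, Nat.succ_mul, add_comm]

/-- Blocks of one common length can be cut apart in only one way. -/
theorem flatMap_range_inj {γ : Type} {n L : ℕ} {f g : ℕ → List γ}
    (hf : ∀ i < n, (f i).length = L) (hg : ∀ i < n, (g i).length = L)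
    (h : (List.range n).flatMap f = (List.range n).flatMap g) : ∀ i < n, f i = g i := by
  induction n with
  | zero => intro i hi; omega
  | succ n ih =>
    rw [List.range_succ, List.flatMap_append, List.flatMap_append] at h
    have h' := List.append_inj' h (by simp [hf n (by omega), hg n (by omega)])
    intro i hi
    rcases Nat.lt_succ_iff_lt_or_eq.1 hi with hi | rfl
    · exact ih (fun i hi => hf i (by omega)) (fun i hi => hg i (by omega)) h'.1 i hi
    · simpa using h'.2

theorem length_flatMap_range {γ : Type} {n L : ℕ} {f : ℕ → List γ}
    (hf : ∀ i < n, (f i).length = L) : ((List.range n).flatMap f).length = n * L := by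
  induction n with
  | zero => simp
  | succ n ih =>
    rw [List.range_succ, List.flatMap_append, List.length_append,
      ih fun i hi => hf i (by omega)]
    simp [hf n (by omega), Nat.succ_mul]

theorem length_natTable (n m : ℕ) (r : ℕ → ℕ → Prop) : (natTable n m r).length = n * m :=
  length_flatMap_range fun i _ => by simp

theorem length_constraintWord (n m : ℕ) (con : ℕ → ℕ → ℕ → ℕ → Prop) :
    (constraintWord n m con).length = n * (n * (m * m)) :=
  length_flatMap_range fun _ _ => length_flatMap_range fun _ _ => length_natTable _ _ _

theorem length_unary (n : ℕ) : (unary n).length = n + 1 := by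
  simp [unary]

theorem length_graphWord (n m : ℕ) (adj par dom : ℕ → ℕ → Prop) :
    (graphWord n m adj par dom).length = n + m + 2 + n * n + n * n + n * m := by
  simp only [graphWord, List.length_append, length_unary, length_natTable]
  omega

theorem natTable_inj {n m : ℕ} {r r' : ℕ → ℕ → Prop} (h : natTable n m r = natTable n m r') :
    ∀ i < n, ∀ j < m, (r i j ↔ r' i j) := by
  intro i hi j hj
  have h1 := flatMap_range_inj (L := m) (fun i _ => by simp) (fun i _ => by simp) h i hi
  have h2 := List.map_inj_left.1 h1 j (List.mem_range.2 hj)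
  simpa using h2

theorem natTable_congr {n m : ℕ} {r r' : ℕ → ℕ → Prop} (h : ∀ i < n, ∀ j < m, (r i j ↔ r' i j)) :
    natTable n m r = natTable n m r' := by
  refine List.flatMap_congr fun i hi => List.map_congr_left fun j hj => ?_
  simp [h i (List.mem_range.1 hi) j (List.mem_range.1 hj)]

theorem constraintWord_inj {n m : ℕ} {con con' : ℕ → ℕ → ℕ → ℕ → Prop}
    (h : constraintWord n m con = constraintWord n m con') :
    ∀ u < n, ∀ v < n, ∀ a < m, ∀ b < m, (con u v a b ↔ con' u v a b) := by
  intro u hu v hv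
  have h1 := flatMap_range_inj (L := n * (m * m))
    (fun u _ => length_flatMap_range fun _ _ => length_natTable _ _ _)
    (fun u _ => length_flatMap_range fun _ _ => length_natTable _ _ _) h u hu
  have h2 := flatMap_range_inj (L := m * m) (fun _ _ => length_natTable _ _ _)
    (fun _ _ => length_natTable _ _ _) h1 v hv
  exact natTable_inj h2

theorem unary_append_inj {n n' : ℕ} {s s' : List Bool} (h : unary n ++ s = unary n' ++ s') :
    n = n' ∧ s = s' := by
  induction n generalizing n' with
  | zero =>
    rcases n' with _ | n'
    · simpa [unary] using h
    · simp [unary, List.replicate_succ] at h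
  | succ n ih =>
    rcases n' with _ | n'
    · simp [unary, List.replicate_succ] at h
    · have := ih (n' := n') (by simpa [unary, List.replicate_succ] using h)
      exact ⟨congrArg Nat.succ this.1, this.2⟩

/-- Unary numerals are prefix-free, and once `n` and `m` are known, so is the length of every table;
hence the word parses uniquely, whatever follows it. -/
theorem graphWord_append_inj {n m n' m' : ℕ} {adj par dom adj' par' dom' : ℕ → ℕ → Prop}
    {s s' : List Bool}
    (h : graphWord n m adj par dom ++ s = graphWord n' m' adj' par' dom' ++ s') :
    n = n' ∧ m = m' ∧ (∀ u < n, ∀ v < n, (adj u v ↔ adj' u v)) ∧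
      (∀ u < n, ∀ v < n, (par u v ↔ par' u v)) ∧ (∀ u < n, ∀ a < m, (dom u a ↔ dom' u a)) ∧
      s = s' := by
  simp only [graphWord, List.append_assoc] at h
  obtain ⟨rfl, h⟩ := unary_append_inj h
  obtain ⟨rfl, h⟩ := unary_append_inj h
  obtain ⟨h1, h⟩ := List.append_inj h (by simp [length_natTable])
  obtain ⟨h2, h⟩ := List.append_inj h (by simp [length_natTable])
  obtain ⟨h3, h⟩ := List.append_inj h (by simp [length_natTable])
  exact ⟨rfl, rfl, natTable_inj h1, natTable_inj h2, natTable_inj h3, h⟩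

/-- Every bit string of the right length is a truth table, namely of the relation read off from it.
So parsing requires only a check of lengths. -/
theorem natTable_of_bits (x : List Bool) (o n m : ℕ) (h : o + n * m ≤ x.length) :
    (x.drop o).take (n * m) = natTable n m fun i j => x[o + (i * m + j)]? = some true := by
  classical
  refine flatMap_take_drop (L := m) _ _ (by simp; omega) fun i hi => ?_
  have him : i * m + m ≤ n * m := (Nat.succ_mul i _).symm.le.trans (Nat.mul_le_mul_right _ hi)
  apply List.ext_getElem
  · simp; omega
  · intro j h1 h2
    simp only [List.length_map, List.length_range] at h2
    have : o + (i * m + j) < x.length := by omega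
    simp [List.getElem?_eq_getElem this]

theorem constraintWord_of_bits (x : List Bool) (o n m : ℕ)
    (h : x.length = o + n * (n * (m * m))) :
    x.drop o = constraintWord n m fun u v a b =>
      x[o + (u * (n * (m * m)) + (v * (m * m) + (a * m + b)))]? = some true := by
  refine flatMap_take_drop (L := n * (m * m)) _ _ (by simp [h]) fun u hu => ?_
  have hu' : u * (n * (m * m)) + n * (m * m) ≤ n * (n * (m * m)) :=
    (Nat.succ_mul u _).symm.le.trans (Nat.mul_le_mul_right _ hu)
  refine flatMap_take_drop (L := m * m) _ _ (by simp [h]; omega) fun v hv => ?_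
  have hv' : v * (m * m) + m * m ≤ n * (m * m) :=
    (Nat.succ_mul v _).symm.le.trans (Nat.mul_le_mul_right _ hv)
  have := natTable_of_bits x (o + (u * (n * (m * m)) + v * (m * m))) m m (by omega)
  rw [List.drop_take, List.take_take, List.drop_drop, List.drop_drop, min_eq_left (by omega)]
  simp only [add_assoc] at this ⊢
  exact this

theorem unary_of_bits (x : List Bool) (o n : ℕ) (h : o + n + 1 ≤ x.length)
    (h1 : ∀ j < n, x[o + j]? = some true) (h2 : x[o + n]? ≠ some true) :
    (x.drop o).take (n + 1) = unary n := by
  apply List.ext_getElem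
  · simp [unary]; omega
  · intro j hj hj'
    simp only [unary, List.length_append, List.length_replicate, List.length_singleton] at hj'
    simp only [List.getElem_take, List.getElem_drop, unary]
    by_cases hjn : j < n
    · rw [List.getElem_append_left (by simpa using hjn), List.getElem_replicate]
      exact (List.getElem?_eq_some_iff.1 (h1 j hjn)).2
    · obtain rfl : j = n := by omega
      rw [List.getElem?_eq_getElem (by omega)] at h2
      simpa using h2

theorem graphWord_of_bits (x : List Bool) (n m : ℕ)
    (hx : n + m + 2 + n * n + n * n + n * m ≤ x.length)
    (h1 : ∀ j < n, x[j]? = some true) (h2 : x[n]? ≠ some true)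
    (h3 : ∀ j < m, x[n + 1 + j]? = some true) (h4 : x[n + 1 + m]? ≠ some true) :
    x = graphWord n m (fun u v => x[n + m + 2 + (u * n + v)]? = some true)
      (fun u v => x[n + m + 2 + n * n + (u * n + v)]? = some true)
      (fun u a => x[n + m + 2 + n * n + n * n + (u * m + a)]? = some true) ++
      x.drop (n + m + 2 + n * n + n * n + n * m) := by
  rw [graphWord, ← natTable_of_bits x _ n n (by omega), ← natTable_of_bits x _ n n (by omega),
    ← natTable_of_bits x _ n m (by omega),
    ← unary_of_bits x 0 n (by omega) (by simpa using h1) (by simpa using h2),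
    ← unary_of_bits x (n + 1) m (by omega) h3 h4]
  simp only [List.append_assoc]
  rw [← List.drop_drop (j := n + m + 2 + n * n + n * n), List.take_append_drop,
    ← List.drop_drop (j := n + m + 2 + n * n), List.take_append_drop,
    ← List.drop_drop (j := n + m + 2), List.take_append_drop,
    show n + m + 2 = (n + 1) + (m + 1) by ring, ← List.drop_drop (j := n + 1),
    List.take_append_drop, List.drop_zero, List.take_append_drop]

/-! ### Decoding words -/

/-- The word has the bit `1` at position `i`. -/
def bitAt (w : Word) (i : ℕ) : Prop := w[i]? = some (some true)

open Classical in
/-- The number of bits of a word. -/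
noncomputable def bitCount (w : Word) : ℕ :=
  ∑ i ∈ Finset.range w.length, if 2 ≤ symCode w[i]? then 1 else 0

/-- The number of tally marks of a word. -/
noncomputable def tallyCount (w : Word) : ℕ := w.length - bitCount w

open Classical in
/-- The number of consecutive ones from position `s` on. -/
noncomputable def ones (w : Word) (s : ℕ) : ℕ :=
  ∑ i ∈ Finset.range w.length, if ∀ j < i + 1, bitAt w (s + j) then 1 else 0

/-- The number of vertices in the instance that is encoded by a word. -/
noncomputable def vertexCount (w : Word) : ℕ := ones w 0

/-- The number of values in the instance that is encoded by a word. -/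
noncomputable def valueCount (w : Word) : ℕ := ones w (vertexCount w + 1)

/-- The position after the unary numbers at the beginning of the word. -/
noncomputable def tableStart (w : Word) : ℕ := vertexCount w + valueCount w + 2

/-- The encoded adjacency relation. -/
def wordAdj (w : Word) (u v : ℕ) : Prop := bitAt w (tableStart w + (u * vertexCount w + v))

/-- The encoded parent relation. -/
def wordPar (w : Word) (u v : ℕ) : Prop :=
  bitAt w (tableStart w + vertexCount w * vertexCount w + (u * vertexCount w + v))

/-- The encoded lists. -/
def wordDom (w : Word) (u a : ℕ) : Prop :=
  bitAt w (tableStart w + vertexCount w * vertexCount w + vertexCount w * vertexCount w +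
    (u * valueCount w + a))

/-- The length of the part of the word that describes graph, forest and lists. -/
noncomputable def graphLength (w : Word) : ℕ :=
  tableStart w + vertexCount w * vertexCount w + vertexCount w * vertexCount w +
    vertexCount w * valueCount w

/-- The encoded constraints. -/
def wordCon (w : Word) (u v a b : ℕ) : Prop :=
  bitAt w (graphLength w + (u * (vertexCount w * (valueCount w * valueCount w)) +
    (v * (valueCount w * valueCount w) + (a * valueCount w + b))))

theorem LP.bitAt {f : Word → (ℕ → ℕ) → ℕ} (hf : LS f) : LP fun w v => bitAt w (f w v) :=
  (LP.eq (LS.read hf) (LS.const 3)).congr fun w v => by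
    rw [ParamCplx.bitAt]
    rcases w[f w v]? with _ | _ | _ | _ <;> simp [symCode]

theorem LS.bitCount : LS fun w _ => bitCount w := by
  classical
  exact LS.sum (b := fun w i _ => if 2 ≤ symCode w[i]? then 1 else 0) LS.length
    (LP.le (LS.const 2) (LS.read (LS.var 0))).indicator

theorem LS.tallyCount : LS fun w _ => tallyCount w := LS.length.sub LS.bitCount

theorem LS.ones {f : Word → (ℕ → ℕ) → ℕ} (hf : LS f) : LS fun w v => ones w (f w v) := by
  classical
  exact LS.sum (b := fun w i v => if ∀ j < i + 1, ParamCplx.bitAt w (f w v + j) then 1 else 0)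
    LS.length (LP.forall_lt (P := fun w j v => ParamCplx.bitAt w (f w (fun i => v (i + 1)) + j))
      (LS.var 0).succ (LP.bitAt ((hf.rename fun i => i + 2).add (LS.var 0)))).indicator

theorem LS.vertexCount : LS fun w _ => vertexCount w := LS.ones (LS.const 0)

theorem LS.valueCount : LS fun w _ => valueCount w := LS.ones LS.vertexCount.succ

theorem LS.tableStart : LS fun w _ => tableStart w :=
  (LS.vertexCount.add LS.valueCount).add (LS.const 2)

theorem LS.graphLength : LS fun w _ => graphLength w :=
  ((LS.tableStart.add (LS.vertexCount.mul LS.vertexCount)).add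
    (LS.vertexCount.mul LS.vertexCount)).add (LS.vertexCount.mul LS.valueCount)

theorem LP.wordAdj {f g : Word → (ℕ → ℕ) → ℕ} (hf : LS f) (hg : LS g) :
    LP fun w v => wordAdj w (f w v) (g w v) :=
  LP.bitAt (LS.tableStart.add ((hf.mul LS.vertexCount).add hg))

theorem LP.wordPar {f g : Word → (ℕ → ℕ) → ℕ} (hf : LS f) (hg : LS g) :
    LP fun w v => wordPar w (f w v) (g w v) :=
  LP.bitAt ((LS.tableStart.add (LS.vertexCount.mul LS.vertexCount)).add
    ((hf.mul LS.vertexCount).add hg))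

theorem LP.wordDom {f g : Word → (ℕ → ℕ) → ℕ} (hf : LS f) (hg : LS g) :
    LP fun w v => wordDom w (f w v) (g w v) :=
  LP.bitAt (((LS.tableStart.add (LS.vertexCount.mul LS.vertexCount)).add
    (LS.vertexCount.mul LS.vertexCount)).add ((hf.mul LS.valueCount).add hg))

theorem LP.wordCon {f g h i : Word → (ℕ → ℕ) → ℕ} (hf : LS f) (hg : LS g) (hh : LS h)
    (hi : LS i) : LP fun w v => wordCon w (f w v) (g w v) (h w v) (i w v) :=
  LP.bitAt (LS.graphLength.add ((hf.mul (LS.vertexCount.mul (LS.valueCount.mul LS.valueCount))).add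
    ((hg.mul (LS.valueCount.mul LS.valueCount)).add ((hh.mul LS.valueCount).add hi))))

section decode

variable (x : List Bool) (k : ℕ)

theorem getElem?_tapeWord (i : ℕ) : (tapeWord (x, k))[i]? =
    if i < x.length then x[i]?.map some else if i < x.length + k then some none else none := by
  simp only [tapeWord]
  split_ifs with h1 h2
  · rw [List.getElem?_append_left (by simpa using h1)]
    simp
  · rw [List.getElem?_append_right (by simpa using h1)]
    simp only [List.length_map, List.getElem?_replicate]
    rw [if_pos (by omega)]
  · rw [List.getElem?_eq_none]
    simpa using h2

theorem bitAt_tapeWord (i : ℕ) : bitAt (tapeWord (x, k)) i ↔ x[i]? = some true := by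
  rw [bitAt, getElem?_tapeWord]
  split_ifs with h1 h2
  · rw [List.getElem?_eq_getElem h1]
    simp
  · simp [List.getElem?_eq_none (not_lt.1 h1)]
  · simp [List.getElem?_eq_none (not_lt.1 h1)]

theorem bitCount_tapeWord : bitCount (tapeWord (x, k)) = x.length := by
  refine sum_ite_lt (by simp [length_tapeWord]) _ fun i _ => ?_
  rw [getElem?_tapeWord]
  split_ifs with h1 h2
  · rw [List.getElem?_eq_getElem h1]
    cases x[i] <;> simp [symCode, h1]
  · simp [symCode, h1]
  · simp [symCode, h1]

theorem tallyCount_tapeWord : tallyCount (tapeWord (x, k)) = k := by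
  simp [tallyCount, bitCount_tapeWord, length_tapeWord]

/-- A run of ones cannot extend beyond the word, so as many tests as the word has symbols suffice to
measure it. -/
theorem ones_eq {w : Word} {s n : ℕ} (h1 : ∀ j < n, bitAt w (s + j)) (h2 : ¬ bitAt w (s + n)) :
    ones w s = n := by
  classical
  refine sum_ite_lt ?_ _ fun i _ => ⟨fun h => ?_, fun h j hj => h1 j (by omega)⟩
  · rcases n with _ | n
    · omega
    · have := h1 n (by omega)
      have := (List.getElem?_eq_some_iff.1 this).1
      omega
  · by_contra hlt
    exact h2 (h n (by omega))

theorem ones_spec (w : Word) (s : ℕ) :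
    (∀ j < ones w s, bitAt w (s + j)) ∧ ¬ bitAt w (s + ones w s) := by
  classical
  have hex : ∃ j, ¬ bitAt w (s + j) := ⟨w.length, by simp [bitAt]⟩
  have h : ones w s = Nat.find hex :=
    ones_eq (fun j hj => not_not.1 (Nat.find_min hex hj)) (Nat.find_spec hex)
  rw [h]
  exact ⟨fun j hj => not_not.1 (Nat.find_min hex hj), Nat.find_spec hex⟩

/-- The decoders are total: a word that is long enough for the sizes read from it always has this
form. Whether the decoded relations are a graph and a forest is left open. -/
theorem eq_graphWord_append (w : Word) (hw : w = tapeWord (x, k)) (h : graphLength w ≤ x.length) :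
    x = graphWord (vertexCount w) (valueCount w) (wordAdj w) (wordPar w) (wordDom w) ++
      x.drop (graphLength w) := by
  have h1 := ones_spec w 0
  have h2 := ones_spec w (vertexCount w + 1)
  subst hw
  simp only [zero_add, bitAt_tapeWord] at h1 h2
  have := graphWord_of_bits x (vertexCount (tapeWord (x, k))) (valueCount (tapeWord (x, k))) h h1.1
    h1.2 h2.1 h2.2
  simp only [← bitAt_tapeWord x k] at this
  exact this

theorem drop_eq_constraintWord (w : Word) (hw : w = tapeWord (x, k))
    (h : x.length = graphLength w +
      vertexCount w * (vertexCount w * (valueCount w * valueCount w))) :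
    x.drop (graphLength w) = constraintWord (vertexCount w) (valueCount w) (wordCon w) := by
  subst hw
  have := constraintWord_of_bits x _ _ _ h
  simp only [← bitAt_tapeWord x k] at this
  exact this

/-- The converse of parsing: the decoders return the encoded sizes, so a failing length check proves
that a word is not an encoding. -/
theorem counts_of_eq {n m : ℕ} {adj par dom : ℕ → ℕ → Prop} {s : List Bool} (w : Word)
    (hw : w = tapeWord (x, k)) (hx : x = graphWord n m adj par dom ++ s) :
    vertexCount w = n ∧ valueCount w = m ∧ x.length = graphLength w + s.length := by
  have hn : vertexCount w = n := by
    subst hw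
    refine ones_eq ?_ ?_
    · intro j hj
      rw [bitAt_tapeWord, hx]
      simp only [graphWord, unary, List.append_assoc, zero_add]
      rw [List.getElem?_append_left (by simpa using hj)]
      simp [hj]
    · rw [bitAt_tapeWord, hx]
      simp only [graphWord, unary, List.append_assoc, zero_add]
      rw [List.getElem?_append_right (by simp)]
      simp
  have hm : valueCount w = m := by
    rw [valueCount, hn]
    subst hw
    have hx' : x = unary n ++ (List.replicate m true ++ (false :: (natTable n n adj ++
        (natTable n n par ++ (natTable n m dom ++ s))))) := by
      rw [hx]
      simp [graphWord, unary]
    refine ones_eq ?_ ?_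
    · intro j hj
      rw [bitAt_tapeWord, hx', List.getElem?_append_right (by simp [length_unary]),
        length_unary, Nat.add_sub_cancel_left, List.getElem?_append_left (by simpa using hj)]
      simp [hj]
    · rw [bitAt_tapeWord, hx', List.getElem?_append_right (by simp [length_unary]),
        length_unary, Nat.add_sub_cancel_left, List.getElem?_append_right (by simp)]
      simp
  refine ⟨hn, hm, ?_⟩
  rw [hx, List.length_append, length_graphWord, graphLength, tableStart, hn, hm]

end decode


/-! ### The two problems in terms of relations on numbers -/

/-- A relation on initial segments as a relation on numbers. -/
def natRel {n m : ℕ} (r : Fin n → Fin m → Prop) (i j : ℕ) : Prop :=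
  ∃ (hi : i < n) (hj : j < m), r ⟨i, hi⟩ ⟨j, hj⟩

theorem natRel_coe {n m : ℕ} (r : Fin n → Fin m → Prop) (i : Fin n) (j : Fin m) :
    natRel r i j ↔ r i j :=
  ⟨fun ⟨_, _, h⟩ => h, fun h => ⟨i.2, j.2, h⟩⟩

/-- The constraints of an instance as a relation on numbers. -/
def BinCSP.natCon {n m : ℕ} (I : BinCSP (Fin n) (Fin m)) (u v a b : ℕ) : Prop :=
  ∃ (hu : u < n) (hv : v < n),
    natRel (fun c d => I.G.Adj ⟨u, hu⟩ ⟨v, hv⟩ ∧ (c, d) ∈ I.C ⟨u, hu⟩ ⟨v, hv⟩) a b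

theorem graphWord_congr {n m : ℕ} {adj par dom adj' par' dom' : ℕ → ℕ → Prop}
    (ha : ∀ u < n, ∀ v < n, (adj u v ↔ adj' u v)) (hp : ∀ u < n, ∀ v < n, (par u v ↔ par' u v))
    (hd : ∀ u < n, ∀ a < m, (dom u a ↔ dom' u a)) :
    graphWord n m adj par dom = graphWord n m adj' par' dom' := by
  rw [graphWord, natTable_congr ha, natTable_congr hp, natTable_congr hd, graphWord]

theorem table_eq_natTable {n m : ℕ} (r : Fin n → Fin m → Prop) :
    table r = natTable n m (natRel r) := by
  rw [table, natTable, ← List.map_coe_finRange_eq_range (n := n), List.flatMap_map]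
  refine List.flatMap_congr fun i _ => ?_
  rw [← List.map_coe_finRange_eq_range, List.map_map]
  refine List.map_congr_left fun j _ => ?_
  simp [natRel_coe]

theorem ListColoring.encode_eq {n m : ℕ} (I : ListColoring (Fin n) (Fin m))
    (F : RootedForest (Fin n)) :
    I.encode F = graphWord n m (natRel I.G.Adj) (natRel fun u v => F.parent u = some v)
      (natRel fun u a => a ∈ I.L u) := by
  simp only [ListColoring.encode, RootedForest.encode, table_eq_natTable, graphWord,
    List.append_assoc]

theorem BinCSP.encode_eq {n m : ℕ} (I : BinCSP (Fin n) (Fin m))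
    (F : RootedForest (Fin n)) :
    I.encode F = graphWord n m (natRel I.G.Adj) (natRel fun u v => F.parent u = some v)
      (natRel fun u a => a ∈ I.D u) ++ constraintWord n m I.natCon := by
  have h : ((List.finRange n).flatMap fun u => (List.finRange n).flatMap fun v =>
      table fun a b => I.G.Adj u v ∧ (a, b) ∈ I.C u v) = constraintWord n m I.natCon := by
    rw [constraintWord, ← List.map_coe_finRange_eq_range, List.flatMap_map]
    refine List.flatMap_congr fun u _ => ?_
    rw [List.flatMap_map]
    refine List.flatMap_congr fun v _ => ?_
    rw [table_eq_natTable]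
    refine natTable_congr fun a _ b _ => ?_
    simp [BinCSP.natCon]
  rw [BinCSP.encode, h]
  simp only [RootedForest.encode, table_eq_natTable, graphWord, List.append_assoc]

/-- Unique parsing fixes the sizes and turns membership into a statement about relations on numbers.
If these are not a graph and a forest, the right side is false. -/
theorem mem_listColoringTreedepth_graphWord {n m k : ℕ} {adj par dom : ℕ → ℕ → Prop} :
    (graphWord n m adj par dom, k) ∈ listColoringTreedepth ↔
      ∃ (I : ListColoring (Fin n) (Fin m)) (F : RootedForest (Fin n)),
        F.IsEliminationForest I.G ∧ F.depth ≤ k ∧ I.Colorable ∧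
        (∀ u v : Fin n, I.G.Adj u v ↔ adj u v) ∧
        (∀ u v : Fin n, F.parent u = some v ↔ par u v) ∧
        ∀ (u : Fin n) (a : Fin m), a ∈ I.L u ↔ dom u a := by
  constructor
  · rintro ⟨n', m', I, F, h1, h2, h3, h4⟩
    have h5 := h3.trans (I.encode_eq F)
    obtain ⟨rfl, rfl, ha, hp, hd, -⟩ := graphWord_append_inj (s := []) (s' := [])
      (congrArg (· ++ []) h5)
    refine ⟨I, F, h1, h2, h4, fun u v => ?_, fun u v => ?_, fun u a => ?_⟩
    · rw [ha u u.2 v v.2, natRel_coe]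
    · rw [hp u u.2 v v.2, natRel_coe fun u v => F.parent u = some v]
    · rw [hd u u.2 a a.2, natRel_coe fun u a => a ∈ I.L u]
  · rintro ⟨I, F, h1, h2, h3, ha, hp, hd⟩
    refine ⟨n, m, I, F, h1, h2, ?_, h3⟩
    rw [I.encode_eq]
    rw [graphWord_congr (adj := natRel I.G.Adj) (adj' := adj) (par' := par) (dom' := dom)]
    · exact fun u hu v hv => (natRel_coe I.G.Adj ⟨u, hu⟩ ⟨v, hv⟩).trans (ha ⟨u, hu⟩ ⟨v, hv⟩)
    · exact fun u hu v hv => (natRel_coe (fun u v => F.parent u = some v) ⟨u, hu⟩ ⟨v, hv⟩).trans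
        (hp ⟨u, hu⟩ ⟨v, hv⟩)
    · exact fun u hu a ha => (natRel_coe (fun u a => a ∈ I.L u) ⟨u, hu⟩ ⟨a, ha⟩).trans
        (hd ⟨u, hu⟩ ⟨a, ha⟩)

theorem mem_binCSPTreedepth_graphWord {n m k : ℕ} {adj par dom : ℕ → ℕ → Prop}
    {con : ℕ → ℕ → ℕ → ℕ → Prop} :
    (graphWord n m adj par dom ++ constraintWord n m con, k) ∈ binCSPTreedepth ↔
      ∃ (I : BinCSP (Fin n) (Fin m)) (F : RootedForest (Fin n)),
        F.IsEliminationForest I.G ∧ F.depth ≤ k ∧ I.Satisfiable ∧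
        (∀ u v : Fin n, I.G.Adj u v ↔ adj u v) ∧
        (∀ u v : Fin n, F.parent u = some v ↔ par u v) ∧
        (∀ (u : Fin n) (a : Fin m), a ∈ I.D u ↔ dom u a) ∧
        ∀ (u v : Fin n) (a b : Fin m), I.G.Adj u v ∧ (a, b) ∈ I.C u v ↔ con u v a b := by
  have hcon (I : BinCSP (Fin n) (Fin m)) (u v : Fin n) (a b : Fin m) :
      I.natCon u v a b ↔ I.G.Adj u v ∧ (a, b) ∈ I.C u v := by
    simp [BinCSP.natCon, natRel]
  constructor
  · rintro ⟨n', m', I, F, h1, h2, h3, h4⟩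
    have h5 := h3.trans (I.encode_eq F)
    obtain ⟨rfl, rfl, ha, hp, hd, hc⟩ := graphWord_append_inj h5
    refine ⟨I, F, h1, h2, h4, fun u v => ?_, fun u v => ?_, fun u a => ?_, fun u v a b => ?_⟩
    · rw [ha u u.2 v v.2, natRel_coe]
    · rw [hp u u.2 v v.2, natRel_coe fun u v => F.parent u = some v]
    · rw [hd u u.2 a a.2, natRel_coe fun u a => a ∈ I.D u]
    · rw [constraintWord_inj hc u u.2 v v.2 a a.2 b b.2, hcon]
  · rintro ⟨I, F, h1, h2, h3, ha, hp, hd, hc⟩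
    refine ⟨n, m, I, F, h1, h2, ?_, h3⟩
    have hc' : constraintWord n m con = constraintWord n m I.natCon := by
      refine List.flatMap_congr fun u hu => List.flatMap_congr fun v hv =>
        natTable_congr fun a ha b hb => ?_
      rw [List.mem_range] at hu hv
      exact (hc ⟨u, hu⟩ ⟨v, hv⟩ ⟨a, ha⟩ ⟨b, hb⟩).symm.trans (hcon I ⟨u, hu⟩ ⟨v, hv⟩ ⟨a, ha⟩ ⟨b, hb⟩).symm
    rw [I.encode_eq, hc']
    rw [graphWord_congr (adj := natRel I.G.Adj) (adj' := adj) (par' := par) (dom' := dom)]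
    · exact fun u hu v hv => (natRel_coe I.G.Adj ⟨u, hu⟩ ⟨v, hv⟩).trans (ha ⟨u, hu⟩ ⟨v, hv⟩)
    · exact fun u hu v hv => (natRel_coe (fun u v => F.parent u = some v) ⟨u, hu⟩ ⟨v, hv⟩).trans
        (hp ⟨u, hu⟩ ⟨v, hv⟩)
    · exact fun u hu a ha => (natRel_coe (fun u a => a ∈ I.D u) ⟨u, hu⟩ ⟨a, ha⟩).trans
        (hd ⟨u, hu⟩ ⟨a, ha⟩)

theorem ListColoring.encode_ne_nil {n m : ℕ} (I : ListColoring (Fin n) (Fin m))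
    (F : RootedForest (Fin n)) : I.encode F ≠ [] := by
  simp [ListColoring.encode, unary]

theorem BinCSP.encode_ne_nil {n m : ℕ} (I : BinCSP (Fin n) (Fin m))
    (F : RootedForest (Fin n)) : I.encode F ≠ [] := by
  simp [BinCSP.encode, unary]

/-- The empty word contains no numerals; it is the image of all rejected inputs. -/
theorem nil_notMem_listColoringTreedepth (k : ℕ) : ([], k) ∉ listColoringTreedepth := by
  rintro ⟨n, m, I, F, -, -, h, -⟩
  exact I.encode_ne_nil F h.symm

theorem nil_notMem_binCSPTreedepth (k : ℕ) : ([], k) ∉ binCSPTreedepth := by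
  rintro ⟨n, m, I, F, -, -, h, -⟩
  exact I.encode_ne_nil F h.symm


/-! ### Reductions that are defined on tape words -/

open Classical in
/-- The map that sends the inputs with property `p` to `(b, k)`, and all others to the empty
word. -/
noncomputable def guardedMap (p : Word → Prop) (b : Word → List Bool) (k : Word → ℕ)
    (y : List Bool × ℕ) : List Bool × ℕ :=
  if p (tapeWord y) then (b (tapeWord y), k (tapeWord y)) else ([], 0)

theorem plComputable_guardedMap_comp {α : Type} {R : List α × ℕ → List Bool × ℕ}
    (hR : PLComputable R) {p : Word → Prop} {b : Word → List Bool} {k : Word → ℕ}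
    (hp : LP fun w _ => p w) (hb : LSO fun w _ => (b w).map some) (hk : LS fun w _ => k w) :
    PLComputable (guardedMap p b k ∘ R) := by
  have h := LSO.ite hp (hb.append (LSO.replicate hk none)) LSO.nil
  refine LSO.plComputable_comp hR h fun y => ?_
  rw [guardedMap]
  split_ifs <;> rfl

/-! ### List Coloring as a binary CSP -/

/-- The constraints of a List Coloring instance. -/
def differCon (adj dom : ℕ → ℕ → Prop) (u v a b : ℕ) : Prop :=
  adj u v ∧ dom u a ∧ dom v b ∧ a ≠ b

/-- Both sides speak of the same graph, forest and lists, so any defect of these occurs on both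
sides; only the constraints have to be supplied. -/
theorem mem_binCSPTreedepth_differCon {n m k : ℕ} {adj par dom : ℕ → ℕ → Prop} :
    (graphWord n m adj par dom ++ constraintWord n m (differCon adj dom), k) ∈ binCSPTreedepth ↔
      (graphWord n m adj par dom, k) ∈ listColoringTreedepth := by
  classical
  rw [mem_binCSPTreedepth_graphWord, mem_listColoringTreedepth_graphWord]
  constructor
  · rintro ⟨I, F, hF, hk, ⟨η, hη, hη'⟩, ha, hp, hd, hc⟩
    refine ⟨⟨I.G, I.D⟩, F, hF, hk, ⟨η, hη, fun u v huv h => ?_⟩, ha, hp, hd⟩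
    exact ((hc u v _ _).1 ⟨huv, hη' u v huv⟩).2.2.2 (congrArg Fin.val h)
  · rintro ⟨I, F, hF, hk, ⟨f, hf, hf'⟩, ha, hp, hd⟩
    have hmem (u v : Fin n) (a b : Fin m) :
        (a, b) ∈ (I.L u ×ˢ I.L v).filter (fun p => p.1 ≠ p.2) ↔
          a ∈ I.L u ∧ b ∈ I.L v ∧ a ≠ b := by
      simp [and_assoc]
    refine ⟨⟨I.G, I.L, fun u v => (I.L u ×ˢ I.L v).filter fun p => p.1 ≠ p.2, ?_, ?_⟩, F, hF, hk,
      ⟨f, hf, fun u v huv => (hmem u v _ _).2 ⟨hf u, hf v, hf' u v huv⟩⟩, ha, hp, hd, ?_⟩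
    · exact fun u v _ a b h => ⟨((hmem u v a b).1 h).1, ((hmem u v a b).1 h).2.1⟩
    · intro u v _ a b
      rw [hmem, hmem]
      tauto
    · intro u v a b
      change _ ∧ _ ∈ Finset.filter _ _ ↔ _
      rw [hmem, ha, hd, hd, differCon, Ne, Ne, Fin.ext_iff]

/-- The reduction from List Coloring to BinCSP. -/
noncomputable def listColoringToBinCSP : List Bool × ℕ → List Bool × ℕ :=
  guardedMap (fun w => bitCount w = graphLength w)
    (fun w => graphWord (vertexCount w) (valueCount w) (wordAdj w) (wordPar w) (wordDom w) ++
      constraintWord (vertexCount w) (valueCount w) (differCon (wordAdj w) (wordDom w)))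
    tallyCount

/-- Only the length is tested. A word of the right length with a defective graph or forest is
translated as it stands and remains a no-instance. -/
theorem listColoringToBinCSP_mem (z : List Bool × ℕ) :
    listColoringToBinCSP z ∈ binCSPTreedepth ↔ z ∈ listColoringTreedepth := by
  obtain ⟨x, k⟩ := z
  rw [listColoringToBinCSP, guardedMap]
  split_ifs with h
  · rw [bitCount_tapeWord] at h
    have hx := eq_graphWord_append x k _ rfl h.ge
    rw [List.drop_of_length_le h.le, List.append_nil] at hx
    rw [mem_binCSPTreedepth_differCon, ← hx, tallyCount_tapeWord]
  · refine iff_of_false (nil_notMem_binCSPTreedepth 0) ?_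
    rintro ⟨n, m, I, F, -, -, hx, -⟩
    have := (counts_of_eq x k (s := []) _ rfl (by
      rw [List.append_nil, ← I.encode_eq F]
      exact hx)).2.2
    exact h (by simpa [bitCount_tapeWord] using this)

theorem listColoringToBinCSP_snd_le (z : List Bool × ℕ) : (listColoringToBinCSP z).2 ≤ z.2 := by
  rw [listColoringToBinCSP, guardedMap]
  split_ifs
  · exact (tallyCount_tapeWord z.1 z.2).le
  · exact Nat.zero_le _

theorem plComputable_listColoringToBinCSP : PLComputable listColoringToBinCSP := by
  have hg := LSO.graphWord (adj := fun w _ => wordAdj w) (par := fun w _ => wordPar w)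
    (dom := fun w _ => wordDom w) LS.vertexCount LS.valueCount
    (LP.wordAdj (LS.var 1) (LS.var 0)) (LP.wordPar (LS.var 1) (LS.var 0))
    (LP.wordDom (LS.var 1) (LS.var 0))
  have hc := LSO.constraintWord (con := fun w _ => differCon (wordAdj w) (wordDom w))
    LS.vertexCount LS.valueCount ((LP.wordAdj (LS.var 3) (LS.var 2)).and
      ((LP.wordDom (LS.var 3) (LS.var 1)).and ((LP.wordDom (LS.var 2) (LS.var 0)).and
        (LP.eq (LS.var 1) (LS.var 0)).not)))
  refine plComputable_guardedMap_comp plComputable_id (LP.eq LS.bitCount LS.graphLength) ?_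
    LS.tallyCount
  simpa only [List.map_append] using hg.append hc

theorem inXSLP_listColoringTreedepth : InXSLP listColoringTreedepth :=
  ⟨listColoringToBinCSP, fun z => (listColoringToBinCSP_mem z).symm,
    ⟨id, Computable.id, listColoringToBinCSP_snd_le⟩, plComputable_listColoringToBinCSP⟩


/-! ### Iterated parents -/

section climb

variable {V : Type}

/-- Splits off the first step, from `v` to its parent, where the definition splits off the last one.
-/
theorem climb_succ' (parent : V → Option V) (j : ℕ) (v : V) :
    climb parent (j + 1) v = (parent v).bind (climb parent j) := by
  induction j generalizing v with
  | zero => cases h : parent v <;> simp [climb, h]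
  | succ j ih =>
    rw [climb, ih]
    cases h : parent v <;> simp [climb]

theorem climb_eq_none_of_le {parent : V → Option V} {i j : ℕ} {v : V} (hij : i ≤ j)
    (h : climb parent i v = none) : climb parent j v = none := by
  induction hij with
  | refl => exact h
  | step _ ih => rw [climb, ih, Option.bind_none]

theorem climb_map {V' : Type} {parent : V → Option V} {parent' : V' → Option V'} (e : V → V')
    (h : ∀ v, parent' (e v) = (parent v).map e) (j : ℕ) (v : V) :
    climb parent' j (e v) = (climb parent j v).map e := by
  induction j with
  | zero => rfl
  | succ j ih =>
    rw [climb, climb, ih]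
    cases climb parent j v <;> simp [h]

/-- The level of a vertex is the least number of steps that leads past its root, and once past the
root the walk stays there. -/
theorem RootedForest.depth_le_iff [Fintype V] (F : RootedForest V) (k : ℕ) :
    F.depth ≤ k ↔ ∀ v, climb F.parent k v = none := by
  classical
  rw [depth, Finset.sup_le_iff]
  refine ⟨fun h v => ?_, fun h v _ => Nat.find_le (h v)⟩
  exact climb_eq_none_of_le (h v (Finset.mem_univ v)) (Nat.find_spec (F.acyclic v))

end climb

open Classical in
/-- The parent of `u`, or `n` if there is none. -/
noncomputable def nextVertex (n : ℕ) (par : ℕ → ℕ → Prop) (u : ℕ) : ℕ :=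
  if u < n ∧ ∃ y < n, par u y then ∑ y ∈ Finset.range n, if par u y then y else 0 else n

/-- `v` is reached from `u` in less than `k` steps from parent to parent. -/
def IsAbove (n k : ℕ) (par : ℕ → ℕ → Prop) (u v : ℕ) : Prop :=
  ∃ j < k, (nextVertex n par)^[j] u = v

/-- The number `n` plays the role of `none` and is a fixed point. For a genuine forest, the parent
is the only index that contributes to the sum in `nextVertex`. -/
theorem iterate_nextVertex {n : ℕ} {par : ℕ → ℕ → Prop} (F : RootedForest (Fin n))
    (hF : ∀ u v : Fin n, F.parent u = some v ↔ par u v) (j : ℕ) (u : Fin n) :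
    (nextVertex n par)^[j] u = (climb F.parent j u).elim n Fin.val := by
  classical
  have hnext (v : Fin n) : nextVertex n par v = (F.parent v).elim n Fin.val := by
    rw [nextVertex]
    cases h : F.parent v with
    | none =>
      rw [if_neg]
      · rfl
      · rintro ⟨-, y, hy, hpar⟩
        have := (hF v ⟨y, hy⟩).2 hpar
        simp [h] at this
    | some y =>
      rw [if_pos ⟨v.2, y, y.2, (hF v y).1 h⟩, Finset.sum_eq_single (y : ℕ)]
      · rw [if_pos ((hF v y).1 h)]
        rfl
      · intro z hz hzy
        refine if_neg fun hpar => hzy ?_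
        have := (hF v ⟨z, Finset.mem_range.1 hz⟩).2 hpar
        rw [h, Option.some_inj] at this
        rw [this]
      · simp
  induction j with
  | zero => rfl
  | succ j ih =>
    rw [Function.iterate_succ_apply', ih, climb]
    cases climb F.parent j u with
    | none => simp [nextVertex]
    | some v => exact hnext v

theorem iterate_nextVertex_eq_iff {n : ℕ} {par : ℕ → ℕ → Prop} (F : RootedForest (Fin n))
    (hF : ∀ u v : Fin n, F.parent u = some v ↔ par u v) (j : ℕ) (u v : Fin n) :
    (nextVertex n par)^[j] u = v ↔ climb F.parent j u = some v := by
  rw [iterate_nextVertex F hF]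
  cases climb F.parent j u with
  | none => simpa using v.2.ne'
  | some y => simp [Fin.ext_iff]

/-! ### Numbering of the gadgets

In the List Coloring instance, the vertices below `n` are the variables of the CSP, and the vertex
`gadgetIndex n m u v a b` excludes that `u` has value `a` and `v` has value `b`. -/

/-- The number of vertices of the List Coloring instance. -/
def gadgetCount (n m : ℕ) : ℕ := n + n * (n * (m * m))

/-- The vertex that excludes the pair of values `a`, `b` for `u`, `v`. -/
def gadgetIndex (n m u v a b : ℕ) : ℕ := n + (u * (n * (m * m)) + (v * (m * m) + (a * m + b)))

/-- The first variable of a gadget. -/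
def gadgetFst (n m p : ℕ) : ℕ := (p - n) / (n * (m * m))

/-- The second variable of a gadget. -/
def gadgetSnd (n m p : ℕ) : ℕ := (p - n) / (m * m) % n

/-- The value of the first variable of a gadget. -/
def gadgetFstVal (n m p : ℕ) : ℕ := (p - n) / m % m

/-- The value of the second variable of a gadget. -/
def gadgetSndVal (n m p : ℕ) : ℕ := (p - n) % m

theorem mul_add_lt_mul {x y c d : ℕ} (hx : x < c) (hy : y < d) : x * d + y < c * d :=
  calc x * d + y < x * d + d := by omega
    _ = (x + 1) * d := (Nat.succ_mul x d).symm
    _ ≤ c * d := Nat.mul_le_mul_right d hx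

theorem mul_add_div_of_lt {x y d : ℕ} (hy : y < d) : (x * d + y) / d = x := by
  rw [mul_comm, Nat.mul_add_div (by omega), Nat.div_eq_of_lt hy, add_zero]

theorem mul_add_mod_of_lt {x y d : ℕ} (hy : y < d) : (x * d + y) % d = y := by
  rw [mul_comm, Nat.mul_add_mod, Nat.mod_eq_of_lt hy]

section gadgetIndex

variable {n m u v a b : ℕ}

/-- After subtraction of `n`, the index is a mixed-radix numeral with the digits `u`, `v`, `a`, `b`,
which quotients and remainders recover. -/
theorem gadgetIndex_lt (hu : u < n) (hv : v < n) (ha : a < m) (hb : b < m) :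
    gadgetIndex n m u v a b < gadgetCount n m :=
  Nat.add_lt_add_left
    (mul_add_lt_mul hu (mul_add_lt_mul hv (mul_add_lt_mul ha hb))) n

theorem gadgetFst_gadgetIndex (hv : v < n) (ha : a < m) (hb : b < m) :
    gadgetFst n m (gadgetIndex n m u v a b) = u := by
  rw [gadgetFst, gadgetIndex, Nat.add_sub_cancel_left,
    mul_add_div_of_lt (mul_add_lt_mul hv (mul_add_lt_mul ha hb))]

theorem gadgetSnd_gadgetIndex (hv : v < n) (ha : a < m) (hb : b < m) :
    gadgetSnd n m (gadgetIndex n m u v a b) = v := by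
  rw [gadgetSnd, gadgetIndex, Nat.add_sub_cancel_left, ← mul_assoc, ← add_assoc, ← add_mul,
    mul_add_div_of_lt (mul_add_lt_mul ha hb), mul_add_mod_of_lt hv]

theorem gadgetFstVal_gadgetIndex (ha : a < m) (hb : b < m) :
    gadgetFstVal n m (gadgetIndex n m u v a b) = a := by
  have h : u * (n * (m * m)) + (v * (m * m) + (a * m + b)) =
      ((u * n + v) * m + a) * m + b := by ring
  rw [gadgetFstVal, gadgetIndex, Nat.add_sub_cancel_left, h, mul_add_div_of_lt hb,
    mul_add_mod_of_lt ha]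

theorem gadgetSndVal_gadgetIndex (hb : b < m) :
    gadgetSndVal n m (gadgetIndex n m u v a b) = b := by
  have h : u * (n * (m * m)) + (v * (m * m) + (a * m + b)) =
      ((u * n + v) * m + a) * m + b := by ring
  rw [gadgetSndVal, gadgetIndex, Nat.add_sub_cancel_left, h, mul_add_mod_of_lt hb]

/-- The mere existence of a gadget forces `n` and `m` to be positive, as the remainders require. -/
theorem gadget_bounds {p : ℕ} (hp : p < gadgetCount n m) (hn : n ≤ p) :
    gadgetFst n m p < n ∧ gadgetSnd n m p < n ∧ gadgetFstVal n m p < m ∧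
      gadgetSndVal n m p < m := by
  have h : p - n < n * (n * (m * m)) := by
    rw [gadgetCount] at hp
    omega
  have h0 : 0 < n ∧ 0 < m := by
    refine ⟨Nat.pos_of_ne_zero ?_, Nat.pos_of_ne_zero ?_⟩ <;> rintro rfl <;> simp at h
  exact ⟨Nat.div_lt_of_lt_mul (by rwa [mul_comm]), Nat.mod_lt _ h0.1,
    Nat.mod_lt _ h0.2, Nat.mod_lt _ h0.2⟩

theorem le_gadgetIndex : n ≤ gadgetIndex n m u v a b := Nat.le_add_right _ _

end gadgetIndex


/-! ### A binary CSP as a List Coloring instance -/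

section gadget

variable (n m k : ℕ) (adj par dom : ℕ → ℕ → Prop) (con : ℕ → ℕ → ℕ → ℕ → Prop)

/-- The gadget forbids a pair of values that violates a constraint.  For each edge only the
gadgets in one direction are used, where the second variable is above the first. -/
def GadgetActive (p : ℕ) : Prop :=
  adj (gadgetFst n m p) (gadgetSnd n m p) ∧ IsAbove n k par (gadgetFst n m p) (gadgetSnd n m p) ∧
    ¬ con (gadgetFst n m p) (gadgetSnd n m p) (gadgetFstVal n m p) (gadgetSndVal n m p)

/-- The variable `x` is adjacent to the gadget `p`. -/
def GadgetEdge (x p : ℕ) : Prop :=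
  x < n ∧ n ≤ p ∧ GadgetActive n m k adj par con p ∧ (x = gadgetFst n m p ∨ x = gadgetSnd n m p)

/-- The edges of the List Coloring instance. -/
def gadgetAdj (x y : ℕ) : Prop :=
  (x < n ∧ y < n ∧ adj x y) ∨ GadgetEdge n m k adj par con x y ∨ GadgetEdge n m k adj par con y x

/-- The parent relation of the List Coloring instance: a gadget is a child of its first
variable. -/
def gadgetPar (p q : ℕ) : Prop :=
  q < n ∧ ((p < n ∧ par p q) ∨ (n ≤ p ∧ q = gadgetFst n m p))

/-- The lists of the List Coloring instance; the color `x * m + a` stands for the value `a` of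
the variable `x`. -/
def gadgetDom (p c : ℕ) : Prop :=
  (p < n ∧ c / m = p ∧ dom p (c % m)) ∨ (n ≤ p ∧ (c = gadgetFst n m p * m + gadgetFstVal n m p ∨
    c = gadgetSnd n m p * m + gadgetSndVal n m p))

/-- The CSP with these relations has the properties of a CSP instance that concern the
constraints. -/
def ConValid : Prop :=
  ∀ u < n, ∀ v < n, ∀ a < m, ∀ b < m, con u v a b → adj u v ∧ dom u a ∧ dom v b ∧ con v u b a

variable {n m k adj par dom con}

/-- Graph and forest are restricted to the variables, which is possible because parents are always
variables. The assignment is read from the colors; a violated constraint would leave its gadget with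
both colors of its list taken by neighbours. -/
theorem binCSP_mem_of_gadget_mem (hcon : ConValid n m adj dom con)
    (h : (graphWord (gadgetCount n m) (n * m) (gadgetAdj n m k adj par con) (gadgetPar n m par)
      (gadgetDom n m dom), k + 1) ∈ listColoringTreedepth) :
    (graphWord n m adj par dom ++ constraintWord n m con, k) ∈ binCSPTreedepth := by
  classical
  rw [mem_listColoringTreedepth_graphWord] at h
  obtain ⟨I', F', hF', hk', ⟨f, hf, hf'⟩, ha', hp', hd'⟩ := h
  have hnN : n ≤ gadgetCount n m := Nat.le_add_right _ _
  let e : Fin n → Fin (gadgetCount n m) := Fin.castLE hnN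
  have he : Function.Injective e := Fin.castLE_injective hnN
  let parent : Fin n → Option (Fin n) := fun u =>
    (F'.parent (e u)).bind fun q => if h : (q : ℕ) < n then some ⟨q, h⟩ else none
  have hparent (u : Fin n) : F'.parent (e u) = (parent u).map e := by
    cases h : F'.parent (e u) with
    | none => simp [parent, h]
    | some q =>
      have hq := ((hp' _ _).1 h).1
      simp only [parent, h, Option.bind_some, dif_pos hq, Option.map_some]
      rfl
  have hclimb := climb_map e hparent
  have hac (u : Fin n) : ∃ j, climb parent j u = none := by
    obtain ⟨j, hj⟩ := F'.acyclic (e u)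
    rw [hclimb, Option.map_eq_none_iff] at hj
    exact ⟨j, hj⟩
  let F : RootedForest (Fin n) := ⟨parent, hac⟩
  have hp (u v : Fin n) : F.parent u = some v ↔ par u v := by
    have h1 : F.parent u = some v ↔ F'.parent (e u) = some (e v) := by
      rw [hparent]
      change parent u = some v ↔ _
      cases parent u <;> simp [he.eq_iff]
    rw [h1, hp']
    simp [gadgetPar, e]
  have hanc (u v : Fin n) : F'.IsAncestor (e u) (e v) → F.IsAncestor u v := by
    rintro ⟨j, hj⟩
    refine ⟨j, ?_⟩
    rw [hclimb, Option.map_eq_some_iff] at hj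
    obtain ⟨y, hy, hye⟩ := hj
    rw [← he hye]
    exact hy
  let G : SimpleGraph (Fin n) := I'.G.comap e
  have hG (u v : Fin n) : G.Adj u v ↔ adj u v := by
    rw [SimpleGraph.comap_adj, ha']
    simp [gadgetAdj, GadgetEdge, e]
  have hF : F.IsEliminationForest G := fun u v huv => (hF' _ _ huv).imp (hanc u v) (hanc v u)
  -- The color of a variable is a number below `n * m`, which rules out `m = 0`.
  have hm (u : Fin n) : 0 < m := by
    have := (f (e u)).2
    exact Nat.pos_of_ne_zero (by rintro rfl; simp at this)
  -- Below each variable `u` hangs a gadget, for instance that of `u`, `u` and the values 0, 0,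
  -- whether active or not. It lies one level deeper, so the bound `k + 1` becomes `k` on the
  -- variables.
  have hk : F.depth ≤ k := by
    rw [F.depth_le_iff]
    intro u
    rw [F'.depth_le_iff] at hk'
    have hlt := gadgetIndex_lt u.2 u.2 (hm u) (hm u)
    have hpar : F'.parent ⟨_, hlt⟩ = some (e u) :=
      (hp' _ _).2 ⟨u.2, Or.inr ⟨le_gadgetIndex, (gadgetFst_gadgetIndex u.2 (hm u) (hm u)).symm⟩⟩
    have := hk' ⟨_, hlt⟩
    rw [climb_succ', hpar, Option.bind_some, hclimb, Option.map_eq_none_iff] at this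
    exact this
  let η : Fin n → Fin m := fun u => ⟨f (e u) % m, Nat.mod_lt _ (hm u)⟩
  have hη (u : Fin n) : (f (e u) : ℕ) = u * m + η u ∧ dom u (η u) := by
    rcases (hd' _ _).1 (hf (e u)) with ⟨_, h1, h2⟩ | ⟨h1, _⟩
    · refine ⟨?_, h2⟩
      have h1 : (f (e u) : ℕ) / m = u := h1
      rw [← h1]
      exact (Nat.div_add_mod' _ _).symm
    · exact absurd u.2 (not_lt.2 h1)
  have key (u v : Fin n) (huv : adj u v) (hvu : F.IsAncestor v u) : con u v (η u) (η v) := by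
    by_contra hnot
    obtain ⟨j, hj⟩ := hvu
    -- `IsAbove` searches fewer than `k` steps, which by the depth bound finds every ancestor.
    have hjk : j < k := by
      by_contra hlt
      rw [climb_eq_none_of_le (not_lt.1 hlt) ((F.depth_le_iff k).1 hk u)] at hj
      cases hj
    have habove : IsAbove n k par u v := ⟨j, hjk, (iterate_nextVertex_eq_iff F hp j u v).2 hj⟩
    have hlt := gadgetIndex_lt u.2 v.2 (η u).2 (η v).2
    have e1 := gadgetFst_gadgetIndex (u := u) v.2 (η u).2 (η v).2
    have e2 := gadgetSnd_gadgetIndex (u := u) v.2 (η u).2 (η v).2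
    have e3 := gadgetFstVal_gadgetIndex (n := n) (u := u) (v := v) (η u).2 (η v).2
    have e4 := gadgetSndVal_gadgetIndex (n := n) (u := u) (v := v) (a := η u) (η v).2
    have hact : GadgetActive n m k adj par con (gadgetIndex n m u v (η u) (η v)) := by
      rw [GadgetActive, e1, e2, e3, e4]
      exact ⟨huv, habove, hnot⟩
    have hadj1 : I'.G.Adj (e u) ⟨_, hlt⟩ :=
      (ha' _ _).2 (Or.inr (Or.inl ⟨u.2, le_gadgetIndex, hact, Or.inl e1.symm⟩))
    have hadj2 : I'.G.Adj (e v) ⟨_, hlt⟩ :=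
      (ha' _ _).2 (Or.inr (Or.inl ⟨v.2, le_gadgetIndex, hact, Or.inr e2.symm⟩))
    rcases (hd' _ _).1 (hf ⟨_, hlt⟩) with ⟨h1, _⟩ | ⟨_, h1 | h1⟩
    · exact absurd h1 (not_lt.2 le_gadgetIndex)
    · rw [e1, e3, ← (hη u).1] at h1
      exact hf' _ _ hadj1 (Fin.ext h1.symm)
    · rw [e2, e4, ← (hη v).1] at h1
      exact hf' _ _ hadj2 (Fin.ext h1.symm)
  rw [mem_binCSPTreedepth_graphWord]
  have hmemD (u : Fin n) (a : Fin m) : a ∈ Finset.univ.filter (fun a : Fin m => dom u a) ↔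
      dom u a := by simp
  have hmemC (u v : Fin n) (a b : Fin m) : (a, b) ∈ Finset.univ.filter
      (fun p : Fin m × Fin m => con u v p.1 p.2) ↔ con u v a b := by simp
  refine ⟨⟨G, fun u => Finset.univ.filter fun a : Fin m => dom u a,
    fun u v => Finset.univ.filter fun p : Fin m × Fin m => con u v p.1 p.2, ?_, ?_⟩, F, hF, hk,
    ⟨η, fun u => (hmemD _ _).2 (hη u).2, fun u v huv => (hmemC _ _ _ _).2 ?_⟩, hG, hp, hmemD, ?_⟩
  · intro u v _ a b h
    rw [hmemC] at h
    rw [hmemD, hmemD]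
    have := hcon u u.2 v v.2 a a.2 b b.2 h
    exact ⟨this.2.1, this.2.2.1⟩
  · intro u v _ a b
    rw [hmemC, hmemC]
    exact ⟨fun h => (hcon u u.2 v v.2 a a.2 b b.2 h).2.2.2,
      fun h => (hcon v v.2 u u.2 b b.2 a a.2 h).2.2.2⟩
  -- If `u` is above `v`, the active gadgets belong to the reversed edge, and `ConValid` transfers
  -- the result to the converse.
  · rcases hF u v huv with h | h
    · have := key v u ((hG v u).1 huv.symm) h
      exact (hcon v v.2 u u.2 _ (η v).2 _ (η u).2 this).2.2.2
    · exact key u v ((hG u v).1 huv) h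
  · intro u v a b
    change _ ∧ _ ∈ Finset.filter _ _ ↔ _
    rw [hmemC, hG]
    exact ⟨And.right, fun h => ⟨(hcon u u.2 v v.2 a a.2 b b.2 h).1, h⟩⟩

/-- A gadget for `u`, `v`, `a`, `b` takes the color of `(u, a)` unless `u` has the value `a`; in
that case it takes the color of `(v, b)`, which is free because the satisfied constraint excludes
`(a, b)`. -/
theorem gadget_mem_of_binCSP_mem
    (h : (graphWord n m adj par dom ++ constraintWord n m con, k) ∈ binCSPTreedepth) :
    (graphWord (gadgetCount n m) (n * m) (gadgetAdj n m k adj par con) (gadgetPar n m par)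
      (gadgetDom n m dom), k + 1) ∈ listColoringTreedepth := by
  classical
  rw [mem_binCSPTreedepth_graphWord] at h
  obtain ⟨I, F, hF, hk, ⟨η, hη, hη'⟩, ha, hp, hd, hc⟩ := h
  have hnN : n ≤ gadgetCount n m := Nat.le_add_right _ _
  let e : Fin n → Fin (gadgetCount n m) := Fin.castLE hnN
  have hfst (p : Fin (gadgetCount n m)) (h : ¬ (p : ℕ) < n) : gadgetFst n m p < n :=
    (gadget_bounds p.2 (not_lt.1 h)).1
  let parent : Fin (gadgetCount n m) → Option (Fin (gadgetCount n m)) := fun p =>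
    if h : (p : ℕ) < n then (F.parent ⟨p, h⟩).map e else some (e ⟨gadgetFst n m p, hfst p h⟩)
  have hparent (u : Fin n) : parent (e u) = (F.parent u).map e := dif_pos u.2
  have hparent' (p : Fin (gadgetCount n m)) (h : ¬ (p : ℕ) < n) :
      parent p = some (e ⟨gadgetFst n m p, hfst p h⟩) := dif_neg h
  have hclimb := climb_map e hparent
  -- One extra step pays for the way from a gadget to its first variable.
  have hnone (j : ℕ) (hj : ∀ u, climb F.parent j u = none) (p : Fin (gadgetCount n m)) :
      climb parent (j + 1) p = none := by
    by_cases hpn : (p : ℕ) < n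
    · have := hclimb j ⟨p, hpn⟩
      rw [hj, Option.map_none] at this
      exact climb_eq_none_of_le (Nat.le_succ j) this
    · rw [climb_succ', hparent' p hpn, Option.bind_some, hclimb, hj, Option.map_none]
  have hk' := hnone k ((F.depth_le_iff k).1 hk)
  let F' : RootedForest (Fin (gadgetCount n m)) := ⟨parent, fun v => ⟨k + 1, hk' v⟩⟩
  have hF'par (p q : Fin (gadgetCount n m)) :
      F'.parent p = some q ↔ gadgetPar n m par p q := by
    change parent p = some q ↔ _
    by_cases hpn : (p : ℕ) < n
    · rw [show parent p = (F.parent ⟨p, hpn⟩).map e from hparent ⟨p, hpn⟩,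
        Option.map_eq_some_iff, gadgetPar]
      constructor
      · rintro ⟨y, hy, rfl⟩
        exact ⟨y.2, Or.inl ⟨hpn, (hp _ _).1 hy⟩⟩
      · rintro ⟨hq, ⟨-, h⟩ | ⟨h, -⟩⟩
        · exact ⟨⟨q, hq⟩, (hp _ _).2 h, rfl⟩
        · omega
    · rw [hparent' p hpn, Option.some_inj, gadgetPar]
      constructor
      · rintro rfl
        exact ⟨hfst p hpn, Or.inr ⟨not_lt.1 hpn, rfl⟩⟩
      · rintro ⟨hq, ⟨h, -⟩ | ⟨-, h⟩⟩
        · omega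
        · exact Fin.ext h.symm
  have hne {u v : ℕ} (hu : u < n) (hv : v < n) (huv : adj u v) : u ≠ v := by
    rintro rfl
    exact I.G.irrefl ((ha ⟨u, hu⟩ ⟨u, hu⟩).2 huv)
  let G' : SimpleGraph (Fin (gadgetCount n m)) :=
    { Adj := fun x y => gadgetAdj n m k adj par con x y
      symm := ⟨by
        rintro x y (⟨hx, hy, h⟩ | h | h)
        · exact Or.inl ⟨hy, hx, (ha ⟨y, hy⟩ ⟨x, hx⟩).1 ((ha ⟨x, hx⟩ ⟨y, hy⟩).2 h).symm⟩
        · exact Or.inr (Or.inr h)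
        · exact Or.inr (Or.inl h)⟩
      loopless := ⟨by
        rintro x (⟨hx, _, h⟩ | ⟨h1, h2, -⟩ | ⟨h1, h2, -⟩)
        · exact hne hx hx h rfl
        · omega
        · omega⟩ }
  -- The first variable is the parent of the gadget. The second one is above the first by the
  -- condition `IsAbove` on active gadgets.
  have hancestor {x p : Fin (gadgetCount n m)} (h : GadgetEdge n m k adj par con x p) :
      F'.IsAncestor x p := by
    obtain ⟨hx, hpn, ⟨-, ⟨j, -, hj⟩, -⟩, hxp⟩ := h
    have hpar := hparent' p (not_lt.2 hpn)
    rcases hxp with hxp | hxp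
    · refine ⟨1, ?_⟩
      rw [climb_succ']
      change (parent p).bind _ = _
      rw [hpar, Option.bind_some, climb]
      exact congrArg some (Fin.ext hxp.symm)
    · refine ⟨j + 1, ?_⟩
      rw [climb_succ']
      change (parent p).bind (climb parent j) = _
      rw [hpar, Option.bind_some, hclimb]
      rw [← hxp] at hj
      rw [(iterate_nextVertex_eq_iff F hp j ⟨gadgetFst n m p, hfst p (not_lt.2 hpn)⟩
        ⟨x, hx⟩).1 hj]
      rfl
  -- The test quantifies over a proof of the bound to make the coloring total on numbers; for
  -- vertices of the instance the bound holds.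
  let color : ℕ → ℕ := fun p =>
    if h : p < n then p * m + η ⟨p, h⟩
    else if ∀ h : gadgetFst n m p < n, (η ⟨_, h⟩ : ℕ) ≠ gadgetFstVal n m p then
      gadgetFst n m p * m + gadgetFstVal n m p
    else gadgetSnd n m p * m + gadgetSndVal n m p
  have hcolor_lt (p : ℕ) (hpN : p < gadgetCount n m) : color p < n * m := by
    simp only [color]
    split_ifs with h1 h2
    · exact mul_add_lt_mul h1 (η _).2
    · have := gadget_bounds hpN (not_lt.1 h1)
      exact mul_add_lt_mul this.1 this.2.2.1
    · have := gadget_bounds hpN (not_lt.1 h1)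
      exact mul_add_lt_mul this.2.1 this.2.2.2
  have hcolor_mem (p : ℕ) : gadgetDom n m dom p (color p) := by
    simp only [color]
    split_ifs with h1 h2
    · refine Or.inl ⟨h1, mul_add_div_of_lt (η _).2, ?_⟩
      rw [mul_add_mod_of_lt (η _).2]
      exact (hd ⟨p, h1⟩ _).1 (hη _)
    · exact Or.inr ⟨not_lt.1 h1, Or.inl rfl⟩
    · exact Or.inr ⟨not_lt.1 h1, Or.inr rfl⟩
  have hcode {x y a b : ℕ} (ha : a < m) (hb : b < m) (h : x * m + a = y * m + b) :
      x = y ∧ a = b := by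
    have h1 := congrArg (· / m) h
    have h2 := congrArg (· % m) h
    simp only [mul_add_div_of_lt ha, mul_add_div_of_lt hb, mul_add_mod_of_lt ha,
      mul_add_mod_of_lt hb] at h1 h2
    exact ⟨h1, h2⟩
  have hcolor_ne {x p : ℕ} (hpN : p < gadgetCount n m) (h : GadgetEdge n m k adj par con x p) :
      color x ≠ color p := by
    obtain ⟨hx, hpn, ⟨hadj, -, hcon⟩, hxp⟩ := h
    obtain ⟨b1, b2, b3, b4⟩ := gadget_bounds hpN hpn
    have huv := hne b1 b2 hadj
    intro heq
    simp only [color, dif_pos hx, dif_neg (not_lt.2 hpn)] at heq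
    by_cases h1 : ∀ h : gadgetFst n m p < n, (η ⟨_, h⟩ : ℕ) ≠ gadgetFstVal n m p
    · rw [if_pos h1] at heq
      have := hcode (η _).2 b3 heq
      have hxu := this.1
      subst hxu
      exact h1 b1 this.2
    · rw [if_neg h1] at heq
      push Not at h1
      obtain ⟨_, h1⟩ := h1
      have := hcode (η _).2 b4 heq
      have hxv := this.1
      subst hxv
      -- Both variables have the values of the gadget, so the constraint satisfied by `η` contains
      -- the very pair that the active gadget declares forbidden.
      have hsat := (hc _ _ _ _).1 ⟨(ha ⟨_, b1⟩ ⟨_, hx⟩).2 hadj,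
        hη' ⟨_, b1⟩ ⟨_, hx⟩ ((ha _ _).2 hadj)⟩
      rw [h1, this.2] at hsat
      exact hcon hsat
  rw [mem_listColoringTreedepth_graphWord]
  have hmemL (u : Fin (gadgetCount n m)) (c : Fin (n * m)) :
      c ∈ Finset.univ.filter (fun c : Fin (n * m) => gadgetDom n m dom u c) ↔
      gadgetDom n m dom u c := by simp
  refine ⟨⟨G', fun u => Finset.univ.filter fun c : Fin (n * m) => gadgetDom n m dom u c⟩, F', ?_,
    (F'.depth_le_iff _).2 hk', ⟨fun p => ⟨color p, hcolor_lt p p.2⟩,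
      fun u => (hmemL _ _).2 (hcolor_mem u), ?_⟩, fun _ _ => Iff.rfl, hF'par, hmemL⟩
  · rintro x y (⟨hx, hy, h⟩ | h | h)
    · have hlift {u v : Fin n} : F.IsAncestor u v → F'.IsAncestor (e u) (e v) := by
        rintro ⟨j, hj⟩
        refine ⟨j, ?_⟩
        change climb parent j (e v) = _
        rw [hclimb, hj, Option.map_some]
      exact (hF ⟨x, hx⟩ ⟨y, hy⟩ ((ha _ _).2 h)).imp hlift hlift
    · exact Or.inl (hancestor h)
    · exact Or.inr (hancestor h)
  · rintro x y hxy heq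
    have heq : color x = color y := congrArg Fin.val heq
    rcases hxy with ⟨hx, hy, h⟩ | h | h
    -- Colors of different variables already differ in the quotient by `m`.
    · simp only [color, dif_pos hx, dif_pos hy] at heq
      exact hne hx hy h (hcode (η _).2 (η _).2 heq).1
    · exact hcolor_ne y.2 h heq
    · exact hcolor_ne x.2 h heq.symm

end gadget


/-! ### Computability of the reduction to List Coloring -/

theorem ls_nextVertex : LS fun w v => nextVertex (vertexCount w) (wordPar w) (v 0) := by
  classical
  have h1 := (LP.lt (LS.var 0) LS.vertexCount).and (LP.exists_lt
    (P := fun w y v => wordPar w (v 0) y) LS.vertexCount (LP.wordPar (LS.var 1) (LS.var 0)))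
  have h2 := LS.sum (b := fun w y v => if wordPar w (v 0) y then y else 0) LS.vertexCount
    (LS.ite (LP.wordPar (LS.var 1) (LS.var 0)) (LS.var 0) (LS.const 0))
  have h3 := LS.ite h1 h2 LS.vertexCount
  unfold nextVertex
  convert h3

theorem ones_le_length (w : Word) (s : ℕ) : ones w s ≤ w.length := by
  classical
  calc ones w s ≤ ∑ i ∈ Finset.range w.length, 1 :=
      Finset.sum_le_sum fun i _ => by split_ifs <;> simp
    _ = w.length := by simp

/-- The program also runs on words that encode no forest, where the sum may have several nonzero
terms; hence a quadratic bound that assumes nothing about `par`. -/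
theorem nextVertex_le (n : ℕ) (par : ℕ → ℕ → Prop) (u : ℕ) :
    nextVertex n par u ≤ (n + 1) * (n + 1) := by
  classical
  rw [nextVertex]
  split_ifs
  · calc ∑ y ∈ Finset.range n, (if par u y then y else 0) ≤ ∑ y ∈ Finset.range n, n :=
        Finset.sum_le_sum fun y hy => by
          have := Finset.mem_range.1 hy
          split_ifs <;> omega
      _ = n * n := by simp
      _ ≤ (n + 1) * (n + 1) := Nat.mul_le_mul (Nat.le_succ n) (Nat.le_succ n)
  · nlinarith

/-- Provides the uniform bound for the iteration: the start is an entry of the environment, and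
every later iterate is at most `(n + 1) * (n + 1)`, where `n` is at most the length of the word. -/
theorem lp_isAbove :
    LP fun w v => IsAbove (vertexCount w) (tallyCount w) (wordPar w) (v 0) (v 1) := by
  have h := LS.iterate (c := fun _ v => v 0) (a := fun _ v => v 1)
    (s := fun w x _ => nextVertex (vertexCount w) (wordPar w) x) (LS.var 0) (LS.var 1)
    ls_nextVertex 2 fun w v B hB hv j => ?_
  · exact LP.exists_lt (P := fun w j v =>
      (nextVertex (vertexCount w) (wordPar w))^[j] (v 0) = v 1) LS.tallyCount
      (LP.eq h (LS.var 2))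
  · cases j with
    | zero => exact (hv 1).trans (Nat.le_self_pow two_ne_zero B)
    | succ j =>
      rw [Function.iterate_succ_apply', sq]
      have := ones_le_length w 0
      exact (nextVertex_le _ _ _).trans (Nat.mul_le_mul (by rw [vertexCount]; omega)
        (by rw [vertexCount]; omega))

/-- In the nested environments the innermost quantified variable has index 0, so `u`, `v`, `a`, `b`
end up at 3, 2, 1, 0. -/
theorem lp_conValid : LP fun w _ =>
    ConValid (vertexCount w) (valueCount w) (wordAdj w) (wordDom w) (wordCon w) := by
  have h := (LP.wordCon (LS.var 3) (LS.var 2) (LS.var 1) (LS.var 0)).imp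
    ((LP.wordAdj (LS.var 3) (LS.var 2)).and ((LP.wordDom (LS.var 3) (LS.var 1)).and
      ((LP.wordDom (LS.var 2) (LS.var 0)).and
        (LP.wordCon (LS.var 2) (LS.var 3) (LS.var 0) (LS.var 1)))))
  exact LP.forall_lt (P := fun w u _ => ∀ v < vertexCount w, ∀ a < valueCount w,
      ∀ b < valueCount w, wordCon w u v a b →
        wordAdj w u v ∧ wordDom w u a ∧ wordDom w v b ∧ wordCon w v u b a) LS.vertexCount <|
    LP.forall_lt (P := fun w x v => ∀ a < valueCount w,
      ∀ b < valueCount w, wordCon w (v 0) x a b →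
        wordAdj w (v 0) x ∧ wordDom w (v 0) a ∧ wordDom w x b ∧ wordCon w x (v 0) b a)
      LS.vertexCount <|
    LP.forall_lt (P := fun w a v => ∀ b < valueCount w, wordCon w (v 1) (v 0) a b →
        wordAdj w (v 1) (v 0) ∧ wordDom w (v 1) a ∧ wordDom w (v 0) b ∧
          wordCon w (v 0) (v 1) b a) LS.valueCount <|
    LP.forall_lt (P := fun w b v => wordCon w (v 2) (v 1) (v 0) b →
        wordAdj w (v 2) (v 1) ∧ wordDom w (v 2) (v 0) ∧ wordDom w (v 1) b ∧
          wordCon w (v 1) (v 2) b (v 0)) LS.valueCount h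

section gadget

variable {f : Word → (ℕ → ℕ) → ℕ}

theorem ls_gadgetFst (hf : LS f) :
    LS fun w v => gadgetFst (vertexCount w) (valueCount w) (f w v) :=
  (hf.sub LS.vertexCount).div (LS.vertexCount.mul (LS.valueCount.mul LS.valueCount))

theorem ls_gadgetSnd (hf : LS f) :
    LS fun w v => gadgetSnd (vertexCount w) (valueCount w) (f w v) :=
  ((hf.sub LS.vertexCount).div (LS.valueCount.mul LS.valueCount)).mod LS.vertexCount

theorem ls_gadgetFstVal (hf : LS f) :
    LS fun w v => gadgetFstVal (vertexCount w) (valueCount w) (f w v) :=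
  ((hf.sub LS.vertexCount).div LS.valueCount).mod LS.valueCount

theorem ls_gadgetSndVal (hf : LS f) :
    LS fun w v => gadgetSndVal (vertexCount w) (valueCount w) (f w v) :=
  (hf.sub LS.vertexCount).mod LS.valueCount

theorem lp_gadgetActive (hf : LS f) : LP fun w v => GadgetActive (vertexCount w) (valueCount w)
    (tallyCount w) (wordAdj w) (wordPar w) (wordCon w) (f w v) :=
  (LP.wordAdj (ls_gadgetFst hf) (ls_gadgetSnd hf)).and
    ((LP.comp₂ (P := fun w a b => IsAbove (vertexCount w) (tallyCount w) (wordPar w) a b)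
      lp_isAbove (ls_gadgetFst hf) (ls_gadgetSnd hf)).and
    (LP.wordCon (ls_gadgetFst hf) (ls_gadgetSnd hf) (ls_gadgetFstVal hf)
      (ls_gadgetSndVal hf)).not)

variable {g : Word → (ℕ → ℕ) → ℕ}

theorem lp_gadgetEdge (hf : LS f) (hg : LS g) : LP fun w v => GadgetEdge (vertexCount w)
    (valueCount w) (tallyCount w) (wordAdj w) (wordPar w) (wordCon w) (f w v) (g w v) :=
  (LP.lt hf LS.vertexCount).and ((LP.le LS.vertexCount hg).and ((lp_gadgetActive hg).and
    ((LP.eq hf (ls_gadgetFst hg)).or (LP.eq hf (ls_gadgetSnd hg)))))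

theorem lp_gadgetAdj (hf : LS f) (hg : LS g) : LP fun w v => gadgetAdj (vertexCount w)
    (valueCount w) (tallyCount w) (wordAdj w) (wordPar w) (wordCon w) (f w v) (g w v) :=
  ((LP.lt hf LS.vertexCount).and ((LP.lt hg LS.vertexCount).and (LP.wordAdj hf hg))).or
    ((lp_gadgetEdge hf hg).or (lp_gadgetEdge hg hf))

theorem lp_gadgetPar (hf : LS f) (hg : LS g) : LP fun w v => gadgetPar (vertexCount w)
    (valueCount w) (wordPar w) (f w v) (g w v) :=
  (LP.lt hg LS.vertexCount).and (((LP.lt hf LS.vertexCount).and (LP.wordPar hf hg)).or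
    ((LP.le LS.vertexCount hf).and (LP.eq hg (ls_gadgetFst hf))))

theorem lp_gadgetDom (hf : LS f) (hg : LS g) : LP fun w v => gadgetDom (vertexCount w)
    (valueCount w) (wordDom w) (f w v) (g w v) :=
  ((LP.lt hf LS.vertexCount).and ((LP.eq (hg.div LS.valueCount) hf).and
    (LP.wordDom hf (hg.mod LS.valueCount)))).or ((LP.le LS.vertexCount hf).and
    ((LP.eq hg (((ls_gadgetFst hf).mul LS.valueCount).add (ls_gadgetFstVal hf))).or
      (LP.eq hg (((ls_gadgetSnd hf).mul LS.valueCount).add (ls_gadgetSndVal hf)))))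

end gadget

theorem ls_gadgetCount : LS fun w _ => gadgetCount (vertexCount w) (valueCount w) :=
  LS.vertexCount.add (LS.vertexCount.mul (LS.vertexCount.mul (LS.valueCount.mul LS.valueCount)))

/-- The reduction from BinCSP to List Coloring. -/
noncomputable def binCSPToListColoring : List Bool × ℕ → List Bool × ℕ :=
  guardedMap (fun w => bitCount w = graphLength w +
      vertexCount w * (vertexCount w * (valueCount w * valueCount w)) ∧
      ConValid (vertexCount w) (valueCount w) (wordAdj w) (wordDom w) (wordCon w))
    (fun w => graphWord (gadgetCount (vertexCount w) (valueCount w))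
      (vertexCount w * valueCount w)
      (gadgetAdj (vertexCount w) (valueCount w) (tallyCount w) (wordAdj w) (wordPar w) (wordCon w))
      (gadgetPar (vertexCount w) (valueCount w) (wordPar w))
      (gadgetDom (vertexCount w) (valueCount w) (wordDom w)))
    (fun w => tallyCount w + 1)

/-- Defects of the graph or the forest survive in the gadget instance. Defects of the constraints
would be hidden by it, so `ConValid` is tested beforehand; true encodings pass the test by `C_sub`
and `C_symm`. -/
theorem binCSPToListColoring_mem (z : List Bool × ℕ) :
    binCSPToListColoring z ∈ listColoringTreedepth ↔ z ∈ binCSPTreedepth := by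
  obtain ⟨x, k⟩ := z
  rw [binCSPToListColoring, guardedMap]
  split_ifs with h
  · obtain ⟨h, hcon⟩ := h
    rw [bitCount_tapeWord] at h
    have hx := eq_graphWord_append x k _ rfl (by omega)
    rw [drop_eq_constraintWord x k _ rfl h] at hx
    have hk := tallyCount_tapeWord x k
    rw [hk]
    refine ⟨fun h => ?_, fun h => ?_⟩
    · have := binCSP_mem_of_gadget_mem hcon h
      rwa [← hx] at this
    · rw [hx] at h
      exact gadget_mem_of_binCSP_mem h
  · refine iff_of_false (nil_notMem_listColoringTreedepth 0) fun hmem => h ?_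
    obtain ⟨n, m, I, F, -, -, hx, -⟩ := hmem
    rw [I.encode_eq F] at hx
    obtain ⟨hn, hm, hlen⟩ := counts_of_eq x k _ rfl hx
    rw [length_constraintWord] at hlen
    have hlen' : x.length = graphLength (tapeWord (x, k)) + vertexCount (tapeWord (x, k)) *
        (vertexCount (tapeWord (x, k)) *
          (valueCount (tapeWord (x, k)) * valueCount (tapeWord (x, k)))) := by
      rw [hn, hm, hlen]
    refine ⟨by rw [bitCount_tapeWord, hlen'], ?_⟩
    -- The word now has two parses, by the given instance and by the decoders. Comparing them
    -- carries the properties of the instance over to the decoded relations.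
    have hx' := eq_graphWord_append x k _ rfl (by omega)
    rw [drop_eq_constraintWord x k _ rfl hlen'] at hx'
    have heq := hx.symm.trans hx'
    rw [hn, hm] at heq ⊢
    obtain ⟨-, -, ha, -, hd, hc⟩ := graphWord_append_inj heq
    have hc := constraintWord_inj hc
    intro u hu v hv a ha' b hb h
    rw [← hc u hu v hv a ha' b hb] at h
    obtain ⟨_, _, _, _, hadj, hmem⟩ := h
    rw [← ha u hu v hv, ← hd u hu a ha', ← hd v hv b hb, ← hc v hv u hu b hb a ha']
    obtain ⟨h1, h2⟩ := I.C_sub _ _ hadj _ _ hmem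
    exact ⟨⟨hu, hv, hadj⟩, ⟨hu, ha', h1⟩, ⟨hv, hb, h2⟩, hv, hu, hb, ha', hadj.symm,
      (I.C_symm _ _ hadj _ _).1 hmem⟩

theorem binCSPToListColoring_snd_le (z : List Bool × ℕ) :
    (binCSPToListColoring z).2 ≤ z.2 + 1 := by
  rw [binCSPToListColoring, guardedMap]
  split_ifs
  · exact Nat.succ_le_succ (tallyCount_tapeWord z.1 z.2).le
  · exact Nat.zero_le _

theorem plComputable_binCSPToListColoring_comp {α : Type} {R : List α × ℕ → List Bool × ℕ}
    (hR : PLComputable R) : PLComputable (binCSPToListColoring ∘ R) := by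
  have hg := LSO.graphWord (adj := fun w _ => gadgetAdj (vertexCount w) (valueCount w)
      (tallyCount w) (wordAdj w) (wordPar w) (wordCon w))
    (par := fun w _ => gadgetPar (vertexCount w) (valueCount w) (wordPar w))
    (dom := fun w _ => gadgetDom (vertexCount w) (valueCount w) (wordDom w))
    ls_gadgetCount (LS.vertexCount.mul LS.valueCount)
    (lp_gadgetAdj (LS.var 1) (LS.var 0)) (lp_gadgetPar (LS.var 1) (LS.var 0))
    (lp_gadgetDom (LS.var 1) (LS.var 0))
  have hp := (LP.eq LS.bitCount (LS.graphLength.add (LS.vertexCount.mul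
    (LS.vertexCount.mul (LS.valueCount.mul LS.valueCount))))).and lp_conValid
  exact plComputable_guardedMap_comp hR hp hg LS.tallyCount.succ

/-- Every problem in XSLP comes with a reduction to BinCSP; the gadget map is appended to it, and
the parameter bound grows by one. -/
theorem plReducible_listColoringTreedepth {α : Type} {Q : ParamProblem α} (hQ : InXSLP Q) :
    PLReducible Q listColoringTreedepth := by
  obtain ⟨R, hR, ⟨g, hg, hle⟩, hpl⟩ := hQ
  refine ⟨binCSPToListColoring ∘ R, fun z => (hR z).trans (binCSPToListColoring_mem _).symm,
    ⟨fun k => g k + 1, Primrec.succ.to_comp.comp hg, fun z => ?_⟩,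
    plComputable_binCSPToListColoring_comp hpl⟩
  exact (binCSPToListColoring_snd_le _).trans (Nat.succ_le_succ (hle z))

end ParamCplx

theorem mainTheorem8 :
    ParamCplx.XSLPComplete ParamCplx.listColoringTreedepth :=
  ⟨ParamCplx.inXSLP_listColoringTreedepth,
    fun _ _ _ hQ => ParamCplx.plReducible_listColoringTreedepth hQ⟩
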